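/- **Setting (entanglement-based symmetric six-state protocol, collective attacks).** All logarithms $\log$ are to base $2$. For $0\le e\le 2/3$ put $\lambda_0=\frac{2-3e}{2}$, $\lambda_1=\lambda_2=\lambda_3=\frac e2$, and let $|\Psi_e\rangle_{ABE}=\sum_{i=0}^3\sqrt{\lambda_i}\,|\mathrm{Bell}_i\rangle_{AB}|i\rangle_E$ with $\mathrm{Bell}_{0,1}=(|00\rangle\pm|11\rangle)/\sqrt2$, $\mathrm{Bell}_{2,3}=(|01\rangle\pm|10\rangle)/\sqrt2$. Alice and Bob measure $n\ge1$ copies of $|\Psi_e\rangle$ in the computational basis, with outcomes $X,Y\in\{0,1\}^n$; the number $e$ is the QBER. Write $\rho_{XE}^{\otimes n}=2^{-n}\sum_x|x\rangle\langle x|\otimes\rho^x_{E^n}$ and $\rho_E^{\otimes n}$ for the resulting states of Alice's string and Eve's systems, and of Eve's systems alone. **Entropies.** $S_0(\sigma)=\log\operatorname{rank}\sigma$, $S_2(\sigma)=-\log\operatorname{tr}\sigma^2$, $S_\infty(P)=-\log\max_c P(c)$. For a positive operator $A$ let $S_0^{\varepsilon}(A)=\inf\{S_0(\sigma):\sigma\ge0,\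 \operatorname{tr}\sigma=1,\ \frac12\|\sigma-A\|_1\le\frac\varepsilon2\}$. The modified smooth entropy is $\overline S_2^{\varepsilon}(\rho_{XE}^{\otimes n})=S_2(\tau)$, $\tau=2^{-n}\sum_x|x\rangle\langle x|\otimes\sum_{i=0}^{n+1}\mu_iP_i^x$. Here $0<e<\frac12$, $\Lambda_0<\dots<\Lambda_{n+1}$ are the distinct eigenvalues of a block $\rho^x_{E^n}$ (they do not depend on $x$), $m_i$ their multiplicities, $P_i^x$ the spectral projectors, and, with $s_r=\sum_{i=1}^r m_{n-i+2}(\Lambda_{n-i+2}-\Lambda_{n-r+1})$, $b=\max\{0\le r\le n+1: s_r\le\frac\varepsilon2\}$ and $\Lambda_+=\Lambda_{n-b+1}-(\frac\varepsilon2-s_b)/\sum_{i=0}^b m_{n-i+1}$, one sets $\mu_0=\frac{\varepsilon}{2m_0}$, $\mu_i=\Lambda_i$ for $1\le i\le n-b$ and $\mu_i=\Lambda_+$ for $n+1-b\le i\le n+1$. **Protocol.** $N\ge n$ signals are sent. Parameter estimation on $m_Z\ge1$ bits has a (public) outcome $t$ in a finite set, with probability $p_t$, independent of the $n$ key signals;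 it gives a measured QBER $e_m(t)\ge0$ and the estimate $e'(t)=e_m(t)+2\zeta(\varepsilon_{PE},m_Z)$, where $\zeta(\varepsilon_{PE},m)=\sqrt{\frac{\ln(1/\varepsilon_{PE})+2\ln(m+1)}{8m}}$. One-way error correction: Alice sends a public transcript $c\in\mathcal C$ with probability $P(c|x)$, Bob replaces $Y$ by a function of $(c,Y)$; its leakage is $\log|\mathcal C|-\inf_xS_\infty(P(\cdot|x))$. Privacy amplification: a function $f:\{0,1\}^n\to\{0,1\}^\ell$ from a two-universal family is chosen at random, is published, and is applied by both parties to their strings. Error correction, $\ell$ and the family may depend on $t$; $\ell=0$ means that no key is produced. **Rate.** For $\varepsilon_{PA},\varepsilon_{EC}>0$, $\overline\varepsilon\ge0$, $f_{EC}\in\mathbb R$ and $0<e<\frac12$ let $\mathrm{leak}_{EC}(e)=f_{EC}\,n\,h(e)+\log\frac{2}{\varepsilon_{EC}}$, with $h$ the binary entropy, $\bar\delta=\frac{\overline\varepsilon/2}{2^{2n+1}}\mathbb 1$, and $$r(e)=\frac1N\Big[\overline S_2^{\overline\varepsilon/2}(\rho_{XE}^{\otimes n})-S_0^{\overline\varepsilon/2}(\rho_E^{\otimes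 n}+\bar\delta)-\overline\varepsilon-\mathrm{leak}_{EC}(e)+2\log(2\varepsilon_{PA})\Big].$$ **Proposition.** Let $\varepsilon_{PE}>0$, and let the true QBER $e\in[0,2/3]$ satisfy $e\le e'(t)$ with probability at least $1-\varepsilon_{PE}$ over $t$. Suppose that whenever a key is produced ($\ell(t)\ne0$) one has $e'(t)<\frac12$, the leakage of the error correction is at most $\mathrm{leak}_{EC}(e'(t))$, and $\ell(t)/N\le r(e'(t))$; and that the probability that a key is to be produced and Alice's and Bob's strings differ after error correction is at most $\varepsilon_{EC}$. Then two-universal families $\{0,1\}^n\to\{0,1\}^{\ell(t)}$ exist, and for every choice of them the final keys are $\varepsilon$-secure with $\varepsilon=\varepsilon_{PE}+\varepsilon_{PA}+\overline\varepsilon+\varepsilon_{EC}$: the joint state of Alice's key, Bob's key, and all of Eve's information (her quantum systems, $t$, the transcript and $f$) has trace distance $\frac12\|\cdot\|_1\le\varepsilon$ from the state in which both keys are equal, uniform, and independent of Eve's information. In this sense Alice and Bob can achieve the secret key rate $r(e_m+2\zeta(\varepsilon_{PE},m_Z))$. -/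

import Mathlib

noncomputable section

namespace QKD

open Matrix Finset
open scoped ComplexOrder

/-! ### States, trace norm, entropies -/

section Entropies

variable {ι : Type*} [Fintype ι]

/-- The density operators on the finite-dimensional space with orthonormal basis `ι`. -/
def IsState (σ : Matrix ι ι ℂ) : Prop :=
  σ.PosSemidef ∧ σ.trace = 1

open Classical in
/-- The trace norm `tr √(A A†)`: the sum of the square roots of the eigenvalues of `A A†`. -/
def traceNorm (A : Matrix ι ι ℂ) : ℝ :=
  ∑ i, √((isHermitian_mul_conjTranspose_self A).eigenvalues i)

/-- The `ε`-environment of `A`: all normalized states at trace distance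
`½ ‖σ - A‖₁ ≤ ε` from `A`. The centre `A` need not be normalized. -/
def ball (ε : ℝ) (A : Matrix ι ι ℂ) : Set (Matrix ι ι ℂ) :=
  {σ | IsState σ ∧ traceNorm (σ - A) / 2 ≤ ε}

/-- The Rényi entropy of order zero, `log₂ rank σ`. -/
def renyiZero (σ : Matrix ι ι ℂ) : ℝ :=
  Real.logb 2 (σ.rank : ℝ)

/-- The Rényi entropy of order two, `-log₂ tr σ²`. -/
def renyiTwo (σ : Matrix ι ι ℂ) : ℝ :=
  -Real.logb 2 (σ * σ).trace.re

/-- The smooth Rényi entropy of order zero: the infimum of `log₂ rank σ` over the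
`ε/2`-environment. -/
def smoothRenyiZero (ε : ℝ) (A : Matrix ι ι ℂ) : ℝ :=
  sInf (renyiZero '' ball (ε / 2) A)

end Entropies

/-! ### Spectral data of one block, and the modified smooth Rényi entropy of order two -/

section Modified

variable {ι : Type*} [Fintype ι] [DecidableEq ι] {B : Matrix ι ι ℂ}

/-- `Λ_i`: the `i`-th distinct eigenvalue of `B`, in increasing order, counted from `0`. -/
def eigLevel (hB : B.IsHermitian) (i : ℕ) : ℝ :=
  ((univ.image hB.eigenvalues).sort (· ≤ ·)).getD i 0

/-- `m_i`: the multiplicity of the eigenvalue `Λ_i`. -/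
def eigMult (hB : B.IsHermitian) (i : ℕ) : ℕ :=
  #{j | hB.eigenvalues j = eigLevel hB i}

/-- The projector onto the eigenspace of `B` for the eigenvalue `v`. -/
def eigProj (hB : B.IsHermitian) (v : ℝ) : Matrix ι ι ℂ :=
  (hB.eigenvectorUnitary : Matrix ι ι ℂ) *
    diagonal (fun j => if hB.eigenvalues j = v then (1 : ℂ) else 0) *
    (hB.eigenvectorUnitary : Matrix ι ι ℂ)ᴴ

/-- `s_r⁺ = ∑_{i=1}^r m_{n-i+2} (Λ_{n-i+2} - Λ_{n-r+1})`, for a block with `n + 2` distinct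
eigenvalues and `0 ≤ r ≤ n + 1`: the weight that is lost when the `r` largest distinct
eigenvalues are lowered to the next one. -/
def sPlus (hB : B.IsHermitian) (n r : ℕ) : ℝ :=
  ∑ i ∈ Icc 1 r, (eigMult hB (n + 2 - i) : ℝ) * (eigLevel hB (n + 2 - i) - eigLevel hB (n + 1 - r))

open Classical in
/-- `b⁺ = max {r : s_r⁺ ≤ ε/2}`, where `0 ≤ r ≤ n + 1`. -/
def bPlus (hB : B.IsHermitian) (n : ℕ) (ε : ℝ) : ℕ :=
  ((range (n + 2)).filter (fun r => sPlus hB n r ≤ ε / 2)).sup id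

/-- `Λ₊ = Λ_{n-b⁺+1} - (ε/2 - s_{b⁺}) / ∑_{i=0}^{b⁺} m_{n-i+1}`. -/
def levelPlus (hB : B.IsHermitian) (n : ℕ) (ε : ℝ) : ℝ :=
  eigLevel hB (n + 1 - bPlus hB n ε) -
    (ε / 2 - sPlus hB n (bPlus hB n ε)) /
      ∑ i ∈ range (bPlus hB n ε + 1), (eigMult hB (n + 1 - i) : ℝ)

/-- The modified eigenvalues `μ_i`, `0 ≤ i ≤ n + 1`: the top of the spectrum is lowered to `Λ₊`,
and the removed weight `ε/2` is spread evenly over the eigenspace of `Λ_0`. -/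
def modEig (hB : B.IsHermitian) (n : ℕ) (ε : ℝ) (i : ℕ) : ℝ :=
  if i = 0 then ε / (2 * eigMult hB 0)
  else if i + bPlus hB n ε ≤ n then eigLevel hB i
  else levelPlus hB n ε

end Modified

/-- Bit strings of length `n`. -/
abbrev BitString (n : ℕ) : Type := Fin n → Bool

/-- The cq-operator `τ = 2⁻ⁿ ∑_x |x⟩⟨x| ⊗ τ^x`, `τ^x = ∑_i μ_i P_i^x`, where `P_i^x` projects onto
the eigenspace of the `i`-th distinct eigenvalue of the (normalized) block `B x`. -/
def tauOp {ι : Type*} [Fintype ι] [DecidableEq ι] {n : ℕ} {B : BitString n → Matrix ι ι ℂ}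
    (hB : ∀ x, (B x).IsHermitian) (ε : ℝ) : Matrix (ι × BitString n) (ι × BitString n) ℂ :=
  blockDiagonal fun x : BitString n =>
    ((2 : ℂ) ^ n)⁻¹ •
      ∑ i ∈ range (n + 2), ((modEig (hB x) n ε i : ℝ) : ℂ) • eigProj (hB x) (eigLevel (hB x) i)

/-- The modified smooth Rényi entropy of order two of `2⁻ⁿ ∑_x |x⟩⟨x| ⊗ B x`. -/
def modRenyiTwo {ι : Type*} [Fintype ι] [DecidableEq ι] {n : ℕ} {B : BitString n → Matrix ι ι ℂ}
    (hB : ∀ x, (B x).IsHermitian) (ε : ℝ) : ℝ :=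
  renyiTwo (tauOp hB ε)

/-! ### The symmetric six-state protocol under collective attacks -/

/-- The Bell-diagonal weights of the symmetric six-state protocol with QBER `e`. -/
def bellWeight (e : ℝ) (i : Fin 4) : ℝ :=
  if i = 0 then (2 - 3 * e) / 2 else e / 2

/-- The coefficients `⟨a b | Bell_i⟩` of the four Bell states
`(|00⟩ ± |11⟩)/√2`, `(|01⟩ ± |10⟩)/√2`. -/
def bellCoeff (i : Fin 4) (a b : Bool) : ℂ :=
  (if (i = 0 ∨ i = 1) ↔ a = b then 1 else 0) * (if (i = 1 ∨ i = 3) ∧ a = true then -1 else 1) /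
    ((√2 : ℝ) : ℂ)

/-- Orthonormal basis of Eve's system for `n` signals. -/
abbrev EveIdx (n : ℕ) : Type := Fin n → Fin 4

/-- Eve's unnormalized vector `⟨x y | Ψ^{⊗n}⟩` when Alice and Bob measure `x` and `y` in the
computational basis, where `|Ψ⟩ = ∑_i √λ_i |Bell_i⟩_{AB} |i⟩_E` purifies the Bell-diagonal state. -/
def eveVec (e : ℝ) {n : ℕ} (x y : BitString n) : EveIdx n → ℂ :=
  fun i => ∏ p, ((√(bellWeight e (i p)) : ℝ) : ℂ) * bellCoeff (i p) (x p) (y p)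

/-- Eve's unnormalized state given Alice's string `x` and Bob's string `y`; its trace is the
probability of `(x, y)`. -/
def rhoXYE (e : ℝ) {n : ℕ} (x y : BitString n) : Matrix (EveIdx n) (EveIdx n) ℂ :=
  vecMulVec (eveVec e x y) (star (eveVec e x y))

/-- The normalized block of `ρ_{XE}^{⊗n} = 2⁻ⁿ ∑_x |x⟩⟨x| ⊗ ρ_{Eⁿ}^x`: Bob is traced out, and
Alice's string has probability `2⁻ⁿ`. -/
def eveBlock (e : ℝ) {n : ℕ} (x : BitString n) : Matrix (EveIdx n) (EveIdx n) ℂ :=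
  (2 : ℂ) ^ n • ∑ y, rhoXYE e x y

/-- Eve's state `ρ_E^{⊗n}`. -/
def rhoE (e : ℝ) (n : ℕ) : Matrix (EveIdx n) (EveIdx n) ℂ :=
  ∑ x : BitString n, ∑ y : BitString n, rhoXYE e x y

theorem eveBlock_isHermitian (e : ℝ) {n : ℕ} (x : BitString n) : (eveBlock e x).IsHermitian := by
  have h : ∀ y, (rhoXYE e x y)ᴴ = rhoXYE e x y := fun y =>
    (posSemidef_vecMulVec_self_star (eveVec e x y)).isHermitian
  unfold Matrix.IsHermitian eveBlock
  rw [conjTranspose_smul, conjTranspose_sum]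
  simp [h]

/-! ### Parameter estimation, error correction, privacy amplification -/

/-- `ζ(ε_PE, m)`. -/
def zeta (εPE : ℝ) (m : ℕ) : ℝ :=
  √((Real.log (1 / εPE) + 2 * Real.log (m + 1)) / (8 * m))

/-- The estimate `e_m + 2ζ(ε_PE, m)` of the QBER, from the measured value `e_m`. -/
def qberEst (eM εPE : ℝ) (m : ℕ) : ℝ :=
  eM + 2 * zeta εPE m

/-- The binary Shannon entropy, with base-two logarithms. -/
def binEnt (e : ℝ) : ℝ :=
  -e * Real.logb 2 e - (1 - e) * Real.logb 2 (1 - e)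

/-- `leak_EC = f_EC n h(e) + log₂(2/ε_EC)`. -/
def leakEC (fEC : ℝ) (n : ℕ) (e εEC : ℝ) : ℝ :=
  fEC * n * binEnt e + Real.logb 2 (2 / εEC)

/-- A one-way error correction protocol on strings of length `n`: given `x`, Alice sends the
transcript `c` with probability `prob x c`, and Bob replaces his string `y` by `decode c y`. -/
structure ECProtocol (n : ℕ) where
  C : Type
  fintypeC : Fintype C
  prob : BitString n → C → ℝ
  prob_nonneg : ∀ x c, 0 ≤ prob x c
  prob_sum : ∀ x, ∑ c, prob x c = 1
  decode : C → BitString n → BitString n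

attribute [instance] ECProtocol.fintypeC

/-- The number of leaked bits, `log₂ |C| - inf_x S_∞(P_{C|X=x})`, where
`S_∞(P) = -log₂ max_c P(c)`. -/
def ECProtocol.leak {n : ℕ} (P : ECProtocol n) : ℝ :=
  Real.logb 2 (Fintype.card P.C) - ⨅ x, -Real.logb 2 (⨆ c, P.prob x c)

/-- The probability, for signals with QBER `e`, that Alice's and Bob's strings differ after the
error correction. -/
def ECProtocol.failProb {n : ℕ} (P : ECProtocol n) (e : ℝ) : ℝ :=
  ∑ x, ∑ y, ∑ c, if P.decode c y = x then 0 else (rhoXYE e x y).trace.re * P.prob x c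

/-- A finite family of functions from strings of length `n` to strings of length `ℓ`, together
with a probability distribution on it. -/
structure HashFamily (n ℓ : ℕ) where
  F : Type
  fintypeF : Fintype F
  prob : F → ℝ
  prob_nonneg : ∀ f, 0 ≤ prob f
  prob_sum : ∑ f, prob f = 1
  hash : F → BitString n → BitString ℓ

attribute [instance] HashFamily.fintypeF

/-- Two-universality: distinct strings collide with probability at most `1/|{0,1}^ℓ| = 2^{-ℓ}`. -/
def HashFamily.IsTwoUniversal {n ℓ : ℕ} (H : HashFamily n ℓ) : Prop :=
  ∀ x x', x ≠ x' → ∑ f, (if H.hash f x = H.hash f x' then H.prob f else 0) ≤ 1 / 2 ^ ℓ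

/-! ### The state at the end of the protocol, security, and the rate -/

section Final

variable {n : ℕ} {T : Type} {ℓ : T → ℕ}

/-- The values of the classical registers at the end of the protocol: the outcome `t` of the
parameter estimation, Alice's key, Bob's key, the error correction transcript, and the hash
function. Everything except the two keys is public. -/
abbrev Registers (EC : T → ECProtocol n) (H : ∀ t, HashFamily n (ℓ t)) : Type :=
  Σ t : T, BitString (ℓ t) × BitString (ℓ t) × (EC t).C × (H t).F

variable [Fintype T]

open Classical in
/-- The final state of both keys, the public registers and Eve's quantum system, for signals with
QBER `e`; `p` is the distribution of the outcome of the parameter estimation. -/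
def realState (e : ℝ) (p : T → ℝ) (EC : T → ECProtocol n) (H : ∀ t, HashFamily n (ℓ t)) :
    Matrix (EveIdx n × Registers EC H) (EveIdx n × Registers EC H) ℂ :=
  blockDiagonal fun ⟨t, kA, kB, c, f⟩ =>
    ∑ x, ∑ y,
      if (H t).hash f x = kA ∧ (H t).hash f ((EC t).decode c y) = kB then
        ((p t * (H t).prob f * (EC t).prob x c : ℝ) : ℂ) • rhoXYE e x y
      else 0

open Classical in
/-- The ideal state: both parties hold the same key, which is uniform and independent of the
public registers and Eve's system, whose joint state is that of the real protocol. -/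
def idealState (e : ℝ) (p : T → ℝ) (EC : T → ECProtocol n) (H : ∀ t, HashFamily n (ℓ t)) :
    Matrix (EveIdx n × Registers EC H) (EveIdx n × Registers EC H) ℂ :=
  blockDiagonal fun ⟨t, kA, kB, c, f⟩ =>
    if kA = kB then
      ((1 / 2 ^ ℓ t : ℝ) : ℂ) •
        ∑ x, ∑ y, ((p t * (H t).prob f * (EC t).prob x c : ℝ) : ℂ) • rhoXYE e x y
    else 0

/-- `ε`-security of the final keys: trace distance at most `ε` from the ideal state. -/
def IsSecure (ε : ℝ) (e : ℝ) (p : T → ℝ) (EC : T → ECProtocol n)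
    (H : ∀ t, HashFamily n (ℓ t)) : Prop :=
  traceNorm (realState e p EC H - idealState e p EC H) / 2 ≤ ε

end Final

/-- The operator `δ̄ = ε̂ / 2^{2n+1} · 𝟙` on Eve's `n` systems. -/
def deltaBar (εhat : ℝ) (n : ℕ) : Matrix (EveIdx n) (EveIdx n) ℂ :=
  ((εhat / 2 ^ (2 * n + 1) : ℝ) : ℂ) • 1

/-- The secret key rate at QBER `e`, with `ε̂ = ε̄/2`. -/
def keyRate (N n : ℕ) (fEC εPA εEC εbar e : ℝ) : ℝ :=
  (1 / N) *
    (modRenyiTwo (fun x : BitString n => eveBlock_isHermitian e x) (εbar / 2)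
      - smoothRenyiZero (εbar / 2) (rhoE e n + deltaBar (εbar / 2) n)
      - εbar - leakEC fEC n e εEC + 2 * Real.logb 2 (2 * εPA))

end QKD

end

/-! Security splits into correctness, paid for by ε_EC, and secrecy of Alice's key (`blockDist_le`);
the outcomes t with e > e'(t) cost at most ε_PE altogether. It remains to bound the secrecy at a
true QBER e ≤ e' by ε_PA + ε̄, although the rate is evaluated at e'.

One may take e = e' (`secrecy_mono`). QBER e' arises from QBER e when Bob's qubits suffer random
Pauli errors whose record goes to Eve. Eve's states at e are thus images of those at e' under a
channel that ignores Alice's string, and channels contract the trace norm.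

At e = e' the bound is a leftover hash lemma (`leftover_hash`). Two-universality removes the cross
terms from the second moment of the key's bias, leaving the purity of Eve's blocks; Cauchy–Schwarz
then turns a Hilbert–Schmidt norm into a trace norm at the price of a dimension. The difficulty is
that the two entropies are smoothed separately. Smoothing S_2 lowers the eigenvalue of each error
pattern, which depends only on the number of errors, and replaces the blocks by smaller operators τ,
losing weight ε̄/4 (`exists_cut_eveBlock`). Smoothing S_0 gives a set D of Eve's basis vectors, of
weight at most 3ε̄/8 under ρ_E, such that log #Dᶜ is the smooth entropy
(`exists_upper_set_smoothRenyiZero`).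

To use both at once, only the D × D corner of τ is split off and bounded by its trace; the mixed
entries stay in the Cauchy–Schwarz step, with weight 2 on D (`traceNorm_le_corner_add_sqrt`). This
inflates the purity by its share on D. Vectors in D are improbable, hence more typical of patterns
with many errors, and there the eigenvalues are small. Chebyshev's sum inequality therefore bounds
the share of the purity on D by the share of the trace on D (`sum_sq_mul_sum_le`). The term -ε̄ in
the rate compensates the inflation up to a factor (1 + 3ε̄/8)² (`smoothing_loss_le`), and the losses
add up to ε_PA + ε̄ (`secrecy_le`). -/

noncomputable section

namespace QKD

open Matrix Finset
open scoped ComplexOrder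

/-! ### Trace norm of Hermitian matrices: duality, triangle inequality, contraction under channels
-/

section TraceNorm

variable {ι : Type*} [Fintype ι]

open Polynomial in
theorem map_eigenvalues_of_charpoly_eq [DecidableEq ι] {A : Matrix ι ι ℂ} (hA : A.IsHermitian)
    {s : Multiset ℝ} (h : A.charpoly = (s.map fun a : ℝ => X - C (a : ℂ)).prod) :
    univ.val.map hA.eigenvalues = s := by
  have h1 : A.charpoly.roots = s.map (fun a : ℝ => (a : ℂ)) := by
    have : (s.map fun a : ℝ => X - C (a : ℂ)) =
        (s.map fun a : ℝ => (a : ℂ)).map fun a => X - C a := by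
      rw [Multiset.map_map]
      rfl
    rw [h, this, Polynomial.roots_multiset_prod_X_sub_C]
  have h2 := hA.roots_charpoly_eq_eigenvalues
  rw [h1, ← Multiset.map_map] at h2
  exact (Multiset.map_injective Complex.ofReal_injective h2).symm

theorem charpoly_unitary_conj [DecidableEq ι] {U : Matrix ι ι ℂ} (hU : U ∈ unitaryGroup ι ℂ)
    (A : Matrix ι ι ℂ) : (U * A * Uᴴ).charpoly = A.charpoly := by
  rw [Matrix.charpoly_mul_comm, ← mul_assoc]
  have : Uᴴ * U = 1 := mem_unitaryGroup_iff'.1 hU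
  rw [this, one_mul]

theorem traceNorm_eq_sum_sqrt_eigenvalues [DecidableEq ι] (A : Matrix ι ι ℂ) :
    traceNorm A = ∑ i, √((isHermitian_mul_conjTranspose_self A).eigenvalues i) := by
  unfold traceNorm
  congr!

/-- For A of this form, A Aᴴ is conjugate by the same U to the diagonal matrix of the aᵢ², so the
characteristic polynomial determines the multiset of its eigenvalues. -/
theorem traceNorm_unitary_conj_diagonal [DecidableEq ι] {U : Matrix ι ι ℂ}
    (hU : U ∈ unitaryGroup ι ℂ) (a : ι → ℝ) :
    traceNorm (U * diagonal (fun i => (a i : ℂ)) * Uᴴ) = ∑ i, |a i| := by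
  rw [traceNorm_eq_sum_sqrt_eigenvalues]
  have hUU : Uᴴ * U = 1 := mem_unitaryGroup_iff'.1 hU
  set A := U * diagonal (fun i => (a i : ℂ)) * Uᴴ with hA
  have h1 : A * Aᴴ = U * diagonal (fun i => ((a i ^ 2 : ℝ) : ℂ)) * Uᴴ := by
    have : Aᴴ = A := by
      rw [hA]
      simp only [conjTranspose_mul, conjTranspose_conjTranspose, diagonal_conjTranspose, mul_assoc]
      congr 3
      ext i
      simp
    rw [this, hA]
    calc _ = U * diagonal (fun i => (a i : ℂ)) * (Uᴴ * U) * diagonal (fun i => (a i : ℂ)) * Uᴴ := by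
          simp only [mul_assoc]
      _ = _ := by
          rw [hUU, mul_one, mul_assoc U, diagonal_mul_diagonal]
          simp [sq]
  have h2 := map_eigenvalues_of_charpoly_eq (isHermitian_mul_conjTranspose_self A)
    (s := univ.val.map fun i => a i ^ 2) (by
      rw [h1, charpoly_unitary_conj hU, charpoly_diagonal, Multiset.map_map]; rfl)
  have h3 := congrArg (fun s => (s.map Real.sqrt).sum) h2
  simp only [Multiset.map_map, Function.comp_def, Real.sqrt_sq_eq_abs] at h3
  exact h3

theorem IsHermitian.eq_conj_diagonal [DecidableEq ι] {A : Matrix ι ι ℂ} (hA : A.IsHermitian) :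
    A = (hA.eigenvectorUnitary : Matrix ι ι ℂ) * diagonal (fun i => (hA.eigenvalues i : ℂ)) *
      (hA.eigenvectorUnitary : Matrix ι ι ℂ)ᴴ := by
  conv_lhs => rw [hA.spectral_theorem, Unitary.conjStarAlgAut_apply]
  rfl

theorem traceNorm_eq_sum_abs_eigenvalues [DecidableEq ι] {A : Matrix ι ι ℂ} (hA : A.IsHermitian) :
    traceNorm A = ∑ i, |hA.eigenvalues i| := by
  conv_lhs => rw [IsHermitian.eq_conj_diagonal hA]
  exact traceNorm_unitary_conj_diagonal hA.eigenvectorUnitary.2 _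

/-- In an eigenbasis of A the trace is ∑ Wᵢᵢ λᵢ with W unitary, so |Wᵢᵢ| ≤ 1. Together with
`exists_unitary_re_trace_mul_eq` this exhibits the trace norm as a maximum of linear functionals. -/
theorem re_trace_mul_le_traceNorm [DecidableEq ι] {A U : Matrix ι ι ℂ} (hA : A.IsHermitian)
    (hU : U ∈ unitaryGroup ι ℂ) : (U * A).trace.re ≤ traceNorm A := by
  rw [traceNorm_eq_sum_abs_eigenvalues hA]
  set V : Matrix ι ι ℂ := (hA.eigenvectorUnitary : Matrix ι ι ℂ)
  have hW : Vᴴ * U * V ∈ unitaryGroup ι ℂ :=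
    mul_mem (mul_mem (Unitary.star_mem hA.eigenvectorUnitary.2) hU) hA.eigenvectorUnitary.2
  have h : (U * A).trace = ∑ i, (Vᴴ * U * V) i i * (hA.eigenvalues i : ℂ) := by
    conv_lhs => rw [IsHermitian.eq_conj_diagonal hA]
    rw [← mul_assoc, Matrix.trace_mul_comm, ← mul_assoc, ← mul_assoc]
    simp only [Matrix.trace, diag_apply, mul_diagonal]
    rfl
  rw [h, Complex.re_sum]
  refine sum_le_sum fun i _ => ?_
  refine (Complex.re_le_norm _).trans ?_
  rw [norm_mul, Complex.norm_real, Real.norm_eq_abs]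
  exact mul_le_of_le_one_left (abs_nonneg _) (entry_norm_bound_of_unitary hW i i)

theorem exists_posSemidef_sub [DecidableEq ι] {A : Matrix ι ι ℂ} (hA : A.IsHermitian) :
    ∃ P M : Matrix ι ι ℂ, P.PosSemidef ∧ M.PosSemidef ∧ A = P - M ∧
      P.trace.re + M.trace.re = traceNorm A := by
  set V : Matrix ι ι ℂ := (hA.eigenvectorUnitary : Matrix ι ι ℂ)
  have hVV : Vᴴ * V = 1 := mem_unitaryGroup_iff'.1 hA.eigenvectorUnitary.2
  have psd : ∀ d : ι → ℝ, (∀ i, 0 ≤ d i) →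
      (V * diagonal (fun i => (d i : ℂ)) * Vᴴ).PosSemidef := fun d hd =>
    (PosSemidef.diagonal (fun i => by simpa using hd i)).mul_mul_conjTranspose_same V
  have tr : ∀ d : ι → ℝ, (V * diagonal (fun i => (d i : ℂ)) * Vᴴ).trace.re = ∑ i, d i := by
    intro d
    rw [Matrix.trace_mul_comm, ← mul_assoc, hVV, one_mul, trace_diagonal, Complex.re_sum]
    simp
  refine ⟨_, _, psd (fun i => max (hA.eigenvalues i) 0) (fun i => le_max_right _ _),
    psd (fun i => max (-hA.eigenvalues i) 0) (fun i => le_max_right _ _), ?_, ?_⟩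
  · conv_lhs => rw [IsHermitian.eq_conj_diagonal hA]
    rw [← sub_mul, ← mul_sub, diagonal_sub]
    congr 3
    ext i
    rw [← Complex.ofReal_sub]
    congr 1
    rcases le_total (hA.eigenvalues i) 0 with h | h
    · rw [max_eq_right h, max_eq_left (by linarith)]; ring
    · rw [max_eq_left h, max_eq_right (by linarith)]; ring
  · rw [tr, tr, ← sum_add_distrib, traceNorm_eq_sum_abs_eigenvalues hA]
    refine sum_congr rfl fun i _ => ?_
    rcases le_total (hA.eigenvalues i) 0 with h | h
    · rw [max_eq_right h, max_eq_left (by linarith), abs_of_nonpos h]; ring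
    · rw [max_eq_left h, max_eq_right (by linarith), abs_of_nonneg h]; ring

theorem exists_unitary_re_trace_mul_eq [DecidableEq ι] {A : Matrix ι ι ℂ} (hA : A.IsHermitian) :
    ∃ U ∈ unitaryGroup ι ℂ, (U * A).trace.re = traceNorm A := by
  set V : Matrix ι ι ℂ := (hA.eigenvectorUnitary : Matrix ι ι ℂ)
  have hVV : Vᴴ * V = 1 := mem_unitaryGroup_iff'.1 hA.eigenvectorUnitary.2
  -- The maximizer is the sign of A; the value 1 at eigenvalue 0 keeps it unitary.
  set sg : ι → ℝ := fun i => if 0 ≤ hA.eigenvalues i then 1 else -1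
  have hsg : diagonal (fun i => (sg i : ℂ)) ∈ unitaryGroup ι ℂ := by
    rw [mem_unitaryGroup_iff, star_eq_conjTranspose, diagonal_conjTranspose,
      diagonal_mul_diagonal, ← diagonal_one]
    congr 1
    ext i
    simp only [sg, Pi.star_apply]
    split_ifs <;> simp
  refine ⟨V * diagonal (fun i => (sg i : ℂ)) * Vᴴ, mul_mem (mul_mem hA.eigenvectorUnitary.2 hsg)
    (Unitary.star_mem hA.eigenvectorUnitary.2), ?_⟩
  rw [traceNorm_eq_sum_abs_eigenvalues hA]
  conv_lhs => rw [IsHermitian.eq_conj_diagonal hA]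
  have : V * diagonal (fun i => (sg i : ℂ)) * Vᴴ *
      (V * diagonal (fun i => (hA.eigenvalues i : ℂ)) * Vᴴ) =
      V * diagonal (fun i => (sg i : ℂ)) * (Vᴴ * V) * diagonal (fun i => (hA.eigenvalues i : ℂ)) *
        Vᴴ := by simp only [mul_assoc]
  change (V * diagonal (fun i => (sg i : ℂ)) * Vᴴ *
      (V * diagonal (fun i => (hA.eigenvalues i : ℂ)) * Vᴴ)).trace.re = _
  rw [this, hVV, mul_one, mul_assoc V, diagonal_mul_diagonal, Matrix.trace_mul_comm, ← mul_assoc,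
    hVV, one_mul, trace_diagonal, Complex.re_sum]
  refine sum_congr rfl fun i _ => ?_
  rw [← Complex.ofReal_mul, Complex.ofReal_re]
  simp only [sg]
  split_ifs with h
  · rw [abs_of_nonneg h, one_mul]
  · rw [abs_of_neg (not_le.1 h), neg_one_mul]

theorem traceNorm_add_le {A B : Matrix ι ι ℂ} (hA : A.IsHermitian) (hB : B.IsHermitian) :
    traceNorm (A + B) ≤ traceNorm A + traceNorm B := by
  classical
  obtain ⟨U, hU, h⟩ := exists_unitary_re_trace_mul_eq (hA.add hB)
  rw [← h, mul_add, trace_add, Complex.add_re]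
  exact add_le_add (re_trace_mul_le_traceNorm hA hU) (re_trace_mul_le_traceNorm hB hU)

theorem traceNorm_posSemidef {A : Matrix ι ι ℂ} (hA : A.PosSemidef) :
    traceNorm A = A.trace.re := by
  classical
  rw [traceNorm_eq_sum_abs_eigenvalues hA.isHermitian, hA.isHermitian.trace_eq_sum_eigenvalues,
    Complex.re_sum]
  exact sum_congr rfl fun i _ => by simpa using hA.eigenvalues_nonneg i

theorem traceNorm_neg {A : Matrix ι ι ℂ} : traceNorm (-A) = traceNorm A := by
  unfold traceNorm
  simp only [conjTranspose_neg, neg_mul_neg]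

theorem traceNorm_sub_le {A B : Matrix ι ι ℂ} (hA : A.PosSemidef) (hB : B.PosSemidef) :
    traceNorm (A - B) ≤ A.trace.re + B.trace.re := by
  rw [sub_eq_add_neg]
  refine (traceNorm_add_le hA.isHermitian hB.isHermitian.neg).trans_eq ?_
  rw [traceNorm_neg, traceNorm_posSemidef hA, traceNorm_posSemidef hB]

theorem traceNorm_zero : traceNorm (0 : Matrix ι ι ℂ) = 0 := by
  rw [traceNorm_posSemidef PosSemidef.zero, trace_zero, Complex.zero_re]

theorem isHermitian_sum {ι κ : Type*} (s : Finset κ) {A : κ → Matrix ι ι ℂ}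
    (hA : ∀ k ∈ s, (A k).IsHermitian) : (∑ k ∈ s, A k).IsHermitian := by
  unfold Matrix.IsHermitian
  rw [conjTranspose_sum]
  exact sum_congr rfl hA

theorem traceNorm_smul (c : ℝ) {A : Matrix ι ι ℂ} (hA : A.IsHermitian) :
    traceNorm ((c : ℂ) • A) = |c| * traceNorm A := by
  classical
  have h : (c : ℂ) • A = (hA.eigenvectorUnitary : Matrix ι ι ℂ) *
      diagonal (fun i => ((c * hA.eigenvalues i : ℝ) : ℂ)) *
        (hA.eigenvectorUnitary : Matrix ι ι ℂ)ᴴ := by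
    conv_lhs => rw [IsHermitian.eq_conj_diagonal hA]
    rw [← smul_mul_assoc, ← mul_smul_comm, ← diagonal_smul]
    congr 3
    ext i
    simp
  rw [h, traceNorm_unitary_conj_diagonal hA.eigenvectorUnitary.2,
    traceNorm_eq_sum_abs_eigenvalues hA, mul_sum]
  simp [abs_mul]

theorem IsHermitian.real_smul {ι : Type*} (c : ℝ) {A : Matrix ι ι ℂ} (hA : A.IsHermitian) :
    ((c : ℂ) • A).IsHermitian := by
  unfold Matrix.IsHermitian
  rw [conjTranspose_smul, hA]
  simp

theorem traceNorm_sum_le {κ : Type*} (s : Finset κ) {A : κ → Matrix ι ι ℂ}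
    (hA : ∀ k, (A k).IsHermitian) : traceNorm (∑ k ∈ s, A k) ≤ ∑ k ∈ s, traceNorm (A k) := by
  classical
  induction s using Finset.induction_on with
  | empty => simp [traceNorm_zero]
  | insert k s hk ih =>
    rw [sum_insert hk, sum_insert hk]
    exact (traceNorm_add_le (hA k) (isHermitian_sum s fun j _ => hA j)).trans (by gcongr)

theorem traceNorm_sum_smul_le {κ : Type*} (s : Finset κ) (a : κ → ℝ) {A : κ → Matrix ι ι ℂ}
    (hA : ∀ k, (A k).PosSemidef) :
    traceNorm (∑ k ∈ s, (a k : ℂ) • A k) ≤ ∑ k ∈ s, |a k| * (A k).trace.re := by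
  refine (traceNorm_sum_le s fun k => IsHermitian.real_smul (a k) (hA k).isHermitian).trans_eq ?_
  exact sum_congr rfl fun k _ => by
    rw [traceNorm_smul _ (hA k).isHermitian, traceNorm_posSemidef (hA k)]

theorem traceNorm_blockDiagonal {κ : Type*} [Fintype κ] [DecidableEq κ]
    {A : κ → Matrix ι ι ℂ} (hA : ∀ k, (A k).IsHermitian) :
    traceNorm (blockDiagonal A) = ∑ k, traceNorm (A k) := by
  classical
  have hU : blockDiagonal (fun k => ((hA k).eigenvectorUnitary : Matrix ι ι ℂ)) ∈
      unitaryGroup (ι × κ) ℂ := by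
    rw [mem_unitaryGroup_iff, star_eq_conjTranspose, blockDiagonal_conjTranspose,
      ← blockDiagonal_mul, ← blockDiagonal_one]
    congr 1
    ext1 k
    exact mem_unitaryGroup_iff.1 (hA k).eigenvectorUnitary.2
  have h : blockDiagonal A = blockDiagonal (fun k => ((hA k).eigenvectorUnitary : Matrix ι ι ℂ)) *
      diagonal (fun i : ι × κ => ((hA i.2).eigenvalues i.1 : ℂ)) *
      (blockDiagonal (fun k => ((hA k).eigenvectorUnitary : Matrix ι ι ℂ)))ᴴ := by
    rw [blockDiagonal_conjTranspose,
      ← blockDiagonal_diagonal (fun k i => ((hA k).eigenvalues i : ℂ)), ← blockDiagonal_mul,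
      ← blockDiagonal_mul]
    congr 1
    ext1 k
    exact IsHermitian.eq_conj_diagonal (hA k)
  rw [h, traceNorm_unitary_conj_diagonal hU, Fintype.sum_prod_type, sum_comm]
  exact sum_congr rfl fun k _ => (traceNorm_eq_sum_abs_eigenvalues (hA k)).symm

/-- A completely positive trace-preserving map contracts the trace norm. -/
theorem traceNorm_kraus_le {κ : Type*} [Fintype κ] [DecidableEq ι] {K : κ → Matrix ι ι ℂ}
    (hK : ∑ k, (K k)ᴴ * K k = 1) {A : Matrix ι ι ℂ} (hA : A.IsHermitian) :
    traceNorm (∑ k, K k * A * (K k)ᴴ) ≤ traceNorm A := by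
  -- The images of the positive and negative parts stay positive and keep their traces, but need no
  -- longer be orthogonal.
  obtain ⟨P, M, hP, hM, rfl, ht⟩ := exists_posSemidef_sub hA
  have psd : ∀ {X : Matrix ι ι ℂ}, X.PosSemidef → (∑ k, K k * X * (K k)ᴴ).PosSemidef :=
    fun hX => posSemidef_sum _ fun k _ => hX.mul_mul_conjTranspose_same (K k)
  have tr : ∀ X : Matrix ι ι ℂ, (∑ k, K k * X * (K k)ᴴ).trace = X.trace := by
    intro X
    rw [trace_sum]
    calc _ = ∑ k, ((K k)ᴴ * K k * X).trace := sum_congr rfl fun k _ => by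
          rw [Matrix.trace_mul_comm, mul_assoc]
      _ = _ := by rw [← trace_sum, ← Finset.sum_mul, hK, one_mul]
  rw [← ht]
  have : ∑ k, K k * (P - M) * (K k)ᴴ = ∑ k, K k * P * (K k)ᴴ - ∑ k, K k * M * (K k)ᴴ := by
    simp [mul_sub, sub_mul]
  rw [this]
  refine (traceNorm_sub_le (psd hP) (psd hM)).trans_eq ?_
  rw [tr, tr]

end TraceNorm

/-! ### Leftover hashing with a corner split off -/

section LeftoverHash

variable {ι : Type*} [Fintype ι] [DecidableEq ι]

/-- The compression of `A` to the coordinates in `D`. -/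
def corner (D : Finset ι) (A : Matrix ι ι ℂ) : Matrix ι ι ℂ :=
  of fun i j => if i ∈ D ∧ j ∈ D then A i j else 0

theorem corner_eq (D : Finset ι) (A : Matrix ι ι ℂ) :
    corner D A = diagonal (fun i => if i ∈ D then (1 : ℂ) else 0) * A *
      (diagonal (fun i => if i ∈ D then (1 : ℂ) else 0))ᴴ := by
  ext i j
  rw [diagonal_conjTranspose, mul_diagonal, diagonal_mul]
  by_cases hi : i ∈ D <;> by_cases hj : j ∈ D <;> simp [corner, hi, hj]

theorem corner_posSemidef (D : Finset ι) {A : Matrix ι ι ℂ} (hA : A.PosSemidef) :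
    (corner D A).PosSemidef := by
  rw [corner_eq]
  exact hA.mul_mul_conjTranspose_same _

theorem corner_isHermitian (D : Finset ι) {A : Matrix ι ι ℂ} (hA : A.IsHermitian) :
    (corner D A).IsHermitian := by
  rw [corner_eq]
  exact isHermitian_mul_mul_conjTranspose _ hA

theorem trace_corner (D : Finset ι) (A : Matrix ι ι ℂ) :
    (corner D A).trace = ∑ i ∈ D, A i i := by
  simp [corner, Matrix.trace, Finset.sum_ite_mem]

omit [Fintype ι] in
theorem corner_sum_smul {X : Type*} [Fintype X] (D : Finset ι) (a : X → ℂ)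
    (A : X → Matrix ι ι ℂ) :
    corner D (∑ x, a x • A x) = ∑ x, a x • corner D (A x) := by
  ext i j
  by_cases h : i ∈ D ∧ j ∈ D <;> simp [corner, h, Matrix.sum_apply]

theorem sum_sum_comm {α β γ δ : Type*} [Fintype α] [Fintype β] [Fintype γ] [Fintype δ]
    (f : α → β → γ → δ → ℝ) :
    ∑ a, ∑ b, ∑ c, ∑ d, f a b c d = ∑ c, ∑ d, ∑ a, ∑ b, f a b c d := by
  calc _ = ∑ p : α × β, ∑ q : γ × δ, f p.1 p.2 q.1 q.2 := by simp only [Fintype.sum_prod_type]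
    _ = ∑ q : γ × δ, ∑ p : α × β, f p.1 p.2 q.1 q.2 := sum_comm
    _ = _ := by simp only [Fintype.sum_prod_type]

/-- The bilinear form `tr (L A L Bᴴ)`, where `L` is the diagonal matrix with entries `w`. -/
def weightedForm (w : ι → ℝ) (A B : Matrix ι ι ℂ) : ℝ :=
  ∑ i, ∑ j, w i * w j * (A i j * star (B i j)).re

omit [DecidableEq ι] in
theorem weightedForm_self (w : ι → ℝ) (A : Matrix ι ι ℂ) :
    weightedForm w A A = ∑ i, ∑ j, w i * w j * ‖A i j‖ ^ 2 := by
  refine sum_congr rfl fun i _ => sum_congr rfl fun j _ => ?_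
  congr 1
  rw [Complex.star_def, Complex.mul_conj, Complex.ofReal_re, Complex.normSq_eq_norm_sq]

open scoped MatrixOrder Matrix.Norms.L2Operator in
theorem re_trace_mul_nonneg {A B : Matrix ι ι ℂ} (hA : A.PosSemidef) (hB : B.PosSemidef) :
    0 ≤ (A * B).trace.re := by
  obtain ⟨C, rfl⟩ := CStarAlgebra.nonneg_iff_eq_star_mul_self.mp hB.nonneg
  rw [← mul_assoc, Matrix.trace_mul_comm, ← mul_assoc]
  exact (Complex.le_def.1 (hA.mul_mul_conjTranspose_same C).trace_nonneg).1

/-- The form is the trace of a product of two positive matrices. Nonnegativity is what allows cross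
terms with nonpositive coefficients to be dropped after hashing. -/
theorem weightedForm_nonneg (w : ι → ℝ) {A B : Matrix ι ι ℂ} (hA : A.PosSemidef)
    (hB : B.PosSemidef) : 0 ≤ weightedForm w A B := by
  have h := re_trace_mul_nonneg
    (hA.mul_mul_conjTranspose_same (diagonal fun i => (w i : ℂ))) hB
  convert h using 1
  simp only [Matrix.trace, diag_apply, Matrix.mul_apply (N := B), Complex.re_sum, weightedForm]
  refine sum_congr rfl fun i _ => sum_congr rfl fun j _ => ?_
  rw [diagonal_conjTranspose, mul_diagonal, diagonal_mul]
  have : star (B i j) = B j i := hB.isHermitian.apply j i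
  rw [this, mul_assoc, ← Complex.re_ofReal_mul, ← Complex.re_ofReal_mul]
  congr 1
  simp only [Pi.star_apply, Complex.star_def, Complex.conj_ofReal]
  ring

omit [DecidableEq ι] in
theorem weightedForm_sum_smul {X : Type*} [Fintype X] (w : ι → ℝ) (a : X → ℝ)
    (A : X → Matrix ι ι ℂ) :
    weightedForm w (∑ x, (a x : ℂ) • A x) (∑ x, (a x : ℂ) • A x) =
      ∑ x, ∑ y, a x * a y * weightedForm w (A x) (A y) := by
  have h : ∀ i j, ((∑ x, (a x : ℂ) • A x) i j * star ((∑ x, (a x : ℂ) • A x) i j)).re =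
      ∑ x, ∑ y, a x * a y * (A x i j * star (A y i j)).re := by
    intro i j
    simp only [Matrix.sum_apply, Matrix.smul_apply, star_sum, sum_mul_sum, Complex.re_sum,
      smul_eq_mul, star_mul']
    refine sum_congr rfl fun x _ => sum_congr rfl fun y _ => ?_
    rw [← Complex.re_ofReal_mul]
    congr 1
    simp only [Complex.star_def, Complex.conj_ofReal, Complex.ofReal_mul]
    ring
  simp only [weightedForm, h, mul_sum]
  rw [sum_sum_comm]
  exact sum_congr rfl fun x _ => sum_congr rfl fun y _ => sum_congr rfl fun i _ =>
    sum_congr rfl fun j _ => by ring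

theorem row_sum_norm_sq {U : Matrix ι ι ℂ} (hU : U ∈ unitaryGroup ι ℂ) (i : ι) :
    ∑ j, ‖U i j‖ ^ 2 = 1 := by
  have h := congrFun (congrFun (mem_unitaryGroup_iff.1 hU) i) i
  rw [Matrix.mul_apply, one_apply_eq] at h
  have h2 := congrArg Complex.re h
  rw [Complex.re_sum, Complex.one_re] at h2
  rw [← h2]
  refine sum_congr rfl fun j _ => ?_
  rw [star_apply, Complex.star_def, Complex.mul_conj, Complex.ofReal_re,
    Complex.normSq_eq_norm_sq]

theorem col_sum_norm_sq {U : Matrix ι ι ℂ} (hU : U ∈ unitaryGroup ι ℂ) (j : ι) :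
    ∑ i, ‖U i j‖ ^ 2 = 1 := by
  have h := row_sum_norm_sq (Unitary.star_mem hU) j
  simpa [star_apply] using h

/-- Weight `1` off `D` and weight `2` on `D`. -/
def cornerWeight (D : Finset ι) (i : ι) : ℝ := if i ∈ D then 2 else 1

/-- Write the trace norm as tr(UA) and apply Cauchy–Schwarz to the entries outside the D × D corner.
Each of them has a row or column in Dᶜ, so the dimension that enters is #Dᶜ and not that of the
whole space. -/
theorem traceNorm_le_corner_add_sqrt {A : Matrix ι ι ℂ} (hA : A.IsHermitian) (D : Finset ι) :
    traceNorm A ≤ traceNorm (corner D A) +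
      √((#Dᶜ : ℝ) * weightedForm (cornerWeight D) A A) := by
  obtain ⟨U, hU, h⟩ := exists_unitary_re_trace_mul_eq hA
  set r : ι × ι → ℝ := fun p =>
    if p.1 ∈ D ∧ p.2 ∈ D then 0 else ‖U p.1 p.2‖ * ‖A p.2 p.1‖ with hr
  -- An entry with one index in D gets factor 1/2 here and 2 in `g`. Counting half a unit for each
  -- index outside D makes the rows and columns of U sum to exactly #Dᶜ.
  set f : ι × ι → ℝ := fun p =>
    ((if p.1 ∈ D then 0 else 1) + (if p.2 ∈ D then 0 else 1)) / 2 * ‖U p.1 p.2‖ ^ 2 with hf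
  set g : ι × ι → ℝ := fun p =>
    cornerWeight D p.1 * cornerWeight D p.2 * ‖A p.2 p.1‖ ^ 2 with hg
  have hw : ∀ i, 0 ≤ cornerWeight D i := fun i => by unfold cornerWeight; split_ifs <;> norm_num
  have hcs : (∑ p, r p) ^ 2 ≤ (∑ p, f p) * ∑ p, g p := by
    refine sum_sq_le_sum_mul_sum_of_sq_le_mul _ (fun p _ => ?_) (fun p _ => ?_) fun p _ => ?_
    · simp only [hf]
      split_ifs <;> positivity
    · exact mul_nonneg (mul_nonneg (hw _) (hw _)) (sq_nonneg _)
    · simp only [hr, hf, hg, cornerWeight]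
      by_cases h1 : p.1 ∈ D <;> by_cases h2 : p.2 ∈ D <;> simp [h1, h2] <;>
        exact le_of_eq (by ring)
  have hfs : ∑ p, f p = #Dᶜ := by
    have e1 : ∑ i, ∑ j, (if i ∈ D then (0 : ℝ) else 1) * ‖U i j‖ ^ 2 = #Dᶜ := by
      simp_rw [← mul_sum, row_sum_norm_sq hU]
      rw [card_eq_sum_ones, Nat.cast_sum, compl_eq_univ_sdiff, ← filter_notMem_eq_sdiff,
        sum_filter]
      simp
    have e2 : ∑ i, ∑ j, (if j ∈ D then (0 : ℝ) else 1) * ‖U i j‖ ^ 2 = #Dᶜ := by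
      rw [sum_comm]
      simp_rw [← mul_sum, col_sum_norm_sq hU]
      rw [card_eq_sum_ones, Nat.cast_sum, compl_eq_univ_sdiff, ← filter_notMem_eq_sdiff,
        sum_filter]
      simp
    rw [Fintype.sum_prod_type]
    simp only [hf, add_div, add_mul, sum_add_distrib]
    have e3 : ∀ c : ℝ, (#Dᶜ : ℝ) = #Dᶜ / 2 + #Dᶜ / 2 := fun _ => by ring
    rw [e3 0]
    conv_rhs => rw [← e1]
    nth_rewrite 2 [e1]
    rw [← e2]
    simp only [sum_div]
    congr 1 <;> exact sum_congr rfl fun i _ => sum_congr rfl fun j _ => by ring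
  have hgs : ∑ p, g p = weightedForm (cornerWeight D) A A := by
    rw [weightedForm_self, Fintype.sum_prod_type, sum_comm]
    refine sum_congr rfl fun i _ => sum_congr rfl fun j _ => ?_
    simp only [hg]
    ring
  have hrs : ∑ p, r p ≤ √((#Dᶜ : ℝ) * weightedForm (cornerWeight D) A A) := by
    rw [← hfs, ← hgs]
    exact Real.le_sqrt_of_sq_le hcs
  have hsplit : (U * A).trace.re = (U * corner D A).trace.re +
      ∑ p : ι × ι, if p.1 ∈ D ∧ p.2 ∈ D then 0 else (U p.1 p.2 * A p.2 p.1).re := by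
    simp only [Matrix.trace, diag_apply, Matrix.mul_apply, Complex.re_sum, Fintype.sum_prod_type,
      ← sum_add_distrib]
    refine sum_congr rfl fun i _ => sum_congr rfl fun j _ => ?_
    by_cases h1 : i ∈ D <;> by_cases h2 : j ∈ D <;> simp [h1, h2, corner]
  rw [← h, hsplit]
  refine add_le_add (re_trace_mul_le_traceNorm (corner_isHermitian D hA) hU) (le_trans ?_ hrs)
  refine sum_le_sum fun p _ => ?_
  simp only [hr]
  split_ifs
  · exact le_rfl
  · exact (Complex.re_le_norm _).trans_eq (norm_mul _ _)

variable {X K F C : Type*} [Fintype X] [Fintype K] [Fintype F] [Fintype C] [DecidableEq K]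

/-- The deviation of the indicator of `hash x = k` from its mean over `k`. -/
def keyBias (hash : X → K) (k : K) (x : X) : ℝ :=
  (if hash x = k then 1 else 0) - 1 / Fintype.card K

omit [Fintype X] in
theorem sum_keyBias_mul [Nonempty K] (hash : X → K) (x y : X) :
    ∑ k, keyBias hash k x * keyBias hash k y =
      (if hash x = hash y then 1 else 0) - 1 / Fintype.card K := by
  have hK : (Fintype.card K : ℝ) ≠ 0 := by simp
  simp only [keyBias, sub_mul, mul_sub, sum_sub_distrib, ← mul_sum, sum_ite_eq,
    mem_univ, if_true, sum_const, card_univ, nsmul_eq_mul, ite_mul, one_mul, zero_mul]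
  rw [show (if hash y = hash x then (1 : ℝ) else 0) = if hash x = hash y then 1 else 0 by
    simp only [eq_comm]]
  field_simp
  ring

omit [Fintype X] in
theorem sum_abs_keyBias_le [Nonempty K] (hash : X → K) (x : X) :
    ∑ k, |keyBias hash k x| ≤ 2 := by
  have hK : (Fintype.card K : ℝ) ≠ 0 := by simp
  calc ∑ k, |keyBias hash k x| ≤ ∑ k : K, ((if hash x = k then 1 else 0) + 1 / (Fintype.card K : ℝ)) := by
        refine sum_le_sum fun k _ => ?_
        refine (abs_sub _ _).trans_eq ?_
        rw [abs_of_nonneg (a := 1 / (Fintype.card K : ℝ)) (by positivity), abs_of_nonneg]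
        split_ifs <;> norm_num
    _ = 2 := by
        rw [sum_add_distrib]
        simp [hK]
        norm_num

variable {h : F → ℝ} {hash : F → X → K}

/-- Expanding the square, the coefficient of the pair (x, y) is its collision probability minus
1/|K|. For x ≠ y this is at most 0 by two-universality, and it multiplies a nonnegative form; only
the diagonal survives. -/
theorem sum_weightedForm_keyBias_le [DecidableEq X] [Nonempty K] (w : ι → ℝ) (hh1 : ∑ f, h f = 1)
    (huniv : ∀ x x', x ≠ x' → ∑ f, (if hash f x = hash f x' then h f else 0) ≤
      1 / (Fintype.card K : ℝ))
    {M : X → Matrix ι ι ℂ} (hM : ∀ x, (M x).PosSemidef) :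
    ∑ f, ∑ k, h f * weightedForm w (∑ x, (keyBias (hash f) k x : ℂ) • M x)
      (∑ x, (keyBias (hash f) k x : ℂ) • M x) ≤ ∑ x, weightedForm w (M x) (M x) := by
  calc _ = ∑ x, ∑ y, (∑ f, h f * ∑ k, keyBias (hash f) k x * keyBias (hash f) k y) *
        weightedForm w (M x) (M y) := by
        simp only [weightedForm_sum_smul, mul_sum, sum_mul]
        rw [sum_sum_comm]
        exact sum_congr rfl fun x _ => sum_congr rfl fun y _ => sum_congr rfl fun i _ =>
          sum_congr rfl fun j _ => by ring
    _ ≤ ∑ x, ∑ y, if x = y then weightedForm w (M x) (M y) else 0 := by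
        refine sum_le_sum fun x _ => sum_le_sum fun y _ => ?_
        simp only [sum_keyBias_mul, mul_sub, sum_sub_distrib, mul_ite, mul_one, mul_zero,
          ← sum_mul, hh1, one_mul]
        have h0 := weightedForm_nonneg w (hM x) (hM y)
        split_ifs with hxy
        · subst hxy
          simp only [if_true, hh1]
          refine mul_le_of_le_one_left h0 ?_
          have : (0 : ℝ) ≤ 1 / Fintype.card K := by positivity
          linarith
        · exact mul_nonpos_of_nonpos_of_nonneg (sub_nonpos.2 (huniv x y hxy)) h0
    _ = _ := by simp

omit [DecidableEq ι] in
-- A crude bound without hashing, for the parts of small trace; 2 bounds the ℓ¹ norm of the bias.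
theorem sum_traceNorm_keyBias_le [Nonempty K] (hh : ∀ f, 0 ≤ h f) (hh1 : ∑ f, h f = 1)
    {P : X → C → ℝ} (hP : ∀ x c, 0 ≤ P x c) (hP1 : ∀ x, ∑ c, P x c = 1)
    {N : X → Matrix ι ι ℂ} (hN : ∀ x, (N x).PosSemidef) :
    ∑ f, ∑ c, ∑ k, h f * traceNorm (∑ x, ((keyBias (hash f) k x * P x c : ℝ) : ℂ) • N x) ≤
      2 * ∑ x, (N x).trace.re := by
  have ht : ∀ x, 0 ≤ (N x).trace.re := fun x => (Complex.le_def.1 (hN x).trace_nonneg).1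
  calc _ ≤ ∑ f, ∑ c, ∑ k, h f * ∑ x, |keyBias (hash f) k x * P x c| * (N x).trace.re :=
        sum_le_sum fun f _ => sum_le_sum fun c _ => sum_le_sum fun k _ =>
          mul_le_mul_of_nonneg_left (traceNorm_sum_smul_le _ _ hN) (hh f)
    _ = ∑ f, h f * ∑ x, (N x).trace.re * ((∑ c, P x c) * ∑ k, |keyBias (hash f) k x|) := by
        refine sum_congr rfl fun f _ => ?_
        simp only [← mul_sum]
        congr 1
        rw [sum_congr rfl fun c _ => sum_comm, sum_comm]
        refine sum_congr rfl fun x _ => ?_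
        rw [sum_mul_sum, mul_sum]
        refine sum_congr rfl fun c _ => ?_
        rw [mul_sum]
        refine sum_congr rfl fun k _ => ?_
        rw [abs_mul, abs_of_nonneg (hP x c)]
        ring
    _ ≤ ∑ f, h f * ∑ x, (N x).trace.re * 2 := by
        refine sum_le_sum fun f _ => mul_le_mul_of_nonneg_left (sum_le_sum fun x _ => ?_) (hh f)
        rw [hP1, one_mul]
        exact mul_le_mul_of_nonneg_left (sum_abs_keyBias_le _ _) (ht x)
    _ = _ := by rw [← sum_mul, hh1, one_mul, ← sum_mul, mul_comm]

/-- The smoothing remainder `δ` and the corner of `τ` are estimated by their traces; only the rest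
of `τ` uses hashing. `L` is the factor by which the transcript can help Eve. -/
theorem leftover_hash [DecidableEq X] [Nonempty K] (hh : ∀ f, 0 ≤ h f) (hh1 : ∑ f, h f = 1)
    (huniv : ∀ x x', x ≠ x' → ∑ f, (if hash f x = hash f x' then h f else 0) ≤
      1 / (Fintype.card K : ℝ))
    {P : X → C → ℝ} (hP : ∀ x c, 0 ≤ P x c) (hP1 : ∀ x, ∑ c, P x c = 1)
    {L : ℝ} (hL : ∀ x c, Fintype.card C * P x c ≤ L) {ρ τ δ : X → Matrix ι ι ℂ}
    (hτ : ∀ x, (τ x).PosSemidef) (hδ : ∀ x, (δ x).PosSemidef) (hρ : ∀ x, ρ x = τ x + δ x)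
    (D : Finset ι) :
    ∑ f, ∑ c, ∑ k, h f * traceNorm (∑ x, ((keyBias (hash f) k x * P x c : ℝ) : ℂ) • ρ x) ≤
      2 * ∑ x, (δ x).trace.re + 2 * ∑ x, (corner D (τ x)).trace.re +
        √(Fintype.card K * L * #Dᶜ * ∑ x, weightedForm (cornerWeight D) (τ x) (τ x)) := by
  set w := cornerWeight D
  set B : F → C → K → Matrix ι ι ℂ := fun f c k =>
    ∑ x, ((keyBias (hash f) k x * P x c : ℝ) : ℂ) • τ x with hB
  have hherm : ∀ (a : X → ℝ) {N : X → Matrix ι ι ℂ}, (∀ x, (N x).PosSemidef) →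
      (∑ x, (a x : ℂ) • N x).IsHermitian := fun a N hN =>
    isHermitian_sum _ fun x _ => IsHermitian.real_smul _ (hN x).isHermitian
  have hwpos : ∀ f c k, 0 ≤ weightedForm w (B f c k) (B f c k) := by
    intro f c k
    rw [weightedForm_self]
    refine sum_nonneg fun i _ => sum_nonneg fun j _ => mul_nonneg (mul_nonneg ?_ ?_) (sq_nonneg _)
    all_goals simp only [w, cornerWeight]; split_ifs <;> norm_num
  have hbound : ∀ f c k,
      traceNorm (∑ x, ((keyBias (hash f) k x * P x c : ℝ) : ℂ) • ρ x) ≤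
      traceNorm (∑ x, ((keyBias (hash f) k x * P x c : ℝ) : ℂ) • δ x) +
      traceNorm (∑ x, ((keyBias (hash f) k x * P x c : ℝ) : ℂ) • corner D (τ x)) +
      √((#Dᶜ : ℝ) * weightedForm w (B f c k) (B f c k)) := by
    intro f c k
    have e1 : ∑ x, ((keyBias (hash f) k x * P x c : ℝ) : ℂ) • ρ x =
        B f c k + ∑ x, ((keyBias (hash f) k x * P x c : ℝ) : ℂ) • δ x := by
      simp only [hB, hρ, smul_add, sum_add_distrib]
    have e2 := traceNorm_le_corner_add_sqrt
      (hherm (fun x => keyBias (hash f) k x * P x c) hτ) D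
    rw [corner_sum_smul] at e2
    have e3 := traceNorm_add_le (hherm (fun x => keyBias (hash f) k x * P x c) hτ)
      (hherm (fun x => keyBias (hash f) k x * P x c) hδ)
    rw [e1]
    linarith
  have hcs : (∑ p : F × C × K, h p.1 *
      √((#Dᶜ : ℝ) * weightedForm w (B p.1 p.2.1 p.2.2) (B p.1 p.2.1 p.2.2))) ^ 2 ≤
      (∑ p : F × C × K, h p.1) * ∑ p : F × C × K, h p.1 *
        ((#Dᶜ : ℝ) * weightedForm w (B p.1 p.2.1 p.2.2) (B p.1 p.2.1 p.2.2)) := by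
    refine sum_sq_le_sum_mul_sum_of_sq_le_mul _ (fun p _ => hh _)
      (fun p _ => mul_nonneg (hh _) (mul_nonneg (Nat.cast_nonneg _) (hwpos _ _ _))) fun p _ => ?_
    rw [mul_pow, Real.sq_sqrt (mul_nonneg (Nat.cast_nonneg _) (hwpos _ _ _))]
    exact le_of_eq (by ring)
  -- Cauchy–Schwarz with weights `h` produces the factors |C| and |K|; `hLsum` absorbs |C| together
  -- with one of the two factors P(c|x).
  have hsum : ∑ p : F × C × K, h p.1 = Fintype.card C * Fintype.card K := by
    simp only [Fintype.sum_prod_type, sum_const, card_univ, nsmul_eq_mul, ← mul_sum, hh1,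
      Fintype.card_prod, Nat.cast_mul, mul_one]
  have hform : ∀ c, ∑ f, ∑ k, h f * weightedForm w (B f c k) (B f c k) ≤
      ∑ x, P x c * P x c * weightedForm w (τ x) (τ x) := by
    intro c
    have := sum_weightedForm_keyBias_le (hash := hash) w hh1 huniv
      (M := fun x => (P x c : ℂ) • τ x) (fun x => (hτ x).smul (by simpa using hP x c))
    refine le_trans (le_of_eq ?_) (this.trans_eq ?_)
    · refine sum_congr rfl fun f _ => sum_congr rfl fun k _ => ?_
      simp only [hB, smul_smul, Complex.ofReal_mul]
    · refine sum_congr rfl fun x _ => ?_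
      simp only [weightedForm_self, Matrix.smul_apply, norm_smul, mul_pow, mul_sum,
        Complex.norm_real, Real.norm_eq_abs, sq_abs]
      exact sum_congr rfl fun i _ => sum_congr rfl fun j _ => by ring
  have hLsum : Fintype.card C * ∑ c, ∑ x, P x c * P x c * weightedForm w (τ x) (τ x) ≤
      L * ∑ x, weightedForm w (τ x) (τ x) := by
    rw [sum_comm, mul_sum, mul_sum]
    refine sum_le_sum fun x _ => ?_
    have h0 := weightedForm_nonneg w (hτ x) (hτ x)
    rw [← sum_mul, ← mul_assoc]
    refine mul_le_mul_of_nonneg_right ?_ h0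
    rw [mul_sum]
    calc _ ≤ ∑ c, L * P x c := sum_le_sum fun c _ => by
          rw [← mul_assoc]
          exact mul_le_mul_of_nonneg_right (hL x c) (hP x c)
      _ = L := by rw [← mul_sum, hP1, mul_one]
  have hlast : ∑ f, ∑ c, ∑ k, h f * √((#Dᶜ : ℝ) * weightedForm w (B f c k) (B f c k)) ≤
      √(Fintype.card K * L * #Dᶜ * ∑ x, weightedForm w (τ x) (τ x)) := by
    refine Real.le_sqrt_of_sq_le ?_
    simp only [Fintype.sum_prod_type] at hcs
    refine hcs.trans ?_
    rw [show ∑ f : F, ∑ _c : C, ∑ _k : K, h f = Fintype.card C * Fintype.card K by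
      rw [← hsum]; simp only [Fintype.sum_prod_type]]
    rw [sum_comm]
    calc _ = Fintype.card K * #Dᶜ * (Fintype.card C *
          ∑ c, ∑ f, ∑ k, h f * weightedForm w (B f c k) (B f c k)) := by
          simp only [mul_sum]
          exact sum_congr rfl fun c _ => sum_congr rfl fun f _ => sum_congr rfl fun k _ => by ring
      _ ≤ Fintype.card K * #Dᶜ * (L * ∑ x, weightedForm w (τ x) (τ x)) := by
          refine mul_le_mul_of_nonneg_left (le_trans ?_ hLsum) (by positivity)
          exact mul_le_mul_of_nonneg_left (sum_le_sum fun c _ => hform c) (by positivity)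
      _ = _ := by ring
  have h1 := sum_traceNorm_keyBias_le (hash := hash) hh hh1 hP hP1 hδ
  have h2 := sum_traceNorm_keyBias_le (hash := hash) hh hh1 hP hP1
    (fun x => corner_posSemidef D (hτ x))
  calc _ ≤ ∑ f, ∑ c, ∑ k, (h f * traceNorm (∑ x, ((keyBias (hash f) k x * P x c : ℝ) : ℂ) • δ x) +
        h f * traceNorm (∑ x, ((keyBias (hash f) k x * P x c : ℝ) : ℂ) • corner D (τ x)) +
        h f * √((#Dᶜ : ℝ) * weightedForm w (B f c k) (B f c k))) :=
        sum_le_sum fun f _ => sum_le_sum fun c _ => sum_le_sum fun k _ => by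
          rw [← mul_add, ← mul_add]
          exact mul_le_mul_of_nonneg_left (hbound f c k) (hh f)
    _ ≤ _ := by
        simp only [sum_add_distrib]
        linarith

end LeftoverHash

/-! ### Eve's conditional states, signal by signal -/

section EveStates

theorem bellWeight_nonneg {e : ℝ} (he0 : 0 ≤ e) (he : e ≤ 2 / 3) (i : Fin 4) :
    0 ≤ bellWeight e i := by
  unfold bellWeight
  split_ifs <;> linarith

theorem bellWeight_pos {e : ℝ} (he0 : 0 < e) (he : e < 2 / 3) (i : Fin 4) :
    0 < bellWeight e i := by
  unfold bellWeight
  split_ifs <;> linarith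

/-- The sign (or zero) of the real number `⟨a b | Bell_i⟩`. -/
def bellSign (i : Fin 4) (a b : Bool) : ℝ :=
  (if (i = 0 ∨ i = 1) ↔ a = b then 1 else 0) * (if (i = 1 ∨ i = 3) ∧ a = true then -1 else 1)

/-- The amplitude of `|i⟩_E` given the outcomes `a`, `b` on a single signal. -/
def eveAmp (e : ℝ) (a b : Bool) (i : Fin 4) : ℝ :=
  √(bellWeight e i) * (bellSign i a b / √2)

theorem eveVec_eq (e : ℝ) {n : ℕ} (x y : BitString n) (i : EveIdx n) :
    eveVec e x y i = ((∏ p, eveAmp e (x p) (y p) (i p) : ℝ) : ℂ) := by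
  rw [eveVec, Complex.ofReal_prod]
  refine prod_congr rfl fun p _ => ?_
  simp only [eveAmp, bellCoeff, bellSign, Complex.ofReal_mul, Complex.ofReal_div]
  congr 3 <;> split_ifs <;> simp

/-- The probability of the outcomes `a`, `b` on a single signal. -/
def pairProb (e : ℝ) (a b : Bool) : ℝ := (if a = b then 1 - e else e) / 2

theorem eveAmp_mul {e : ℝ} (he0 : 0 ≤ e) (he : e ≤ 2 / 3) (a b c d : Bool) (i : Fin 4) :
    eveAmp e a b i * eveAmp e c d i = bellWeight e i * (bellSign i a b * bellSign i c d) / 2 := by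
  have h1 := Real.mul_self_sqrt (bellWeight_nonneg he0 he i)
  have h2 : √(2 : ℝ) * √2 = 2 := Real.mul_self_sqrt (by norm_num)
  unfold eveAmp
  calc _ = (√(bellWeight e i) * √(bellWeight e i)) * (bellSign i a b * bellSign i c d) /
        (√2 * √2) := by field_simp
    _ = _ := by rw [h1, h2]

theorem sum_eveAmp_mul {e : ℝ} (he0 : 0 ≤ e) (he : e ≤ 2 / 3) (a b b' : Bool) :
    ∑ i, eveAmp e a b i * eveAmp e a b' i = if b = b' then pairProb e a b else 0 := by
  simp only [eveAmp_mul he0 he, Fin.sum_univ_four, pairProb, bellWeight]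
  cases a <;> cases b <;> cases b' <;> simp [bellSign] <;> ring

theorem sum_sum_eveAmp_mul {e : ℝ} (i j : Fin 4) :
    ∑ a, ∑ b, eveAmp e a b i * eveAmp e a b j =
      if i = j then √(bellWeight e i) * √(bellWeight e i) else 0 := by
  have h2 : √(2 : ℝ) * √2 = 2 := Real.mul_self_sqrt (by norm_num)
  have : ∀ a b, eveAmp e a b i * eveAmp e a b j =
      √(bellWeight e i) * √(bellWeight e j) * ((bellSign i a b * bellSign j a b) / 2) := by
    intro a b
    rw [← h2, eveAmp, eveAmp]
    field_simp
  simp only [this, ← mul_sum]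
  have hs : ∑ a, ∑ b, bellSign i a b * bellSign j a b / 2 = if i = j then 1 else 0 := by
    fin_cases i <;> fin_cases j <;> simp [bellSign] <;> norm_num
  rw [hs]
  split_ifs with h
  · rw [h, mul_one]
  · rw [mul_zero]

theorem sum_prod_pi {n : ℕ} {α R : Type*} [Fintype α] [CommSemiring R] (f : Fin n → α → R) :
    ∑ i : Fin n → α, ∏ p, f p (i p) = ∏ p, ∑ a, f p a := by
  classical
  rw [prod_univ_sum, Fintype.piFinset_univ]

/-- The probability of Alice's outcome `x` and Bob's outcome `y`. -/
def outcomeProb (e : ℝ) {n : ℕ} (x y : BitString n) : ℝ := ∏ p, pairProb e (x p) (y p)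

/-- For fixed x, distinct outcomes of Bob leave Eve in orthogonal vectors: on each signal, flip and
no flip use disjoint Bell labels. These vectors therefore diagonalize the block of x. -/
theorem sum_eveVec_mul_star {e : ℝ} (he0 : 0 ≤ e) (he : e ≤ 2 / 3) {n : ℕ} (x y y' : BitString n) :
    ∑ i, eveVec e x y i * star (eveVec e x y' i) =
      if y = y' then (outcomeProb e x y : ℂ) else 0 := by
  simp only [eveVec_eq, Complex.star_def, Complex.conj_ofReal, ← Complex.ofReal_mul,
    ← prod_mul_distrib]
  rw [← Complex.ofReal_sum, sum_prod_pi (fun p a => eveAmp e (x p) (y p) a * eveAmp e (x p) (y' p) a)]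
  simp only [sum_eveAmp_mul he0 he]
  split_ifs with h
  · subst h
    simp [outcomeProb]
  · obtain ⟨p, hp⟩ := Function.ne_iff.1 h
    rw [prod_eq_zero (mem_univ p) (if_neg hp), Complex.ofReal_zero]

theorem trace_rhoXYE {e : ℝ} (he0 : 0 ≤ e) (he : e ≤ 2 / 3) {n : ℕ} (x y : BitString n) :
    (rhoXYE e x y).trace = (outcomeProb e x y : ℂ) := by
  have h := sum_eveVec_mul_star he0 he x y y
  rw [if_pos rfl] at h
  rw [← h]
  simp [rhoXYE, Matrix.trace, vecMulVec_apply]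

theorem rhoXYE_posSemidef (e : ℝ) {n : ℕ} (x y : BitString n) : (rhoXYE e x y).PosSemidef :=
  posSemidef_vecMulVec_self_star _

/-- Tracing out the orthonormal Bell vectors kills all coherences between Eve's labels. -/
theorem rhoE_eq {e : ℝ} (he0 : 0 ≤ e) (he : e ≤ 2 / 3) (n : ℕ) :
    rhoE e n = diagonal fun i => ((∏ p, bellWeight e (i p) : ℝ) : ℂ) := by
  ext i j
  have h : rhoE e n i j = ((∏ p, ∑ a, ∑ b, eveAmp e a b (i p) * eveAmp e a b (j p) : ℝ) : ℂ) := by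
    rw [← sum_prod_pi (fun p a => ∑ b, eveAmp e a b (i p) * eveAmp e a b (j p))]
    simp only [rhoE, Matrix.sum_apply, rhoXYE, vecMulVec_apply, Pi.star_apply, eveVec_eq,
      Complex.star_def, Complex.conj_ofReal, ← Complex.ofReal_mul, ← prod_mul_distrib,
      ← Complex.ofReal_sum]
    congr 1
    refine sum_congr rfl fun x _ => ?_
    rw [sum_prod_pi (fun p b => eveAmp e (x p) b (i p) * eveAmp e (x p) b (j p))]
  rw [h]
  simp only [sum_sum_eveAmp_mul]
  by_cases hij : i = j
  · subst hij
    simp [Real.mul_self_sqrt (bellWeight_nonneg he0 he _)]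
  · rw [diagonal_apply_ne _ hij]
    obtain ⟨p, hp⟩ := Function.ne_iff.1 hij
    rw [prod_eq_zero (mem_univ p) (if_neg hp), Complex.ofReal_zero]

theorem sum_bellWeight (e : ℝ) : ∑ i, bellWeight e i = 1 := by
  rw [Fin.sum_univ_four]
  simp [bellWeight]
  ring

theorem sum_prod_bellWeight (e : ℝ) (n : ℕ) : ∑ i : EveIdx n, ∏ p, bellWeight e (i p) = 1 := by
  rw [sum_prod_pi (fun _ a => bellWeight e a)]
  simp [sum_bellWeight]

theorem sum_outcomeProb (e : ℝ) {n : ℕ} : ∑ x : BitString n, ∑ y, outcomeProb e x y = 1 := by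
  have h : ∀ x : BitString n, ∑ y, outcomeProb e x y = ∏ p : Fin n, (1 / 2 : ℝ) := by
    intro x
    simp only [outcomeProb]
    rw [sum_prod_pi (fun p b => pairProb e (x p) b)]
    refine prod_congr rfl fun p _ => ?_
    cases x p <;> simp [pairProb] <;> ring
  simp [h]

/-- The set of positions at which two strings differ. -/
def errSet {n : ℕ} (x y : BitString n) : Finset (Fin n) := {p | x p ≠ y p}

theorem errSet_bijective {n : ℕ} (x : BitString n) : Function.Bijective (errSet x) := by
  refine (Fintype.bijective_iff_injective_and_card _).2 ⟨fun y y' h => ?_, by simp⟩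
  funext p
  have := congrArg (p ∈ ·) h
  simp only [errSet, mem_filter, mem_univ, true_and, eq_iff_iff] at this
  revert this
  cases x p <;> cases y p <;> cases y' p <;> simp

theorem sum_errSet {n : ℕ} (x : BitString n) (f : Finset (Fin n) → ℝ) :
    ∑ y, f (errSet x y) = ∑ s, f s :=
  (errSet_bijective x).sum_comp f

/-- The weight `(1 - e)^{n-k} e^k` of an error pattern with `k` errors. -/
def errWeight (e : ℝ) (n k : ℕ) : ℝ := (1 - e) ^ (n - k) * e ^ k

theorem outcomeProb_eq (e : ℝ) {n : ℕ} (x y : BitString n) :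
    outcomeProb e x y = errWeight e n #(errSet x y) / 2 ^ n := by
  unfold outcomeProb pairProb
  rw [prod_div_distrib, prod_const, card_univ, Fintype.card_fin, prod_ite, prod_const, prod_const,
    errWeight]
  congr 3
  rw [errSet, filter_not, card_sdiff_of_subset (filter_subset _ _), card_univ, Fintype.card_fin]
  have := card_le_univ (univ.filter fun p => x p = y p)
  rw [Fintype.card_fin] at this
  omega

theorem sum_finset_card {n : ℕ} (f : ℕ → ℝ) :
    ∑ s : Finset (Fin n), f #s = ∑ k ∈ range (n + 1), (n.choose k : ℝ) * f k := by
  rw [← powerset_univ, sum_powerset_apply_card]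
  simp

theorem sum_choose_mul_errWeight (e : ℝ) (n : ℕ) :
    ∑ k ∈ range (n + 1), (n.choose k : ℝ) * errWeight e n k = 1 := by
  have := add_pow e (1 - e) n
  rw [show e + (1 - e) = 1 by ring, one_pow] at this
  rw [this]
  exact sum_congr rfl fun k _ => by unfold errWeight; ring

end EveStates

/-! ### Spectrum of a block and the purity of the modified state -/

section Spectrum

theorem card_bitString_lt {n : ℕ} (hn : 1 ≤ n) :
    Fintype.card (BitString n) < Fintype.card (EveIdx n) := by
  simp only [Fintype.card_fun, Fintype.card_fin, Fintype.card_bool]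
  exact Nat.pow_lt_pow_left (by norm_num) (by omega)

-- The block is a product AB whose columns and rows are Eve's vectors. By orthogonality BA is
-- diagonal, and AB has the same characteristic polynomial up to a power of X.
open Polynomial in
theorem charpoly_eveBlock {e : ℝ} (he0 : 0 ≤ e) (he : e ≤ 2 / 3) {n : ℕ} (hn : 1 ≤ n)
    (x : BitString n) :
    (eveBlock e x).charpoly = X ^ (Fintype.card (EveIdx n) - Fintype.card (BitString n)) *
      ∏ y, (X - C ((errWeight e n #(errSet x y) : ℝ) : ℂ)) := by
  set A : Matrix (EveIdx n) (BitString n) ℂ := of fun i y => (2 : ℂ) ^ n * eveVec e x y i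
  set B : Matrix (BitString n) (EveIdx n) ℂ := of fun y i => star (eveVec e x y i)
  have hAB : eveBlock e x = A * B := by
    ext i j
    simp only [eveBlock, Matrix.smul_apply, Matrix.sum_apply, rhoXYE, vecMulVec_apply,
      Pi.star_apply, smul_eq_mul, Matrix.mul_apply, A, B, of_apply, mul_sum, mul_assoc]
  have hBA : B * A = diagonal fun y => ((errWeight e n #(errSet x y) : ℝ) : ℂ) := by
    ext y y'
    have h : (B * A) y y' = (2 : ℂ) ^ n * ∑ i, eveVec e x y' i * star (eveVec e x y i) := by
      simp only [Matrix.mul_apply, A, B, of_apply, mul_sum]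
      exact sum_congr rfl fun i _ => by ring
    rw [h, sum_eveVec_mul_star he0 he, diagonal_apply]
    by_cases hy : y = y'
    · subst hy
      rw [if_pos rfl, if_pos rfl, outcomeProb_eq]
      push_cast
      field_simp
    · rw [if_neg hy, if_neg (Ne.symm hy), mul_zero]
  rw [hAB, charpoly_mul_comm_of_le _ _ (card_bitString_lt hn).le, hBA, charpoly_diagonal]

theorem map_eigenvalues_eveBlock {e : ℝ} (he0 : 0 ≤ e) (he : e ≤ 2 / 3) {n : ℕ} (hn : 1 ≤ n)
    (x : BitString n) :
    univ.val.map (eveBlock_isHermitian e x).eigenvalues =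
      Multiset.replicate (Fintype.card (EveIdx n) - Fintype.card (BitString n)) 0 +
        univ.val.map fun y => errWeight e n #(errSet x y) := by
  refine map_eigenvalues_of_charpoly_eq _ ?_
  rw [charpoly_eveBlock he0 he hn x, Multiset.map_add, Multiset.prod_add, Multiset.map_replicate,
    Multiset.prod_replicate, Multiset.map_map]
  simp only [Complex.ofReal_zero, map_zero, sub_zero]
  rfl

/-- The distinct eigenvalues of a block in decreasing order, followed by `0`. -/
def blockLevel (e : ℝ) (n k : ℕ) : ℝ := if k ≤ n then errWeight e n k else 0

theorem errWeight_pos {e : ℝ} (he0 : 0 < e) (he : e < 1 / 2) (n k : ℕ) : 0 < errWeight e n k :=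
  mul_pos (pow_pos (by linarith) _) (pow_pos he0 _)

theorem blockLevel_strictAnti {e : ℝ} (he0 : 0 < e) (he : e < 1 / 2) {n k : ℕ} (hk : k ≤ n) :
    blockLevel e n (k + 1) < blockLevel e n k := by
  unfold blockLevel
  rw [if_pos hk]
  split_ifs with h
  · unfold errWeight
    rw [show n - k = (n - (k + 1)) + 1 by omega, pow_succ, pow_succ]
    have h1 : 0 < (1 - e) ^ (n - (k + 1)) := pow_pos (by linarith) _
    have h2 : 0 < e ^ k := pow_pos he0 _
    have h3 := mul_pos h1 h2
    nlinarith
  · exact errWeight_pos he0 he n k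

theorem blockLevel_lt {e : ℝ} (he0 : 0 < e) (he : e < 1 / 2) {n j k : ℕ} (hjk : j < k)
    (hk : k ≤ n + 1) : blockLevel e n k < blockLevel e n j := by
  induction k, hjk using Nat.le_induction with
  | base => exact blockLevel_strictAnti he0 he (by omega)
  | succ k _ ih => exact (blockLevel_strictAnti he0 he (by omega)).trans (ih (by omega))

theorem image_eigenvalues_eveBlock {e : ℝ} (he0 : 0 < e) (he : e < 1 / 2) {n : ℕ} (hn : 1 ≤ n)
    (x : BitString n) :
    univ.image (eveBlock_isHermitian e x).eigenvalues =
      (range (n + 2)).image fun i => blockLevel e n (n + 1 - i) := by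
  -- Since n ≥ 1, the block has a kernel; hence n + 2 distinct eigenvalues and not n + 1.
  have h0 : Fintype.card (EveIdx n) - Fintype.card (BitString n) ≠ 0 := by
    have := card_bitString_lt hn
    omega
  ext v
  rw [Finset.mem_image]
  have h1 : (∃ a ∈ univ, (eveBlock_isHermitian e x).eigenvalues a = v) ↔
      v ∈ univ.val.map (eveBlock_isHermitian e x).eigenvalues := by simp
  rw [h1, map_eigenvalues_eveBlock he0.le (by linarith) hn, Multiset.mem_add,
    Multiset.mem_replicate, Multiset.mem_map, Finset.mem_image]
  constructor
  · rintro (⟨-, rfl⟩ | ⟨y, -, rfl⟩)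
    · exact ⟨0, by simp, by simp [blockLevel]⟩
    · have hc : #(errSet x y) ≤ n := (card_le_univ _).trans_eq (Fintype.card_fin n)
      refine ⟨n + 1 - #(errSet x y), by simp; omega, ?_⟩
      rw [show n + 1 - (n + 1 - #(errSet x y)) = #(errSet x y) by omega, blockLevel, if_pos hc]
  · rintro ⟨i, hi, rfl⟩
    rw [mem_range] at hi
    rcases Nat.eq_zero_or_pos i with rfl | hpos
    · exact Or.inl ⟨h0, by simp [blockLevel]⟩
    · obtain ⟨s, hs⟩ : ∃ s : Finset (Fin n), #s = n + 1 - i := by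
        obtain ⟨s, -, hs⟩ := exists_subset_card_eq (s := (univ : Finset (Fin n)))
          (n := n + 1 - i) (by simp; omega)
        exact ⟨s, hs⟩
      obtain ⟨y, hy⟩ := (errSet_bijective x).2 s
      refine Or.inr ⟨y, mem_univ _, ?_⟩
      rw [hy, hs, blockLevel, if_pos (by omega)]

/-- As e < 1/2, each further error lowers the eigenvalue, so increasing order reverses the error
count; k = n + 1 stands for the kernel. -/
theorem eigLevel_eveBlock {e : ℝ} (he0 : 0 < e) (he : e < 1 / 2) {n : ℕ} (hn : 1 ≤ n)
    (x : BitString n) {k : ℕ} (hk : k ≤ n + 1) :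
    eigLevel (eveBlock_isHermitian e x) (n + 1 - k) = blockLevel e n k := by
  have hsort : (univ.image (eveBlock_isHermitian e x).eigenvalues).sort (· ≤ ·) =
      (List.range (n + 2)).map fun i => blockLevel e n (n + 1 - i) := by
    have hlt : ((List.range (n + 2)).map fun i => blockLevel e n (n + 1 - i)).Pairwise (· < ·) := by
      rw [List.pairwise_map]
      refine List.Pairwise.imp_of_mem ?_ List.pairwise_lt_range
      intro i j hi hj hij
      rw [List.mem_range] at hi hj
      exact blockLevel_lt he0 he (by omega) (by omega)
    have hset : univ.image (eveBlock_isHermitian e x).eigenvalues =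
        ((List.range (n + 2)).map fun i => blockLevel e n (n + 1 - i)).toFinset := by
      rw [image_eigenvalues_eveBlock he0 he hn]
      ext v
      simp
    rw [hset, List.toFinset_sort _ (hlt.imp fun h => h.ne)]
    exact hlt.imp fun h => h.le
  rw [eigLevel, hsort, List.getD_eq_getElem _ _ (by simp; omega)]
  simp only [List.getElem_map, List.getElem_range]
  congr 1
  omega

theorem eigMult_eveBlock {e : ℝ} (he0 : 0 < e) (he : e < 1 / 2) {n : ℕ} (hn : 1 ≤ n)
    (x : BitString n) {k : ℕ} (hk : k ≤ n) :
    (eigMult (eveBlock_isHermitian e x) (n + 1 - k) : ℝ) = n.choose k := by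
  have hcount : eigMult (eveBlock_isHermitian e x) (n + 1 - k) =
      (univ.val.map (eveBlock_isHermitian e x).eigenvalues).count (blockLevel e n k) := by
    rw [Multiset.count_map, eigMult, eigLevel_eveBlock he0 he hn x (by omega), card_def, filter_val]
    simp only [eq_comm]
  rw [hcount, map_eigenvalues_eveBlock he0.le (by linarith) hn, Multiset.count_add,
    Multiset.count_replicate, blockLevel, if_pos hk, if_neg (errWeight_pos he0 he n k).ne, zero_add,
    Multiset.count_map, ← filter_val, ← card_def, card_eq_sum_ones, sum_filter]
  push_cast
  rw [sum_errSet x (fun s => if errWeight e n k = errWeight e n #s then (1 : ℝ) else 0),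
    sum_finset_card (fun j => if errWeight e n k = errWeight e n j then (1 : ℝ) else 0),
    sum_eq_single k]
  · simp
  · intro j hj hjk
    rw [mem_range] at hj
    rw [if_neg, mul_zero]
    intro h
    have hb : blockLevel e n k = blockLevel e n j := by
      rw [blockLevel, blockLevel, if_pos hk, if_pos (by omega), h]
    rcases lt_or_gt_of_ne hjk with h' | h'
    · exact (blockLevel_lt he0 he h' (by omega)).ne hb
    · exact (blockLevel_lt he0 he h' (by omega)).ne hb.symm
  · intro h
    simp at h
    omega

/-- Injectivity of the levels makes the projectors mutually orthogonal, so no eigenspace is counted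
twice. -/
theorem trace_sum_smul_eigProj_sq {ι : Type*} [Fintype ι] [DecidableEq ι] {B : Matrix ι ι ℂ}
    (hB : B.IsHermitian) (N : ℕ) (hinj : Set.InjOn (eigLevel hB) (range N)) (μ : ℕ → ℝ) :
    ((∑ i ∈ range N, (μ i : ℂ) • eigProj hB (eigLevel hB i)) *
      ∑ i ∈ range N, (μ i : ℂ) • eigProj hB (eigLevel hB i)).trace =
        ((∑ i ∈ range N, (eigMult hB i : ℝ) * μ i ^ 2 : ℝ) : ℂ) := by
  set V : Matrix ι ι ℂ := (hB.eigenvectorUnitary : Matrix ι ι ℂ) with hV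
  have hVV : Vᴴ * V = 1 := mem_unitaryGroup_iff'.1 hB.eigenvectorUnitary.2
  set g : ι → ℝ := fun j => ∑ i ∈ range N, if hB.eigenvalues j = eigLevel hB i then μ i else 0
  have h : ∑ i ∈ range N, (μ i : ℂ) • eigProj hB (eigLevel hB i) =
      V * diagonal (fun j => (g j : ℂ)) * Vᴴ := by
    have : diagonal (fun j => (g j : ℂ)) = ∑ i ∈ range N, (μ i : ℂ) •
        diagonal (fun j => if hB.eigenvalues j = eigLevel hB i then (1 : ℂ) else 0) := by
      ext j j'
      rw [Matrix.sum_apply]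
      by_cases hj : j = j'
      · subst hj
        simp only [g, diagonal_apply_eq, Complex.ofReal_sum, Matrix.smul_apply, smul_eq_mul]
        refine sum_congr rfl fun i _ => ?_
        split_ifs <;> simp
      · simp [diagonal_apply_ne _ hj]
    rw [this, Matrix.mul_sum, Matrix.sum_mul]
    refine sum_congr rfl fun i _ => ?_
    rw [eigProj, mul_smul_comm, smul_mul_assoc]
  have hsq : V * diagonal (fun j => (g j : ℂ)) * Vᴴ * (V * diagonal (fun j => (g j : ℂ)) * Vᴴ) =
      V * (diagonal (fun j => (g j : ℂ)) * (Vᴴ * V) * diagonal (fun j => (g j : ℂ))) * Vᴴ := by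
    simp only [mul_assoc]
  rw [h, hsq, hVV, mul_one, diagonal_mul_diagonal, Matrix.trace_mul_comm, ← mul_assoc, hVV,
    one_mul, trace_diagonal]
  simp only [← Complex.ofReal_mul, ← Complex.ofReal_sum]
  congr 1
  have hg : ∀ j, g j * g j =
      ∑ i ∈ range N, if hB.eigenvalues j = eigLevel hB i then μ i ^ 2 else 0 := by
    intro j
    by_cases hex : ∃ i ∈ range N, hB.eigenvalues j = eigLevel hB i
    · obtain ⟨i, hi, hij⟩ := hex
      have key : ∀ f : ℕ → ℝ, (∑ i ∈ range N, if hB.eigenvalues j = eigLevel hB i then f i else 0) =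
          f i := by
        intro f
        rw [sum_eq_single i, if_pos hij]
        · intro i' hi' hne
          rw [if_neg]
          intro h'
          exact hne (hinj hi' hi (h'.symm.trans hij))
        · exact fun h' => absurd hi h'
      simp only [g, key]
      ring
    · push Not at hex
      have key : ∀ f : ℕ → ℝ, (∑ i ∈ range N, if hB.eigenvalues j = eigLevel hB i then f i else 0) =
          0 := fun f => sum_eq_zero fun i hi => if_neg (hex i hi)
      simp only [g, key]
      ring
  simp only [hg]
  rw [sum_comm]
  refine sum_congr rfl fun i _ => ?_
  rw [eigMult, ← sum_filter, sum_const, nsmul_eq_mul]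

/-- Lowering the largest values of a sequence to a common level, so that the weight `c` is lost. -/
theorem sum_cut {n b : ℕ} {w v : ℕ → ℝ} (hw : ∀ k ≤ n, 0 < w k) {s : ℕ → ℝ}
    (hs : ∀ r ≤ n + 1, s r = ∑ k ∈ range r, w k * (v k - v r)) (hb : b ≤ n) {c lev : ℝ}
    (hsb : s b ≤ c) (hsb1 : c < s (b + 1))
    (hlev : lev = v b - (c - s b) / ∑ k ∈ range (b + 1), w k) :
    lev ≤ v b ∧ v (b + 1) ≤ lev ∧ ∑ k ∈ range (b + 1), w k * (v k - lev) = c := by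
  have hW : 0 < ∑ k ∈ range (b + 1), w k :=
    sum_pos (fun k hk => hw k (by rw [mem_range] at hk; omega)) (by simp)
  set W := ∑ k ∈ range (b + 1), w k
  -- The weight lost by lowering to `t` is affine in `t`. It equals `s b` at `v b` and `s (b + 1)`
  -- at `v (b + 1)`, so the value `c` is reached in between.
  have hsum : ∀ t, ∑ k ∈ range (b + 1), w k * (v k - t) = s b + W * (v b - t) := by
    intro t
    rw [hs b (by omega)]
    have : ∑ k ∈ range (b + 1), w k * (v k - v b) = ∑ k ∈ range b, w k * (v k - v b) := by
      rw [sum_range_succ, sub_self, mul_zero, add_zero]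
    rw [← this, sum_mul, ← sum_add_distrib]
    exact sum_congr rfl fun k _ => by ring
  have h1 := hs (b + 1) (by omega)
  rw [hsum] at h1
  have hdiv : W * ((c - s b) / W) = c - s b := by field_simp
  refine ⟨?_, ?_, ?_⟩
  · rw [hlev]
    have : 0 ≤ (c - s b) / W := div_nonneg (by linarith) hW.le
    linarith
  · rw [hlev]
    have : (c - s b) / W ≤ v b - v (b + 1) := by
      rw [div_le_iff₀ hW]
      linarith
    linarith
  · rw [hsum, hlev]
    linarith

/-- Here μ is indexed by the number of errors and omits the weight that the modified entropy puts on
the kernel. That weight only increases the purity, whence the inequality at the end. -/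
theorem exists_cut_eveBlock {e : ℝ} (he0 : 0 < e) (he : e < 1 / 2) {n : ℕ} (hn : 1 ≤ n) {ε : ℝ}
    (hε0 : 0 ≤ ε) (hε : ε / 2 < 1) :
    ∃ μ : ℕ → ℝ, (∀ k ≤ n, 0 ≤ μ k ∧ μ k ≤ errWeight e n k) ∧ (∀ k < n, μ (k + 1) ≤ μ k) ∧
      ∑ k ∈ range (n + 1), (n.choose k : ℝ) * μ k = 1 - ε / 2 ∧
      ∀ x : BitString n, ∑ k ∈ range (n + 1), (n.choose k : ℝ) * μ k ^ 2 ≤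
        ∑ i ∈ range (n + 2), (eigMult (eveBlock_isHermitian e x) i : ℝ) *
          modEig (eveBlock_isHermitian e x) n ε i ^ 2 := by
  classical
  set s : ℕ → ℝ := fun r => ∑ k ∈ range r, (n.choose k : ℝ) * (blockLevel e n k - blockLevel e n r)
    with hs
  set b : ℕ := ((range (n + 2)).filter fun r => s r ≤ ε / 2).sup id with hb
  have hw : ∀ k ≤ n, (0 : ℝ) < n.choose k := fun k hk => by
    exact_mod_cast Nat.choose_pos hk
  -- Lowering everything to 0 removes the whole trace. As ε/2 < 1, this forces b ≤ n, so that level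
  -- b + 1 exists.
  have hlast : s (n + 1) = 1 := by
    rw [← sum_choose_mul_errWeight e n]
    refine sum_congr rfl fun k hk => ?_
    rw [mem_range] at hk
    simp [blockLevel, Nat.lt_succ_iff.1 hk]
  have hbmem : b ∈ (range (n + 2)).filter fun r => s r ≤ ε / 2 := by
    have hne : ((range (n + 2)).filter fun r => s r ≤ ε / 2).Nonempty := by
      refine ⟨0, mem_filter.2 ⟨by simp, ?_⟩⟩
      simp only [hs, range_zero, sum_empty]
      linarith
    obtain ⟨r, hr, hr2⟩ := exists_mem_eq_sup _ hne id
    rw [hb, hr2]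
    exact hr
  have hsb : s b ≤ ε / 2 := (mem_filter.1 hbmem).2
  have hbn : b ≤ n := by
    have h1 := mem_range.1 (mem_filter.1 hbmem).1
    have h2 : b ≠ n + 1 := by
      intro h
      rw [h, hlast] at hsb
      linarith
    omega
  have hsb1 : ε / 2 < s (b + 1) := by
    by_contra hcon
    have : b + 1 ∈ (range (n + 2)).filter fun r => s r ≤ ε / 2 :=
      mem_filter.2 ⟨by simp; omega, not_lt.1 hcon⟩
    have h2 : b + 1 ≤ b := le_sup (f := id) this
    omega
  set lev : ℝ := blockLevel e n b - (ε / 2 - s b) / ∑ k ∈ range (b + 1), (n.choose k : ℝ) with hlev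
  obtain ⟨h1, h2, h3⟩ := sum_cut hw (fun r _ => rfl) hbn hsb hsb1 hlev
  have hanti : ∀ {j k}, j ≤ k → k ≤ n + 1 → blockLevel e n k ≤ blockLevel e n j := by
    intro j k hjk hk
    rcases hjk.eq_or_lt with rfl | hlt
    · exact le_rfl
    · exact (blockLevel_lt he0 he hlt hk).le
  have hnonneg : ∀ k, 0 ≤ blockLevel e n k := by
    intro k
    unfold blockLevel
    split_ifs
    · exact (errWeight_pos he0 he n k).le
    · exact le_rfl
  refine ⟨fun k => if k ≤ b then lev else blockLevel e n k, fun k hk => ?_, fun k hk => ?_, ?_,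
    fun x => ?_⟩
  · have hk' : errWeight e n k = blockLevel e n k := by rw [blockLevel, if_pos hk]
    rw [hk']
    simp only
    split_ifs with hkb
    · exact ⟨(hnonneg _).trans h2, h1.trans (hanti hkb (by omega))⟩
    · exact ⟨hnonneg _, le_rfl⟩
  · simp only
    by_cases hkb : k + 1 ≤ b
    · rw [if_pos hkb, if_pos (by omega)]
    · rw [if_neg hkb]
      split_ifs with hkb'
      · rwa [show k + 1 = b + 1 by omega]
      · exact hanti (by omega) (by omega)
  · have hsplit : ∑ k ∈ range (n + 1), (n.choose k : ℝ) *
        (errWeight e n k - if k ≤ b then lev else blockLevel e n k) = ε / 2 := by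
      rw [← h3]
      symm
      refine sum_subset_zero_on_sdiff (range_subset_range.2 (by omega)) (fun k hk => ?_)
        (fun k hk => ?_)
      · rw [mem_sdiff, mem_range, mem_range] at hk
        rw [if_neg (by omega), blockLevel, if_pos (by omega), sub_self, mul_zero]
      · rw [mem_range] at hk
        rw [if_pos (by omega), blockLevel, if_pos (by omega)]
    simp only [mul_sub, sum_sub_distrib, sum_choose_mul_errWeight] at hsplit
    linarith
  · have hsP : ∀ r ≤ n + 1, sPlus (eveBlock_isHermitian e x) n r = s r := by
      intro r hr
      rw [sPlus, show Icc 1 r = Ico 1 (r + 1) by ext; simp, sum_Ico_eq_sum_range,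
        Nat.add_sub_cancel]
      refine sum_congr rfl fun k hk => ?_
      rw [mem_range] at hk
      rw [show n + 2 - (1 + k) = n + 1 - k by omega, eigMult_eveBlock he0 he hn x (by omega),
        eigLevel_eveBlock he0 he hn x (by omega), eigLevel_eveBlock he0 he hn x hr]
    have hbP : bPlus (eveBlock_isHermitian e x) n ε = b := by
      rw [bPlus, hb]
      congr 1
      refine filter_congr fun r hr => ?_
      rw [hsP r (by rw [mem_range] at hr; omega)]
    have hlP : levelPlus (eveBlock_isHermitian e x) n ε = lev := by
      rw [levelPlus, hbP, hsP b (by omega), eigLevel_eveBlock he0 he hn x (by omega), hlev]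
      congr 2
      refine sum_congr rfl fun k hk => ?_
      rw [mem_range] at hk
      exact eigMult_eveBlock he0 he hn x (by omega)
    -- Split off the kernel term i = 0 and discard it; the remaining levels match after the
    -- reflection i = n + 1 - k.
    rw [show n + 2 = (n + 1) + 1 by ring, sum_range_succ' _ (n + 1)]
    refine le_add_of_le_of_nonneg ?_ (mul_nonneg (Nat.cast_nonneg _) (sq_nonneg _))
    rw [← sum_range_reflect]
    refine le_of_eq (sum_congr rfl fun i hi => ?_)
    rw [mem_range] at hi
    have hi' : n + 1 - (n + 1 - 1 - i) = i + 1 := by omega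
    have hk : n + 1 - 1 - i ≤ n := by omega
    rw [← hi', eigMult_eveBlock he0 he hn x hk]
    congr 2
    rw [modEig, hbP, hlP, if_neg (by omega), hi']
    beta_reduce
    by_cases hkb : n + 1 - 1 - i ≤ b
    · rw [if_pos hkb, if_neg (by omega)]
    · rw [if_neg hkb, if_pos (by omega), ← hi', eigLevel_eveBlock he0 he hn x (by omega)]

theorem sum_le_trace_tauOp_sq {e : ℝ} (he0 : 0 < e) (he : e < 1 / 2) {n : ℕ} (hn : 1 ≤ n) (ε : ℝ)
    {S : ℝ} (hS : ∀ x : BitString n, S ≤ ∑ i ∈ range (n + 2),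
      (eigMult (eveBlock_isHermitian e x) i : ℝ) *
          modEig (eveBlock_isHermitian e x) n ε i ^ 2) :
    S / 2 ^ n ≤ (tauOp (fun x : BitString n => eveBlock_isHermitian e x) ε *
      tauOp (fun x : BitString n => eveBlock_isHermitian e x) ε).trace.re := by
  have hinj : ∀ x : BitString n,
      Set.InjOn (eigLevel (eveBlock_isHermitian e x)) (range (n + 2)) := by
    intro x i hi j hj hij
    rw [mem_coe, mem_range] at hi hj
    rw [show i = n + 1 - (n + 1 - i) by omega, show j = n + 1 - (n + 1 - j) by omega,
      eigLevel_eveBlock he0 he hn x (by omega), eigLevel_eveBlock he0 he hn x (by omega)] at hij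
    rcases lt_trichotomy (n + 1 - i) (n + 1 - j) with h | h | h
    · exact absurd hij (blockLevel_lt he0 he h (by omega)).ne'
    · omega
    · exact absurd hij (blockLevel_lt he0 he h (by omega)).ne
  rw [tauOp, ← blockDiagonal_mul, trace_blockDiagonal]
  simp only [smul_mul_smul_comm, trace_smul]
  rw [sum_congr rfl fun x _ => by rw [trace_sum_smul_eigProj_sq _ _ (hinj x)], Complex.re_sum]
  have hc : ((2 : ℂ) ^ n)⁻¹ * ((2 : ℂ) ^ n)⁻¹ = ((((2 : ℝ) ^ n)⁻¹ * ((2 : ℝ) ^ n)⁻¹ : ℝ) : ℂ) := by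
    push_cast
    rfl
  simp only [hc, smul_eq_mul, ← Complex.ofReal_mul, Complex.ofReal_re]
  calc S / 2 ^ n = ∑ _x : BitString n, ((2 : ℝ) ^ n)⁻¹ * ((2 : ℝ) ^ n)⁻¹ * S := by
        rw [sum_const, card_univ, Fintype.card_fun, Fintype.card_fin, Fintype.card_bool, nsmul_eq_mul]
        push_cast
        field_simp
    _ ≤ _ := sum_le_sum fun x _ => mul_le_mul_of_nonneg_left (hS x) (by positivity)

end Spectrum

/-! ### Smooth entropy of order zero: reduction to sets of basis vectors -/

section SmoothZero

variable {ι : Type*} [Fintype ι] [DecidableEq ι]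

/-- The diagonal of a projector of rank `rank σ` whose complement carries little weight of
`diagonal α`, for `diagonal α` close to `σ`. -/
theorem exists_diag_of_rank {σ : Matrix ι ι ℂ} (hσ : σ.IsHermitian) (α : ι → ℝ) :
    ∃ d : ι → ℝ, (∀ i, 0 ≤ d i ∧ d i ≤ 1) ∧ ∑ i, d i = σ.rank ∧
      ∑ i, (1 - d i) * α i ≤
        (traceNorm (σ - diagonal fun i => (α i : ℂ)) + ∑ i, α i - σ.trace.re) / 2 := by
  set V : Matrix ι ι ℂ := (hσ.eigenvectorUnitary : Matrix ι ι ℂ) with hV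
  have hVV : Vᴴ * V = 1 := mem_unitaryGroup_iff'.1 hσ.eigenvectorUnitary.2
  have hVV' : V * Vᴴ = 1 := mem_unitaryGroup_iff.1 hσ.eigenvectorUnitary.2
  set f : ι → ℝ := fun j => if hσ.eigenvalues j ≠ 0 then 1 else 0 with hf
  set P : Matrix ι ι ℂ := V * diagonal (fun j => (f j : ℂ)) * Vᴴ with hP
  have hPii : ∀ i, P i i = ((∑ j, f j * ‖V i j‖ ^ 2 : ℝ) : ℂ) := by
    intro i
    rw [hP, Matrix.mul_apply, Complex.ofReal_sum]
    refine sum_congr rfl fun j _ => ?_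
    rw [mul_diagonal, conjTranspose_apply, mul_right_comm, Complex.star_def, Complex.mul_conj,
      Complex.normSq_eq_norm_sq, mul_comm, Complex.ofReal_mul]
  have hPσ : P * σ = σ := by
    have h1 : σ = V * diagonal (fun i => (hσ.eigenvalues i : ℂ)) * Vᴴ :=
      IsHermitian.eq_conj_diagonal hσ
    conv_lhs => rw [h1, hP]
    conv_rhs => rw [h1]
    calc _ = V * (diagonal (fun j => (f j : ℂ)) * (Vᴴ * V) *
          diagonal (fun i => (hσ.eigenvalues i : ℂ))) * Vᴴ := by simp only [mul_assoc]
      _ = _ := by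
        rw [hVV, mul_one, diagonal_mul_diagonal]
        congr 3
        ext j
        simp only [hf]
        split_ifs with h
        · simp
        · rw [not_not.1 h]; simp
  -- The reflection in the support of σ, tested against `diagonal α - σ`, yields the weight of α off
  -- the support, because Pσ = σ.
  have hU : 1 - (2 : ℂ) • P ∈ unitaryGroup ι ℂ := by
    have h1 : 1 - (2 : ℂ) • P = V * diagonal (fun j => 1 - 2 * (f j : ℂ)) * Vᴴ := by
      have : diagonal (fun j => 1 - 2 * (f j : ℂ)) = 1 - (2 : ℂ) • diagonal (fun j => (f j : ℂ)) := by
        rw [← diagonal_one, ← diagonal_smul, diagonal_sub]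
        rfl
      rw [this, mul_sub, sub_mul, mul_one, hVV', mul_smul_comm, smul_mul_assoc]
    have h2 : diagonal (fun j => 1 - 2 * (f j : ℂ)) ∈ unitaryGroup ι ℂ := by
      rw [mem_unitaryGroup_iff, star_eq_conjTranspose, diagonal_conjTranspose,
        diagonal_mul_diagonal, ← diagonal_one]
      congr 1
      ext j
      simp only [hf, Pi.star_apply]
      split_ifs <;> simp <;> norm_num
    rw [h1]
    exact mul_mem (mul_mem hσ.eigenvectorUnitary.2 h2) (Unitary.star_mem hσ.eigenvectorUnitary.2)
  have hα : (diagonal fun i => (α i : ℂ)).IsHermitian := by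
    unfold Matrix.IsHermitian
    rw [diagonal_conjTranspose]
    congr 1
    ext i
    simp
  refine ⟨fun i => (P i i).re, fun i => ?_, ?_, ?_⟩
  · beta_reduce
    rw [hPii, Complex.ofReal_re]
    have hf1 : ∀ j, 0 ≤ f j ∧ f j ≤ 1 := fun j => by
      simp only [hf]
      split_ifs <;> norm_num
    refine ⟨sum_nonneg fun j _ => mul_nonneg (hf1 j).1 (sq_nonneg _), ?_⟩
    rw [← row_sum_norm_sq hσ.eigenvectorUnitary.2 i]
    exact sum_le_sum fun j _ => mul_le_of_le_one_left (sq_nonneg _) (hf1 j).2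
  · have h1 : ∑ i, (P i i).re = P.trace.re := by
      simp [Matrix.trace]
    rw [h1, hP, Matrix.trace_mul_comm, ← mul_assoc, hVV, one_mul, trace_diagonal,
      ← Complex.ofReal_sum, Complex.ofReal_re, hσ.rank_eq_card_non_zero_eigs,
      Fintype.card_subtype, card_eq_sum_ones, sum_filter]
    simp [hf]
  · have h1 := re_trace_mul_le_traceNorm (hσ.sub hα).neg hU
    rw [traceNorm_neg, neg_sub] at h1
    have h2 : ((1 - (2 : ℂ) • P) * (diagonal (fun i => (α i : ℂ)) - σ)).trace.re =
        ∑ i, α i + σ.trace.re - 2 * ∑ i, (P i i).re * α i := by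
      have h3 : (1 - (2 : ℂ) • P) * (diagonal (fun i => (α i : ℂ)) - σ) =
          diagonal (fun i => (α i : ℂ)) - (2 : ℂ) • (P * diagonal (fun i => (α i : ℂ))) + σ := by
        rw [mul_sub, sub_mul, sub_mul, one_mul, one_mul, smul_mul_assoc, smul_mul_assoc, hPσ,
          two_smul ℂ σ]
        abel
      rw [h3, trace_add, trace_sub, trace_smul, trace_diagonal]
      simp only [Matrix.trace, diag_apply, mul_diagonal, Complex.add_re, Complex.sub_re,
        Complex.re_sum, Complex.ofReal_re, smul_eq_mul]
      rw [show (2 : ℂ) = ((2 : ℝ) : ℂ) by simp, Complex.re_ofReal_mul, Complex.re_sum]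
      simp only [Complex.re_mul_ofReal]
      ring
    rw [h2] at h1
    simp only [sub_mul, one_mul, sum_sub_distrib]
    linarith

omit [DecidableEq ι] in
theorem exists_card_eq_of_key (key : ι → ℕ) {r : ℕ} (hr : r ≤ Fintype.card ι) :
    ∃ S : Finset ι, #S = r ∧ ∀ i ∈ S, ∀ j ∉ S, key i ≤ key j := by
  classical
  induction r with
  | zero => exact ⟨∅, by simp, by simp⟩
  | succ r ih =>
    obtain ⟨S, hS, hmin⟩ := ih (by omega)
    have hne : Sᶜ.Nonempty := by
      rw [← card_pos, card_compl]
      omega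
    obtain ⟨j, hj, hjmin⟩ := exists_min_image Sᶜ key hne
    rw [mem_compl] at hj
    refine ⟨insert j S, by rw [card_insert_of_notMem hj, hS], fun i hi k hk => ?_⟩
    rw [mem_insert, not_or] at hk
    rcases mem_insert.1 hi with rfl | hi
    · exact hjmin k (mem_compl.2 hk.2)
    · exact hmin i hi k hk.2

/-- The bathtub principle: among fractional choices of total mass #S, the set of the #S largest
values captures the most weight. The mass that d puts outside S equals the mass missing inside. -/
theorem sum_compl_le_sum_one_sub_mul {key : ι → ℕ} {α : ι → ℝ}
    (hα : ∀ i j, key i ≤ key j → α j ≤ α i) {S : Finset ι}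
    (hS : ∀ i ∈ S, ∀ j ∉ S, key i ≤ key j) {d : ι → ℝ} (hd : ∀ i, 0 ≤ d i ∧ d i ≤ 1)
    (hsum : ∑ i, d i = #S) :
    ∑ i ∈ Sᶜ, α i ≤ ∑ i, (1 - d i) * α i := by
  have key1 : ∑ j ∈ Sᶜ, d j * α j ≤ ∑ i ∈ S, (1 - d i) * α i := by
    rcases Sᶜ.eq_empty_or_nonempty with h | h
    · rw [h, sum_empty]
      have hSu : S = univ := by rwa [compl_eq_empty_iff] at h
      subst hSu
      have hz : ∀ i ∈ (univ : Finset ι), 1 - d i = 0 := by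
        refine (sum_eq_zero_iff_of_nonneg fun i _ => by linarith [(hd i).2]).1 ?_
        rw [sum_sub_distrib, hsum]
        simp
      exact le_of_eq (sum_eq_zero fun i hi => by rw [hz i hi, zero_mul]).symm
    · obtain ⟨j0, hj0, hmax⟩ := exists_max_image Sᶜ α h
      rw [mem_compl] at hj0
      have e : ∑ j ∈ Sᶜ, d j = ∑ i ∈ S, (1 - d i) := by
        rw [sum_sub_distrib, sum_const, nsmul_eq_mul, mul_one, ← hsum, ← sum_add_sum_compl S d]
        ring
      calc _ ≤ ∑ j ∈ Sᶜ, d j * α j0 :=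
            sum_le_sum fun j hj => mul_le_mul_of_nonneg_left (hmax j hj) (hd j).1
        _ = ∑ i ∈ S, (1 - d i) * α j0 := by rw [← sum_mul, e, sum_mul]
        _ ≤ _ := sum_le_sum fun i hi => mul_le_mul_of_nonneg_left (hα _ _ (hS i hi j0 hj0))
            (by linarith [(hd i).2])
  rw [← sum_add_sum_compl S fun i => (1 - d i) * α i]
  have e2 : ∑ i ∈ Sᶜ, (1 - d i) * α i = ∑ i ∈ Sᶜ, α i - ∑ i ∈ Sᶜ, d i * α i := by
    rw [← sum_sub_distrib]
    exact sum_congr rfl fun i _ => by ring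
  linarith

/-- Orders Eve's basis vectors by decreasing eigenvalue of `ρ_E`, then by the number of errors. -/
def eveKey {n : ℕ} (i : EveIdx n) : ℕ :=
  ∑ p, ((n + 1) * (if i p = 0 then 0 else 1) + if i p = 2 ∨ i p = 3 then 1 else 0)

/-- The error count is at most n and cannot outweigh a factor n + 1, so the key compares first the
number of nonzero labels, which alone determines the eigenvalue. The error count only breaks ties.
-/
theorem prod_bellWeight_le_of_eveKey_le {e : ℝ} (he0 : 0 < e) (he : e < 1 / 2) {n : ℕ}
    {i j : EveIdx n} (h : eveKey i ≤ eveKey j) :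
    ∏ p, bellWeight e (j p) ≤ ∏ p, bellWeight e (i p) := by
  have hkey : ∀ i : EveIdx n, eveKey i = (n + 1) * #{p | i p ≠ 0} + #{p | i p = 2 ∨ i p = 3} := by
    intro i
    rw [eveKey, sum_add_distrib, ← mul_sum, card_filter, card_filter]
    simp only [ne_eq, ite_not]
  have hle : #{p | i p ≠ 0} ≤ #{p | j p ≠ 0} := by
    rw [hkey, hkey] at h
    have h2 : #{p | j p = 2 ∨ j p = 3} ≤ n := (card_le_univ _).trans_eq (Fintype.card_fin n)
    by_contra hcon
    have h3 : #{p | j p ≠ 0} + 1 ≤ #{p | i p ≠ 0} := by omega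
    have h4 := Nat.mul_le_mul_left (n + 1) h3
    rw [mul_add] at h4
    omega
  have hprod : ∀ i : EveIdx n, ∏ p, bellWeight e (i p) =
      ((2 - 3 * e) / 2) ^ (n - #{p | i p ≠ 0}) * (e / 2) ^ #{p | i p ≠ 0} := by
    intro i
    simp only [bellWeight, prod_ite, prod_const]
    congr 2
    have := card_filter_add_card_filter_not (s := (univ : Finset (Fin n))) (fun p => i p = 0)
    simp only [card_univ, Fintype.card_fin] at this
    simp only [ne_eq]
    omega
  rw [hprod, hprod]
  have hn : #{p | j p ≠ 0} ≤ n := (card_le_univ _).trans_eq (Fintype.card_fin n)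
  set a := #{p | i p ≠ 0}
  set b := #{p | j p ≠ 0}
  have e1 : n - a = (n - b) + (b - a) := by omega
  have e2 : b = a + (b - a) := by omega
  have hab : (e / 2) ^ (b - a) ≤ ((2 - 3 * e) / 2) ^ (b - a) :=
    pow_le_pow_left₀ (by linarith) (by linarith) _
  have hc : 0 ≤ ((2 - 3 * e) / 2) ^ (n - b) * (e / 2) ^ a :=
    mul_nonneg (pow_nonneg (by linarith) _) (pow_nonneg (by linarith) _)
  calc _ = ((2 - 3 * e) / 2) ^ (n - b) * (e / 2) ^ a * (e / 2) ^ (b - a) := by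
        conv_lhs => rw [e2, pow_add]
        rw [← e2]
        ring
    _ ≤ ((2 - 3 * e) / 2) ^ (n - b) * (e / 2) ^ a * ((2 - 3 * e) / 2) ^ (b - a) :=
        mul_le_mul_of_nonneg_left hab hc
    _ = _ := by
        rw [e1, pow_add]
        ring

theorem rhoE_isState {e : ℝ} (he0 : 0 ≤ e) (he : e ≤ 2 / 3) (n : ℕ) : IsState (rhoE e n) := by
  refine ⟨posSemidef_sum _ fun x _ => posSemidef_sum _ fun y _ => rhoXYE_posSemidef e x y, ?_⟩
  rw [rhoE_eq he0 he, trace_diagonal, ← Complex.ofReal_sum, sum_prod_bellWeight, Complex.ofReal_one]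

/-- A minimizer of the smooth entropy of order zero may be taken diagonal: the complement `Dᶜ` of
an upper set `D` of small weight has the rank of a minimizer. -/
theorem exists_upper_set_smoothRenyiZero {e : ℝ} (he0 : 0 < e) (he : e < 1 / 2) (n : ℕ) {ε : ℝ}
    (hε : 0 ≤ ε) :
    ∃ D : Finset (EveIdx n), 0 < #Dᶜ ∧
      smoothRenyiZero ε (rhoE e n + deltaBar ε n) = Real.logb 2 #Dᶜ ∧
      ∑ i ∈ D, ∏ p, bellWeight e (i p) ≤ 3 * ε / 4 ∧
      ∀ i j, eveKey i < eveKey j → i ∈ D → j ∈ D := by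
  have hcard : (Fintype.card (EveIdx n) : ℝ) = 2 ^ (2 * n) := by
    simp only [Fintype.card_fun, Fintype.card_fin]
    rw [pow_mul]
    norm_num
  have hδ : (deltaBar ε n).PosSemidef := by
    rw [deltaBar]
    exact PosSemidef.one.smul (by
      rw [Complex.zero_le_real]
      positivity)
  have hδtr : (deltaBar ε n).trace.re = ε / 2 := by
    rw [deltaBar, trace_smul, trace_one, smul_eq_mul, ← Complex.ofReal_natCast,
      ← Complex.ofReal_mul, Complex.ofReal_re, hcard, pow_succ]
    field_simp
  have hne : (renyiZero '' ball (ε / 2) (rhoE e n + deltaBar ε n)).Nonempty := by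
    refine ⟨_, rhoE e n, ⟨rhoE_isState he0.le (by linarith) n, ?_⟩, rfl⟩
    rw [sub_add_cancel_left, traceNorm_neg, traceNorm_posSemidef hδ, hδtr]
    linarith
  -- Ranks take finitely many values, so the infimum is attained; the ball is nonempty because it
  -- contains ρ_E.
  have hfin : (renyiZero '' ball (ε / 2) (rhoE e n + deltaBar ε n)).Finite := by
    refine (((range (Fintype.card (EveIdx n) + 1)).finite_toSet).image
      fun k : ℕ => Real.logb 2 (k : ℝ)).subset ?_
    rintro _ ⟨σ, -, rfl⟩
    exact ⟨σ.rank, by simpa [Nat.lt_succ_iff] using σ.rank_le_card_width, rfl⟩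
  obtain ⟨σ, ⟨⟨hσ, hσtr⟩, hdist⟩, hmin⟩ := hne.csInf_mem hfin
  obtain ⟨d, hd, hdsum, hdle⟩ := exists_diag_of_rank hσ.isHermitian
    (fun i => ∏ p, bellWeight e (i p) + ε / 2 ^ (2 * n + 1))
  have hA : rhoE e n + deltaBar ε n =
      diagonal fun i => ((∏ p, bellWeight e (i p) + ε / 2 ^ (2 * n + 1) : ℝ) : ℂ) := by
    rw [rhoE_eq he0.le (by linarith), deltaBar, ← diagonal_one, ← diagonal_smul, diagonal_add]
    congr 1
    ext i
    simp
  rw [← hA] at hdle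
  obtain ⟨S, hScard, hS⟩ := exists_card_eq_of_key (eveKey (n := n)) (r := σ.rank)
    σ.rank_le_card_width
  have hrank : 0 < σ.rank := by
    rw [Nat.pos_iff_ne_zero]
    intro h0
    rw [hσ.isHermitian.rank_eq_card_non_zero_eigs, Fintype.card_eq_zero_iff] at h0
    have h1 : ∀ i, hσ.isHermitian.eigenvalues i = 0 := fun i => by
      by_contra h
      exact h0.false ⟨i, h⟩
    rw [hσ.isHermitian.trace_eq_sum_eigenvalues] at hσtr
    simp [h1] at hσtr
  refine ⟨Sᶜ, by rw [compl_compl, hScard]; exact hrank, ?_, ?_, ?_⟩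
  · rw [compl_compl, hScard]
    exact hmin.symm
  · refine (sum_compl_le_sum_one_sub_mul (key := eveKey)
      (fun i j h => prod_bellWeight_le_of_eveKey_le he0 he h) hS hd
      (by rw [hdsum, hScard])).trans ?_
    -- The bound is (ε + (1 + ε/2) - 1)/2 = 3ε/4, where 1 + ε/2 is the trace of the unnormalized
    -- centre.
    have h1 : ∑ i : EveIdx n, (1 - d i) * ∏ p, bellWeight e (i p) ≤
        ∑ i : EveIdx n, (1 - d i) * (∏ p, bellWeight e (i p) + ε / 2 ^ (2 * n + 1)) := by
      refine sum_le_sum fun i _ => mul_le_mul_of_nonneg_left ?_ (by linarith [(hd i).2])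
      have : 0 ≤ ε / 2 ^ (2 * n + 1) := by positivity
      linarith
    have h2 : ∑ i : EveIdx n, (∏ p, bellWeight e (i p) + ε / 2 ^ (2 * n + 1)) = 1 + ε / 2 := by
      rw [sum_add_distrib, sum_prod_bellWeight, sum_const, card_univ, nsmul_eq_mul, hcard, pow_succ]
      field_simp
    rw [h2, hσtr, Complex.one_re] at hdle
    linarith
  · intro i j hij hi
    rw [mem_compl] at hi ⊢
    exact fun hj => absurd (hS j hj i hi) (by omega)

end SmoothZero

/-! ### Negative correlation between the two smoothings -/

section Correlation

/-- Exchanging the new value with the old coordinate is an involution: resampling one coordinate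
preserves the uniform measure. -/
theorem sum_sum_update {κ α : Type*} [Fintype κ] [DecidableEq κ] [Fintype α] (p : κ)
    (f : (κ → α) → ℝ) :
    ∑ i, ∑ a, f (Function.update i p a) = Fintype.card α * ∑ i, f i := by
  have hinv : Function.Involutive
      fun q : (κ → α) × α => (Function.update q.1 p q.2, q.1 p) := by
    rintro ⟨i, a⟩
    simp
  have h := Equiv.sum_comp hinv.toPerm fun q : (κ → α) × α => f q.1
  simp only [Function.Involutive.coe_toPerm, Fintype.sum_prod_type] at h
  rw [h]
  simp [mul_sum]

/-- The conditional distribution of Eve's basis outcome on one signal, given whether an error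
occurred. -/
def condProb (e : ℝ) (err : Prop) [Decidable err] (a : Fin 4) : ℝ :=
  if err then (if a = 2 ∨ a = 3 then 1 / 2 else 0)
  else if a = 0 ∨ a = 1 then bellWeight e a / (1 - e) else 0

theorem eveAmp_sq {e : ℝ} (he0 : 0 ≤ e) (he : e ≤ 2 / 3) (a b : Bool) (i : Fin 4) :
    eveAmp e a b i ^ 2 = pairProb e a b * condProb e (a ≠ b) i := by
  have h1 : (1 : ℝ) - e ≠ 0 := by linarith
  rw [sq, eveAmp_mul he0 he]
  fin_cases i <;> cases a <;> cases b <;>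
    simp [bellSign, pairProb, condProb, bellWeight] <;> field_simp

/-- The weight on `D` of Eve's conditional distribution given the error pattern `s`. -/
def condWeight (e : ℝ) {n : ℕ} (D : Finset (EveIdx n)) (s : Finset (Fin n)) : ℝ :=
  ∑ i ∈ D, ∏ p, condProb e (p ∈ s) (i p)

theorem norm_eveVec_sq {e : ℝ} (he0 : 0 ≤ e) (he : e ≤ 2 / 3) {n : ℕ} (x y : BitString n)
    (i : EveIdx n) :
    ‖eveVec e x y i‖ ^ 2 = outcomeProb e x y * ∏ p, condProb e (p ∈ errSet x y) (i p) := by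
  rw [eveVec_eq, Complex.norm_real, Real.norm_eq_abs, sq_abs, ← prod_pow, outcomeProb,
    ← prod_mul_distrib]
  refine prod_congr rfl fun p _ => ?_
  rw [eveAmp_sq he0 he]
  simp [errSet]

theorem eveKey_update_lt {n : ℕ} (i : EveIdx n) (p : Fin n) {a b : Fin 4} (ha : a = 0 ∨ a = 1)
    (hb : b = 2 ∨ b = 3) : eveKey (Function.update i p a) < eveKey (Function.update i p b) := by
  unfold eveKey
  refine sum_lt_sum (fun q _ => ?_) ⟨p, mem_univ p, ?_⟩
  · by_cases hq : q = p
    · subst hq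
      simp only [Function.update_self]
      rcases ha with rfl | rfl <;> rcases hb with rfl | rfl <;> simp
    · simp only [Function.update_of_ne hq, le_refl]
  · simp only [Function.update_self]
    rcases ha with rfl | rfl <;> rcases hb with rfl | rfl <;> simp

/-- An additional error moves the label at p from {0, 1} to {2, 3}, which strictly increases
`eveKey` whatever the two labels are, so membership in the upper set D persists. Between 1 and 2
this relies on the tie-breaking by errors. -/
theorem condWeight_le_insert {e : ℝ} (he0 : 0 < e) (he : e < 1 / 2) {n : ℕ}
    {D : Finset (EveIdx n)} (hD : ∀ i j, eveKey i < eveKey j → i ∈ D → j ∈ D)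
    {s : Finset (Fin n)} {p : Fin n} (hp : p ∉ s) :
    condWeight e D s ≤ condWeight e D (insert p s) := by
  classical
  have hform : ∀ s' : Finset (Fin n), (Fintype.card (Fin 4) : ℝ) * condWeight e D s' =
      ∑ i : EveIdx n, (∏ q ∈ univ.erase p, condProb e (q ∈ s') (i q)) *
        ∑ a, condProb e (p ∈ s') a * if Function.update i p a ∈ D then 1 else 0 := by
    intro s'
    have h1 : condWeight e D s' =
        ∑ i : EveIdx n, (∏ q, condProb e (q ∈ s') (i q)) * if i ∈ D then 1 else 0 := by
      simp [condWeight]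
    rw [h1, ← sum_sum_update p]
    refine sum_congr rfl fun i _ => ?_
    rw [mul_sum]
    refine sum_congr rfl fun a _ => ?_
    rw [← mul_assoc, ← prod_erase_mul _ _ (mem_univ p), Function.update_self]
    congr 2
    refine prod_congr rfl fun q hq => ?_
    rw [Function.update_of_ne (ne_of_mem_erase hq)]
  have hpos : (0 : ℝ) < Fintype.card (Fin 4) := by simp
  refine le_of_mul_le_mul_left ?_ hpos
  rw [hform, hform]
  refine sum_le_sum fun i _ => ?_
  have hcp : ∀ (err : Prop) [Decidable err] a, 0 ≤ condProb e err a := by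
    intro err _ a
    unfold condProb
    have : 0 ≤ bellWeight e a / (1 - e) :=
      div_nonneg (bellWeight_nonneg he0.le (by linarith) a) (by linarith)
    split_ifs <;> first | exact this | norm_num
  have hR : ∏ q ∈ univ.erase p, condProb e (q ∈ insert p s) (i q) =
      ∏ q ∈ univ.erase p, condProb e (q ∈ s) (i q) := by
    refine prod_congr rfl fun q hq => ?_
    have : q ∈ insert p s ↔ q ∈ s := by simp [ne_of_mem_erase hq]
    simp only [condProb, this]
  rw [hR]
  refine mul_le_mul_of_nonneg_left ?_ (prod_nonneg fun q _ => hcp _ _)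
  set δ : Fin 4 → ℝ := fun a => if Function.update i p a ∈ D then 1 else 0 with hδ
  have hmono : ∀ a b : Fin 4, (a = 0 ∨ a = 1) → (b = 2 ∨ b = 3) → δ a ≤ δ b := by
    intro a b ha hb
    simp only [hδ]
    by_cases h : Function.update i p a ∈ D
    · rw [if_pos h, if_pos (hD _ _ (eveKey_update_lt i p ha hb) h)]
    · rw [if_neg h]
      split_ifs <;> norm_num
  have h02 := hmono 0 2 (by simp) (by simp)
  have h03 := hmono 0 3 (by simp) (by simp)
  have h12 := hmono 1 2 (by simp) (by simp)
  have h13 := hmono 1 3 (by simp) (by simp)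
  have he1 : 0 < 1 - e := by linarith
  have hl : ∑ a, condProb e (p ∈ s) a * δ a =
      (2 - 3 * e) / 2 / (1 - e) * δ 0 + e / 2 / (1 - e) * δ 1 := by
    rw [Fin.sum_univ_four]
    simp [condProb, hp, bellWeight]
  have hr : ∑ a, condProb e (p ∈ insert p s) a * δ a = (δ 2 + δ 3) / 2 := by
    rw [Fin.sum_univ_four]
    simp [condProb]
    ring
  change ∑ a, condProb e (p ∈ s) a * δ a ≤ ∑ a, condProb e (p ∈ insert p s) a * δ a
  rw [hl, hr]
  have hw : (2 - 3 * e) / 2 / (1 - e) + e / 2 / (1 - e) = 1 := by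
    field_simp
    ring
  have hw0 : 0 ≤ (2 - 3 * e) / 2 / (1 - e) := div_nonneg (by linarith) he1.le
  have hw1 : 0 ≤ e / 2 / (1 - e) := div_nonneg (by linarith) he1.le
  calc _ ≤ (2 - 3 * e) / 2 / (1 - e) * ((δ 2 + δ 3) / 2) + e / 2 / (1 - e) * ((δ 2 + δ 3) / 2) :=
        add_le_add (mul_le_mul_of_nonneg_left (by linarith) hw0)
          (mul_le_mul_of_nonneg_left (by linarith) hw1)
    _ = _ := by rw [← add_mul, hw, one_mul]

/-- Double counting of pairs (s, p) with p outside s, matched with pairs (s ∪ {p}, p): the mean of f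
over the k-sets increases with k. -/
theorem sum_powersetCard_le {n : ℕ} {f : Finset (Fin n) → ℝ}
    (hf : ∀ s p, p ∉ s → f s ≤ f (insert p s)) {k : ℕ} (hk : k ≤ n) :
    ((n : ℝ) - k) * ∑ s ∈ powersetCard k univ, f s ≤
      ((k : ℝ) + 1) * ∑ s ∈ powersetCard (k + 1) univ, f s := by
  calc _ = ∑ s ∈ powersetCard k univ, ∑ _p ∈ sᶜ, f s := by
        rw [mul_sum]
        refine sum_congr rfl fun s hs => ?_
        rw [mem_powersetCard] at hs
        rw [sum_const, card_compl, hs.2, Fintype.card_fin, nsmul_eq_mul, Nat.cast_sub hk]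
    _ ≤ ∑ s ∈ powersetCard k univ, ∑ p ∈ sᶜ, f (insert p s) :=
        sum_le_sum fun s _ => sum_le_sum fun p hp => hf s p (mem_compl.1 hp)
    _ = ∑ s ∈ powersetCard (k + 1) univ, ∑ _p ∈ s, f s := by
        rw [sum_sigma', sum_sigma']
        refine sum_bij' (fun q _ => ⟨insert q.2 q.1, q.2⟩) (fun q _ => ⟨q.1.erase q.2, q.2⟩)
          ?_ ?_ ?_ ?_ ?_
        · rintro ⟨s, p⟩ h
          simp only [mem_sigma, mem_powersetCard, subset_univ, true_and, mem_compl] at h ⊢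
          exact ⟨by rw [card_insert_of_notMem h.2, h.1], mem_insert_self _ _⟩
        · rintro ⟨s, p⟩ h
          simp only [mem_sigma, mem_powersetCard, subset_univ, true_and, mem_compl] at h ⊢
          exact ⟨by rw [card_erase_of_mem h.2, h.1]; rfl, notMem_erase _ _⟩
        · rintro ⟨s, p⟩ h
          simp only [mem_sigma, mem_compl] at h
          simp [erase_insert h.2]
        · rintro ⟨s, p⟩ h
          simp only [mem_sigma] at h
          simp [insert_erase h.2]
        · intros
          rfl
    _ = _ := by
        rw [mul_sum]
        refine sum_congr rfl fun s hs => ?_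
        rw [mem_powersetCard] at hs
        rw [sum_const, hs.2, nsmul_eq_mul]
        push_cast
        ring

/-- Chebyshev's sum inequality, from summing the products of differences over all pairs. -/
theorem sum_mul_sum_le_of_antivary {s : Finset ℕ} {w f g : ℕ → ℝ} (hw : ∀ i ∈ s, 0 ≤ w i)
    (hfg : ∀ i ∈ s, ∀ j ∈ s, (f i - f j) * (g i - g j) ≤ 0) :
    (∑ i ∈ s, w i * (f i * g i)) * ∑ i ∈ s, w i ≤
      (∑ i ∈ s, w i * f i) * ∑ i ∈ s, w i * g i := by
  have h : ∑ i ∈ s, ∑ j ∈ s, w i * w j * ((f i - f j) * (g i - g j)) ≤ 0 :=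
    sum_nonpos fun i hi => sum_nonpos fun j hj =>
      mul_nonpos_of_nonneg_of_nonpos (mul_nonneg (hw i hi) (hw j hj)) (hfg i hi j hj)
  have e : ∑ i ∈ s, ∑ j ∈ s, w i * w j * ((f i - f j) * (g i - g j)) =
      2 * ((∑ i ∈ s, w i * (f i * g i)) * ∑ i ∈ s, w i) -
        2 * ((∑ i ∈ s, w i * f i) * ∑ i ∈ s, w i * g i) := by
    have e1 : (∑ i ∈ s, w i * (f i * g i)) * ∑ i ∈ s, w i =
        ∑ i ∈ s, ∑ j ∈ s, w i * w j * (f i * g i) := by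
      rw [sum_mul_sum]
      exact sum_congr rfl fun i _ => sum_congr rfl fun j _ => by ring
    have e2 : (∑ i ∈ s, w i * (f i * g i)) * ∑ i ∈ s, w i =
        ∑ i ∈ s, ∑ j ∈ s, w i * w j * (f j * g j) := by
      rw [mul_comm, sum_mul_sum]
      exact sum_congr rfl fun i _ => sum_congr rfl fun j _ => by ring
    have e3 : (∑ i ∈ s, w i * f i) * ∑ i ∈ s, w i * g i =
        ∑ i ∈ s, ∑ j ∈ s, w i * w j * (f i * g j) := by
      rw [sum_mul_sum]
      exact sum_congr rfl fun i _ => sum_congr rfl fun j _ => by ring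
    have e4 : (∑ i ∈ s, w i * f i) * ∑ i ∈ s, w i * g i =
        ∑ i ∈ s, ∑ j ∈ s, w i * w j * (f j * g i) := by
      rw [mul_comm, sum_mul_sum]
      exact sum_congr rfl fun i _ => sum_congr rfl fun j _ => by ring
    rw [two_mul, two_mul]
    nth_rewrite 1 [e1]
    rw [e2]
    nth_rewrite 1 [e3]
    rw [e4]
    simp only [← sum_add_distrib, ← sum_sub_distrib]
    exact sum_congr rfl fun i _ => sum_congr rfl fun j _ => by ring
  linarith

theorem sum_sq_mul_sum_le {n : ℕ} {f : Finset (Fin n) → ℝ}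
    (hf : ∀ s p, p ∉ s → f s ≤ f (insert p s)) {μ : ℕ → ℝ} (hμ0 : ∀ k ≤ n, 0 ≤ μ k)
    (hμ : ∀ k < n, μ (k + 1) ≤ μ k) :
    (∑ s, μ #s ^ 2 * f s) * ∑ s : Finset (Fin n), μ #s ≤
      (∑ s : Finset (Fin n), μ #s ^ 2) * ∑ s, μ #s * f s := by
  set A : ℕ → ℝ := fun k => ∑ s ∈ powersetCard k univ, f s with hA
  set t : ℕ → ℝ := fun k => A k / n.choose k with ht
  have hC : ∀ k ≤ n, (0 : ℝ) < n.choose k := fun k hk => by exact_mod_cast Nat.choose_pos hk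
  have hlevels : ∀ g : ℕ → ℝ, ∑ s : Finset (Fin n), g #s * f s =
      ∑ k ∈ range (n + 1), (n.choose k : ℝ) * (g k * t k) := by
    intro g
    have h1 := sum_powerset (univ : Finset (Fin n)) (fun s => g #s * f s)
    rw [powerset_univ, card_univ, Fintype.card_fin] at h1
    rw [h1]
    refine sum_congr rfl fun k hk => ?_
    have hk' := hC k (by rw [mem_range] at hk; omega)
    have h2 : (n.choose k : ℝ) * (g k * t k) = g k * A k := by
      simp only [ht]
      field_simp
    rw [h2, hA, mul_sum]
    refine sum_congr rfl fun s hs => ?_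
    rw [(mem_powersetCard.1 hs).2]
  have htmono : ∀ k < n, t k ≤ t (k + 1) := by
    intro k hk
    have h1 := sum_powersetCard_le hf hk.le
    have h2 : (n.choose (k + 1) : ℝ) * ((k : ℝ) + 1) = n.choose k * ((n : ℝ) - k) := by
      rw [← Nat.cast_sub hk.le]
      exact_mod_cast Nat.choose_succ_right_eq n k
    have hk1 := hC k hk.le
    have hk2 := hC (k + 1) hk
    have hk3 : (0 : ℝ) < (k : ℝ) + 1 := by positivity
    simp only [ht]
    rw [div_le_div_iff₀ hk1 hk2]
    refine le_of_mul_le_mul_right ?_ hk3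
    calc _ = A k * ((n.choose (k + 1) : ℝ) * ((k : ℝ) + 1)) := by ring
      _ = n.choose k * (((n : ℝ) - k) * A k) := by rw [h2]; ring
      _ ≤ n.choose k * (((k : ℝ) + 1) * A (k + 1)) := mul_le_mul_of_nonneg_left h1 hk1.le
      _ = _ := by ring
  have hle : ∀ i j, i ≤ j → j ≤ n → μ j ≤ μ i ∧ t i ≤ t j := by
    intro i j hij
    induction j, hij using Nat.le_induction with
    | base => exact fun _ => ⟨le_rfl, le_rfl⟩
    | succ j _ ih =>
      intro hj
      have := ih (by omega)
      exact ⟨(hμ j (by omega)).trans this.1, this.2.trans (htmono j (by omega))⟩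
  -- Under the weight C(n,k) μ_k, the decreasing μ and the increasing level means t are oppositely
  -- ordered.
  have hcheb := sum_mul_sum_le_of_antivary (s := range (n + 1))
    (w := fun k => (n.choose k : ℝ) * μ k) (f := μ) (g := t)
    (fun k hk => mul_nonneg (Nat.cast_nonneg _) (hμ0 k (by rw [mem_range] at hk; omega)))
    (fun i hi j hj => by
      rw [mem_range] at hi hj
      rcases le_total i j with hij | hij
      · have := hle i j hij (by omega)
        exact mul_nonpos_of_nonneg_of_nonpos (by linarith) (by linarith)
      · have := hle j i hij (by omega)
        exact mul_nonpos_of_nonpos_of_nonneg (by linarith) (by linarith))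
  rw [hlevels (fun k => μ k ^ 2), hlevels μ, sum_finset_card μ, sum_finset_card fun k => μ k ^ 2]
  convert hcheb using 2 <;> exact sum_congr rfl fun k _ => by ring

end Correlation

/-! ### Secrecy of Alice's key when the rate is taken at the true QBER -/

section Secrecy

/-- The unnormalized state of Eve given Alice's string `x`. -/
def rhoXE (e : ℝ) {n : ℕ} (x : BitString n) : Matrix (EveIdx n) (EveIdx n) ℂ :=
  ∑ y, rhoXYE e x y

/-- Twice the trace distance of Alice's key from a uniform key that is independent of the
transcript, the hash function and Eve's system. -/
def secrecy (e : ℝ) {n ℓ : ℕ} (P : ECProtocol n) (H : HashFamily n ℓ) : ℝ :=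
  ∑ f, ∑ c, ∑ k, H.prob f *
    traceNorm (∑ x, ((keyBias (H.hash f) k x * P.prob x c : ℝ) : ℂ) • rhoXE e x)

theorem ECProtocol.card_mul_prob_le {n : ℕ} (P : ECProtocol n) (x : BitString n) (c : P.C) :
    Fintype.card P.C * P.prob x c ≤ 2 ^ P.leak := by
  have hC : Nonempty P.C := ⟨c⟩
  have hcard : (0 : ℝ) < Fintype.card P.C := by exact_mod_cast Fintype.card_pos
  have hbdd : ∀ x, BddAbove (Set.range fun c => P.prob x c) := fun x =>
    (Set.finite_range _).bddAbove
  have hsup : 0 < ⨆ c, P.prob x c := by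
    by_contra h
    have h0 : ∀ c, P.prob x c = 0 := fun c =>
      le_antisymm ((le_ciSup (hbdd x) c).trans (not_lt.1 h)) (P.prob_nonneg x c)
    have := P.prob_sum x
    simp [h0] at this
  have hinf : ⨅ x, -Real.logb 2 (⨆ c, P.prob x c) ≤ -Real.logb 2 (⨆ c, P.prob x c) :=
    ciInf_le (Set.finite_range _).bddBelow x
  have hle : Real.logb 2 (Fintype.card P.C * ⨆ c, P.prob x c) ≤ P.leak := by
    rw [Real.logb_mul hcard.ne' hsup.ne', ECProtocol.leak]
    linarith
  rw [Real.logb_le_iff_le_rpow (by norm_num) (mul_pos hcard hsup)] at hle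
  exact (mul_le_mul_of_nonneg_left (le_ciSup (hbdd x) c) hcard.le).trans hle

variable {e : ℝ} {n : ℕ}

theorem cornerWeight_mul_le (D : Finset (EveIdx n)) (i j : EveIdx n) :
    cornerWeight D i * cornerWeight D j ≤
      1 + 3 / 2 * ((if i ∈ D then 1 else 0) + if j ∈ D then 1 else 0) := by
  unfold cornerWeight
  split_ifs <;> norm_num

/-- Rows and columns in D contribute equally by Hermitian symmetry. The constant 3 comes from the
weight 4 of the D × D entries. -/
theorem weightedForm_cornerWeight_le (D : Finset (EveIdx n)) {A : Matrix (EveIdx n) (EveIdx n) ℂ}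
    (hA : A.IsHermitian) :
    weightedForm (cornerWeight D) A A ≤
      ∑ i, ∑ j, ‖A i j‖ ^ 2 + 3 * ∑ i ∈ D, ∑ j, ‖A i j‖ ^ 2 := by
  have hsymm : ∀ i j, ‖A j i‖ ^ 2 = ‖A i j‖ ^ 2 := fun i j => by
    rw [← hA.apply i j, norm_star]
  have h1 : ∑ i, ∑ j, (if i ∈ D then 1 else 0) * ‖A i j‖ ^ 2 = ∑ i ∈ D, ∑ j, ‖A i j‖ ^ 2 := by
    simp
  have h2 : ∑ i, ∑ j, (if j ∈ D then 1 else 0) * ‖A i j‖ ^ 2 = ∑ i ∈ D, ∑ j, ‖A i j‖ ^ 2 := by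
    rw [sum_comm, ← h1]
    exact sum_congr rfl fun i _ => sum_congr rfl fun j _ => by rw [hsymm i j]
  calc _ ≤ ∑ i, ∑ j, (1 + 3 / 2 * ((if i ∈ D then 1 else 0) + if j ∈ D then 1 else 0)) *
        ‖A i j‖ ^ 2 := by
        rw [weightedForm_self]
        exact sum_le_sum fun i _ => sum_le_sum fun j _ =>
          mul_le_mul_of_nonneg_right (cornerWeight_mul_le D i j) (sq_nonneg _)
    _ = ∑ i, ∑ j, ‖A i j‖ ^ 2 + 3 / 2 * (∑ i, ∑ j, (if i ∈ D then 1 else 0) * ‖A i j‖ ^ 2 +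
          ∑ i, ∑ j, (if j ∈ D then 1 else 0) * ‖A i j‖ ^ 2) := by
        simp only [mul_add, mul_sum, ← sum_add_distrib]
        exact sum_congr rfl fun i _ => sum_congr rfl fun j _ => by ring
    _ = _ := by rw [h1, h2]; ring

/-- The cross terms y ≠ y' vanish by the orthogonality of Eve's vectors. Summing rows over D
measures the share of the purity on D. -/
theorem row_sum_norm_sq_sum_rhoXYE (he0 : 0 ≤ e) (he : e ≤ 2 / 3) (x : BitString n)
    (t : BitString n → ℝ) (i : EveIdx n) :
    ∑ j, ‖(∑ y, (t y : ℂ) • rhoXYE e x y) i j‖ ^ 2 =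
      ∑ y, t y ^ 2 * outcomeProb e x y * ‖eveVec e x y i‖ ^ 2 := by
  have h : ((∑ j, ‖(∑ y, (t y : ℂ) • rhoXYE e x y) i j‖ ^ 2 : ℝ) : ℂ) =
      ((∑ y, t y ^ 2 * outcomeProb e x y * ‖eveVec e x y i‖ ^ 2 : ℝ) : ℂ) := by
    have hentry : ∀ j, (∑ y, (t y : ℂ) • rhoXYE e x y) i j =
        ∑ y, (t y : ℂ) * (eveVec e x y i * star (eveVec e x y j)) := by
      intro j
      simp [Matrix.sum_apply, rhoXYE, vecMulVec_apply]
    simp only [hentry, Complex.ofReal_sum]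
    have hsq : ∀ z : ℂ, ((‖z‖ ^ 2 : ℝ) : ℂ) = z * star z := fun z => by
      rw [Complex.star_def, Complex.mul_conj, Complex.normSq_eq_norm_sq]
    calc _ = ∑ j, ∑ y, ∑ y', (t y : ℂ) * (t y' : ℂ) * (eveVec e x y i * star (eveVec e x y' i)) *
          (eveVec e x y' j * star (eveVec e x y j)) := by
          refine sum_congr rfl fun j _ => ?_
          rw [hsq, star_sum, sum_mul_sum]
          refine sum_congr rfl fun y _ => sum_congr rfl fun y' _ => ?_
          simp only [star_mul', Complex.star_def, Complex.conj_ofReal, Complex.conj_conj]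
          ring
      _ = ∑ y, ∑ y', (t y : ℂ) * (t y' : ℂ) * (eveVec e x y i * star (eveVec e x y' i)) *
          ∑ j, eveVec e x y' j * star (eveVec e x y j) := by
          rw [sum_comm]
          refine sum_congr rfl fun y _ => ?_
          rw [sum_comm]
          simp only [mul_sum]
      _ = _ := by
          refine sum_congr rfl fun y _ => ?_
          rw [sum_eq_single y]
          · rw [sum_eveVec_mul_star he0 he, if_pos rfl, ← hsq]
            push_cast
            ring
          · intro y' _ hne
            rw [sum_eveVec_mul_star he0 he, if_neg hne, mul_zero]
          · simp
  exact_mod_cast h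

theorem sum_sum_bitString (f : Finset (Fin n) → ℝ) :
    ∑ x : BitString n, ∑ y, f (errSet x y) = 2 ^ n * ∑ s, f s := by
  simp [sum_errSet]

theorem sum_prod_condProb (he : e < 1) (s : Finset (Fin n)) :
    ∑ i : EveIdx n, ∏ p, condProb e (p ∈ s) (i p) = 1 := by
  rw [sum_prod_pi (fun p a => condProb e (p ∈ s) a)]
  refine prod_eq_one fun p _ => ?_
  have : 1 - e ≠ 0 := by linarith
  rw [Fin.sum_univ_four]
  by_cases hp : p ∈ s
  · simp [condProb, hp]
    norm_num
  · simp [condProb, hp, bellWeight]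
    field_simp
    ring

theorem condWeight_nonneg (he0 : 0 ≤ e) (he : e ≤ 2 / 3) (D : Finset (EveIdx n))
    (s : Finset (Fin n)) : 0 ≤ condWeight e D s := by
  refine sum_nonneg fun i _ => prod_nonneg fun p _ => ?_
  unfold condProb
  have : 0 ≤ bellWeight e (i p) / (1 - e) := div_nonneg (bellWeight_nonneg he0 he _) (by linarith)
  split_ifs <;> first | exact this | norm_num

theorem sum_errWeight_mul_condWeight (he0 : 0 ≤ e) (he : e ≤ 2 / 3) (D : Finset (EveIdx n)) :
    ∑ s, errWeight e n #s * condWeight e D s = ∑ i ∈ D, ∏ p, bellWeight e (i p) := by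
  have h1 : ∀ i : EveIdx n, ∏ p, bellWeight e (i p) = ∑ x : BitString n, ∑ y, ‖eveVec e x y i‖ ^ 2 := by
    intro i
    have h2 := congrFun (congrFun (rhoE_eq he0 he n) i) i
    rw [diagonal_apply_eq] at h2
    have h3 := congrArg Complex.re h2
    rw [Complex.ofReal_re] at h3
    rw [← h3]
    simp only [rhoE, Matrix.sum_apply, rhoXYE, vecMulVec_apply, Pi.star_apply, Complex.re_sum]
    refine sum_congr rfl fun x _ => sum_congr rfl fun y _ => ?_
    rw [Complex.star_def, Complex.mul_conj, Complex.ofReal_re, Complex.normSq_eq_norm_sq]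
  have h2 := sum_sum_bitString (n := n) fun s => errWeight e n #s / 2 ^ n * condWeight e D s
  have h3 : 2 ^ n * ∑ s : Finset (Fin n), errWeight e n #s / 2 ^ n * condWeight e D s =
      ∑ s : Finset (Fin n), errWeight e n #s * condWeight e D s := by
    rw [mul_sum]
    exact sum_congr rfl fun s _ => by field_simp
  rw [← h3, ← h2]
  simp only [h1]
  rw [sum_comm (s := D)]
  refine sum_congr rfl fun x _ => ?_
  rw [sum_comm (s := D)]
  refine sum_congr rfl fun y _ => ?_
  simp only [norm_eveVec_sq he0 he, ← mul_sum, outcomeProb_eq, condWeight]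

theorem two_rpow_neg_le {x : ℝ} (hx0 : 0 ≤ x) (hx1 : x ≤ 1) : (2 : ℝ) ^ (-x) ≤ 1 - x / 2 := by
  have h := rpow_one_add_le_one_add_mul_self (s := -(1 / 2)) (by norm_num) hx0 hx1
  rw [Real.rpow_neg (by norm_num), ← Real.inv_rpow (by norm_num)]
  convert h using 1 <;> norm_num
  ring

/-- Here x = ε̄: the factor 2^{-x} is the -ε̄ in the rate, a is the trace of τ on D, and 1 - x/4 is
the total trace of τ. The right side is a square because a square root follows. -/
theorem smoothing_loss_le {x a : ℝ} (hx0 : 0 ≤ x) (hx1 : x ≤ 1) (ha : a ≤ 3 * x / 8) :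
    (2 : ℝ) ^ (-x) * (1 + 3 * (a / (1 - x / 4))) ≤ (1 + 3 * x / 8) ^ 2 := by
  have h1 : 0 < 1 - x / 4 := by linarith
  have h2 : 1 + 3 * (a / (1 - x / 4)) ≤ (1 + 7 * x / 8) / (1 - x / 4) := by
    rw [le_div_iff₀ h1, add_mul, mul_assoc, div_mul_cancel₀ _ h1.ne']
    linarith
  have h3 : 0 ≤ (1 + 7 * x / 8) / (1 - x / 4) := div_nonneg (by linarith) h1.le
  calc _ ≤ (2 : ℝ) ^ (-x) * ((1 + 7 * x / 8) / (1 - x / 4)) :=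
        mul_le_mul_of_nonneg_left h2 (by positivity)
    _ ≤ (1 - x / 2) * ((1 + 7 * x / 8) / (1 - x / 4)) :=
        mul_le_mul_of_nonneg_right (two_rpow_neg_le hx0 hx1) h3
    _ ≤ _ := by
        rw [← mul_div_assoc, div_le_iff₀ h1]
        nlinarith [mul_nonneg hx0 hx0, mul_nonneg (mul_nonneg hx0 hx0) (sub_nonneg.2 hx1)]

theorem secrecy_le (he0 : 0 < e) (he : e < 1 / 2) (hn : 1 ≤ n) {ℓ : ℕ} (P : ECProtocol n)
    (H : HashFamily n ℓ) (hH : H.IsTwoUniversal) {εbar εPA : ℝ} (hbar0 : 0 ≤ εbar)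
    (hbar1 : εbar ≤ 1) (hPA0 : 0 < εPA) (hPA1 : εPA ≤ 1)
    (hrate : (ℓ : ℝ) ≤ modRenyiTwo (fun x : BitString n => eveBlock_isHermitian e x) (εbar / 2) -
      smoothRenyiZero (εbar / 2) (rhoE e n + deltaBar (εbar / 2) n) - εbar - P.leak +
        2 * Real.logb 2 (2 * εPA)) :
    secrecy e P H / 2 ≤ εPA + εbar := by
  obtain ⟨D, hDpos, hDent, hDsum, hDup⟩ :=
    exists_upper_set_smoothRenyiZero he0 he n (ε := εbar / 2) (by linarith)
  obtain ⟨μ, hμ, hμanti, hμsum, hμsq⟩ :=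
    exists_cut_eveBlock he0 he hn (ε := εbar / 2) (by linarith) (by linarith)
  have htau := sum_le_trace_tauOp_sq he0 he hn (εbar / 2) hμsq
  rw [← sum_finset_card (n := n) fun k => μ k ^ 2] at htau
  rw [← sum_finset_card (n := n) μ] at hμsum
  set Tr := (tauOp (fun x : BitString n => eveBlock_isHermitian e x) (εbar / 2) *
      tauOp (fun x : BitString n => eveBlock_isHermitian e x) (εbar / 2)).trace.re with hTr
  set M2 := ∑ s : Finset (Fin n), μ #s ^ 2 with hM2
  have hcard : ∀ s : Finset (Fin n), #s ≤ n := fun s => (card_le_univ _).trans_eq (Fintype.card_fin n)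
  have hew := errWeight_pos he0 he n
  have he23 : e ≤ 2 / 3 := by linarith
  -- Rescaling each rank-one term by `t` turns its eigenvalue into μ without moving the
  -- eigenvectors; t ≤ 1 makes the remainder δ positive.
  set t : ℕ → ℝ := fun k => μ k / errWeight e n k with ht
  have ht0 : ∀ k ≤ n, 0 ≤ t k := fun k hk => div_nonneg (hμ k hk).1 (hew k).le
  have ht1 : ∀ k ≤ n, t k ≤ 1 := fun k hk => (div_le_one (hew k)).2 (hμ k hk).2
  have htp : ∀ x y : BitString n, t #(errSet x y) * outcomeProb e x y = μ #(errSet x y) / 2 ^ n := by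
    intro x y
    rw [outcomeProb_eq, ht]
    have := (hew #(errSet x y)).ne'
    field_simp
  set τ : BitString n → Matrix (EveIdx n) (EveIdx n) ℂ :=
    fun x => ∑ y, (t #(errSet x y) : ℂ) • rhoXYE e x y with hτ
  set δ : BitString n → Matrix (EveIdx n) (EveIdx n) ℂ :=
    fun x => ∑ y, ((1 - t #(errSet x y) : ℝ) : ℂ) • rhoXYE e x y with hδ
  have hτpsd : ∀ x, (τ x).PosSemidef := fun x => posSemidef_sum _ fun y _ =>
    (rhoXYE_posSemidef e x y).smul (by rw [Complex.zero_le_real]; exact ht0 _ (hcard _))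
  have hδpsd : ∀ x, (δ x).PosSemidef := fun x => posSemidef_sum _ fun y _ =>
    (rhoXYE_posSemidef e x y).smul (by
      rw [Complex.zero_le_real]; linarith [ht1 _ (hcard (errSet x y))])
  have hsplit : ∀ x, rhoXE e x = τ x + δ x := by
    intro x
    simp only [rhoXE, hτ, hδ, ← sum_add_distrib, ← add_smul]
    refine sum_congr rfl fun y _ => ?_
    rw [← Complex.ofReal_add, add_sub_cancel, Complex.ofReal_one, one_smul]
  have hδtr : ∑ x, (δ x).trace.re = εbar / 4 := by
    have h1 : ∀ x, (δ x).trace.re = ∑ y, (errWeight e n #(errSet x y) - μ #(errSet x y)) / 2 ^ n := by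
      intro x
      simp only [hδ, trace_sum, trace_smul, trace_rhoXYE he0.le he23, Complex.re_sum, smul_eq_mul,
        ← Complex.ofReal_mul, Complex.ofReal_re, sub_mul, one_mul, htp, sub_div]
      simp only [outcomeProb_eq]
    simp only [h1]
    rw [sum_sum_bitString fun s => (errWeight e n #s - μ #s) / 2 ^ n, ← sum_div, sum_sub_distrib,
      hμsum, sum_finset_card fun k => errWeight e n k, sum_choose_mul_errWeight]
    field_simp
    ring
  set a := ∑ s : Finset (Fin n), μ #s * condWeight e D s with ha
  have ha38 : a ≤ 3 * εbar / 8 := by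
    calc a ≤ ∑ s, errWeight e n #s * condWeight e D s := sum_le_sum fun s _ =>
          mul_le_mul_of_nonneg_right (hμ _ (hcard s)).2 (condWeight_nonneg he0.le he23 D s)
      _ ≤ _ := by
          rw [sum_errWeight_mul_condWeight he0.le he23]
          linarith
  have hcorner : ∑ x, (corner D (τ x)).trace.re = a := by
    have h1 : ∀ x, (corner D (τ x)).trace.re =
        ∑ y, μ #(errSet x y) / 2 ^ n * condWeight e D (errSet x y) := by
      intro x
      rw [trace_corner, Complex.re_sum]
      simp only [hτ, Matrix.sum_apply, Matrix.smul_apply, rhoXYE, vecMulVec_apply, Pi.star_apply,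
        Complex.re_sum, smul_eq_mul, Complex.re_ofReal_mul]
      rw [sum_comm]
      refine sum_congr rfl fun y _ => ?_
      rw [← htp, condWeight, mul_sum]
      refine sum_congr rfl fun i _ => ?_
      rw [Complex.star_def, Complex.mul_conj, Complex.ofReal_re, Complex.normSq_eq_norm_sq,
        norm_eveVec_sq he0.le he23, mul_assoc]
    simp only [h1]
    rw [sum_sum_bitString fun s => μ #s / 2 ^ n * condWeight e D s, mul_sum]
    exact sum_congr rfl fun s _ => by field_simp
  have hrow : ∀ x (i : EveIdx n), ∑ j, ‖τ x i j‖ ^ 2 =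
      ∑ y, (μ #(errSet x y) / 2 ^ n) ^ 2 * ∏ p, condProb e (p ∈ errSet x y) (i p) := by
    intro x i
    rw [hτ, row_sum_norm_sq_sum_rhoXYE he0.le he23]
    refine sum_congr rfl fun y _ => ?_
    rw [norm_eveVec_sq he0.le he23, ← htp]
    ring
  have hform : ∑ x, weightedForm (cornerWeight D) (τ x) (τ x) ≤
      (M2 + 3 * ∑ s : Finset (Fin n), μ #s ^ 2 * condWeight e D s) / 2 ^ n := by
    calc _ ≤ ∑ x, ∑ y, (μ #(errSet x y) / 2 ^ n) ^ 2 * (1 + 3 * condWeight e D (errSet x y)) := by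
          refine sum_le_sum fun x _ => ?_
          refine (weightedForm_cornerWeight_le D (hτpsd x).isHermitian).trans_eq ?_
          simp only [hrow]
          rw [sum_comm, sum_comm (s := D), mul_sum, ← sum_add_distrib]
          refine sum_congr rfl fun y _ => ?_
          rw [← mul_sum, ← mul_sum, sum_prod_condProb (by linarith), condWeight]
          ring
      _ = _ := by
          rw [sum_sum_bitString fun s => (μ #s / 2 ^ n) ^ 2 * (1 + 3 * condWeight e D s), hM2,
            mul_sum, mul_sum, ← sum_add_distrib, sum_div]
          exact sum_congr rfl fun s _ => by field_simp
  have hM1 : 0 < 1 - εbar / 4 := by linarith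
  -- This controls the price of not compressing τ to Dᶜ: D holds no larger share of the purity than
  -- of the trace.
  have hcheb := sum_sq_mul_sum_le (f := condWeight e D)
    (fun s p hp => condWeight_le_insert he0 he hDup hp) (fun k hk => (hμ k hk).1) hμanti
  rw [hμsum, show 1 - εbar / 2 / 2 = 1 - εbar / 4 by ring] at hcheb
  have hM2pos : 0 < M2 := by
    refine lt_of_le_of_ne (sum_nonneg fun s _ => sq_nonneg _) fun h0 => ?_
    have h1 := (sum_eq_zero_iff_of_nonneg fun s _ => sq_nonneg _).1 h0.symm
    have h2 : ∑ s : Finset (Fin n), μ #s = 0 := sum_eq_zero fun s hs => by simpa using h1 s hs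
    rw [hμsum] at h2
    linarith
  have hTrpos : 0 < Tr := lt_of_lt_of_le (by positivity) htau
  have hform2 : ∑ x, weightedForm (cornerWeight D) (τ x) (τ x) ≤
      Tr * (1 + 3 * (a / (1 - εbar / 4))) := by
    have h1 : ∑ s : Finset (Fin n), μ #s ^ 2 * condWeight e D s ≤ M2 * (a / (1 - εbar / 4)) := by
      rw [← mul_div_assoc, le_div_iff₀ hM1]
      exact hcheb
    have h2 : 0 ≤ a := sum_nonneg fun s _ =>
      mul_nonneg (hμ _ (hcard s)).1 (condWeight_nonneg he0.le he23 D s)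
    have h3 : 0 ≤ a / (1 - εbar / 4) := div_nonneg h2 hM1.le
    calc _ ≤ _ := hform
      _ ≤ (M2 + 3 * (M2 * (a / (1 - εbar / 4)))) / 2 ^ n := by gcongr
      _ = M2 / 2 ^ n * (1 + 3 * (a / (1 - εbar / 4))) := by ring
      _ ≤ _ := mul_le_mul_of_nonneg_right htau (by positivity)
  have hDpos' : (0 : ℝ) < #Dᶜ := by exact_mod_cast hDpos
  -- The rate condition, exponentiated; positivity of `Tr` is needed to undo its logarithm.
  have hlen : (2 : ℝ) ^ ℓ * 2 ^ P.leak * #Dᶜ * Tr ≤ 2 ^ (-εbar) * (2 * εPA) ^ 2 := by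
    rw [modRenyiTwo, renyiTwo, ← hTr, hDent] at hrate
    have h1 : (ℓ : ℝ) + P.leak + Real.logb 2 #Dᶜ + Real.logb 2 Tr ≤
        -εbar + 2 * Real.logb 2 (2 * εPA) := by linarith
    have h2 := Real.rpow_le_rpow_of_exponent_le (x := 2) (by norm_num) h1
    have hlog : ∀ z : ℝ, 0 < z → (2 : ℝ) ^ Real.logb 2 z = z := fun z hz =>
      Real.rpow_logb (by norm_num) (by norm_num) hz
    rw [Real.rpow_add two_pos, Real.rpow_add two_pos, Real.rpow_add two_pos, Real.rpow_add two_pos,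
      hlog _ hDpos', hlog _ hTrpos, Real.rpow_natCast, mul_comm 2 (Real.logb _ _),
      Real.rpow_mul two_pos.le, hlog _ (by linarith), Real.rpow_two] at h2
    exact h2
  have hcardK : (Fintype.card (BitString ℓ) : ℝ) = 2 ^ ℓ := by simp
  have hmain := leftover_hash (hash := H.hash) H.prob_nonneg H.prob_sum
    (fun x x' h => by rw [hcardK]; exact hH x x' h) P.prob_nonneg P.prob_sum
    (L := 2 ^ P.leak) P.card_mul_prob_le hτpsd hδpsd hsplit D
  rw [hδtr, hcorner, hcardK] at hmain
  have hsqrt : √((2 : ℝ) ^ ℓ * 2 ^ P.leak * #Dᶜ *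
      ∑ x, weightedForm (cornerWeight D) (τ x) (τ x)) ≤ 2 * εPA * (1 + 3 * εbar / 8) := by
    refine Real.sqrt_le_iff.2 ⟨by positivity, ?_⟩
    have h0 : 0 ≤ 1 + 3 * (a / (1 - εbar / 4)) := by
      have : 0 ≤ a := sum_nonneg fun s _ =>
        mul_nonneg (hμ _ (hcard s)).1 (condWeight_nonneg he0.le he23 D s)
      have := div_nonneg this hM1.le
      linarith
    calc _ ≤ (2 : ℝ) ^ ℓ * 2 ^ P.leak * #Dᶜ * (Tr * (1 + 3 * (a / (1 - εbar / 4)))) :=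
          mul_le_mul_of_nonneg_left hform2 (by positivity)
      _ = (2 : ℝ) ^ ℓ * 2 ^ P.leak * #Dᶜ * Tr * (1 + 3 * (a / (1 - εbar / 4))) := by ring
      _ ≤ 2 ^ (-εbar) * (2 * εPA) ^ 2 * (1 + 3 * (a / (1 - εbar / 4))) :=
          mul_le_mul_of_nonneg_right hlen h0
      _ = (2 * εPA) ^ 2 * (2 ^ (-εbar) * (1 + 3 * (a / (1 - εbar / 4)))) := by ring
      _ ≤ (2 * εPA) ^ 2 * (1 + 3 * εbar / 8) ^ 2 :=
          mul_le_mul_of_nonneg_left (smoothing_loss_le hbar0 hbar1 ha38) (sq_nonneg _)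
      _ = _ := by ring
  have hfin : secrecy e P H ≤ 2 * (εbar / 4) + 2 * a + 2 * εPA * (1 + 3 * εbar / 8) :=
    hmain.trans (by linarith)
  -- By ε_PA ≤ 1, ε̄/2 + 3ε̄/4 + 2ε_PA + 3ε_PA ε̄/4 ≤ 2(ε_PA + ε̄).
  nlinarith [mul_le_mul_of_nonneg_right hPA1 hbar0]

end Secrecy

/-! ### Monotonicity in the QBER: a channel that degrades Eve's systems -/

section DataProcessing

/-- The probabilities of Bob's Pauli errors that turn the QBER `e` into `e'`. -/
def pauliProb (e e' : ℝ) (k : Fin 4) : ℝ :=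
  if k = 0 then 1 - 3 * ((e' - e) / (2 * (1 - 2 * e))) else (e' - e) / (2 * (1 - 2 * e))

theorem pauliProb_nonneg {e e' : ℝ} (hee : e ≤ e') (he' : e' < 1 / 2) (k : Fin 4) :
    0 ≤ pauliProb e e' k := by
  have h1 : 0 < 2 * (1 - 2 * e) := by linarith
  have h2 : 0 ≤ (e' - e) / (2 * (1 - 2 * e)) := div_nonneg (by linarith) h1.le
  have h3 : (e' - e) / (2 * (1 - 2 * e)) ≤ 1 / 4 := by
    rw [div_le_iff₀ h1]
    linarith
  unfold pauliProb
  split_ifs <;> linarith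

theorem sum_pauliProb (e e' : ℝ) : ∑ k, pauliProb e e' k = 1 := by
  rw [Fin.sum_univ_four]
  simp [pauliProb]
  ring

/-- Paulis act on Bell labels by XOR. If each of the three nontrivial ones has probability q, the
QBER becomes e + 2q(1 - 2e), which fixes q. -/
theorem sum_pauliProb_mul_bellWeight {e e' : ℝ} (he : e < 1 / 2) (j : Fin 4) :
    ∑ k, pauliProb e e' k * bellWeight e (j ^^^ k) = bellWeight e' j := by
  have h1 : 1 - 2 * e ≠ 0 := by linarith
  have hx : ∀ j k : Fin 4, (j ^^^ k = 0) ↔ j = k := by decide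
  obtain ⟨q, hq⟩ : ∃ q, q = (e' - e) / (2 * (1 - 2 * e)) := ⟨_, rfl⟩
  have he' : e' = e + q * (2 * (1 - 2 * e)) := by
    rw [hq, div_mul_cancel₀ _ (mul_ne_zero two_ne_zero h1)]
    ring
  simp only [pauliProb, ← hq, bellWeight, hx, Fin.sum_univ_four]
  fin_cases j <;> simp <;> linarith

/-- A Kraus operator on one signal of the channel that degrades Eve's system. -/
def krausAmp (e e' : ℝ) (k i j : Fin 4) : ℝ :=
  if j = i ^^^ k then √(pauliProb e e' k) * √(bellWeight e i) / √(bellWeight e' j) else 0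

/-- Whether the Pauli error `k` flips the bit. -/
def pauliFlip (k : Fin 4) : Bool := decide (k = 2 ∨ k = 3)

/-- The sign that the Pauli error `k` contributes for Alice's bit `a`. -/
def pauliSign (k : Fin 4) (a : Bool) : ℝ := if (k = 1 ∨ k = 3) ∧ a = true then -1 else 1

theorem bellSign_xor (i k : Fin 4) (a b : Bool) :
    bellSign (i ^^^ k) a b = pauliSign k a * bellSign i a (xor b (pauliFlip k)) := by
  fin_cases i <;> fin_cases k <;> cases a <;> cases b <;>
    simp [bellSign, pauliSign, pauliFlip]

theorem sum_krausAmp_mul_eveAmp {e e' : ℝ} (he0' : 0 < e') (he' : e' < 1 / 2) (k i : Fin 4)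
    (a b : Bool) :
    ∑ j, krausAmp e e' k i j * eveAmp e' a b j =
      √(pauliProb e e' k) * pauliSign k a * eveAmp e a (xor b (pauliFlip k)) i := by
  simp only [krausAmp, ite_mul, zero_mul, sum_ite_eq', mem_univ, if_true]
  have h : √(bellWeight e' (i ^^^ k)) ≠ 0 :=
    (Real.sqrt_pos.2 (bellWeight_pos he0' (by linarith) _)).ne'
  rw [eveAmp, eveAmp, bellSign_xor]
  field_simp

/-- Given Eve's label j at QBER e', the squared amplitudes are the posterior probabilities of the
pairs (k, i) with j = i XOR k; they sum to 1. Positivity of e' makes this posterior well defined. -/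
theorem sum_krausAmp_mul_krausAmp {e e' : ℝ} (he0 : 0 ≤ e) (hee : e ≤ e') (he0' : 0 < e')
    (he' : e' < 1 / 2) (j j' : Fin 4) :
    ∑ k, ∑ i, krausAmp e e' k i j * krausAmp e e' k i j' = if j = j' then 1 else 0 := by
  have hx : ∀ i j k : Fin 4, j = i ^^^ k ↔ i = j ^^^ k := by decide
  have hinj : ∀ j j' k : Fin 4, j ^^^ k = j' ^^^ k → j = j' := by decide
  split_ifs with h
  · subst h
    have hpos := bellWeight_pos he0' (by linarith) j
    have h1 : ∀ k, ∑ i, krausAmp e e' k i j * krausAmp e e' k i j =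
        pauliProb e e' k * bellWeight e (j ^^^ k) / bellWeight e' j := by
      intro k
      simp only [krausAmp, hx, mul_ite, mul_zero, ite_mul, zero_mul]
      rw [sum_eq_single (j ^^^ k)]
      · simp only [if_true]
        rw [← mul_div_mul_comm, mul_mul_mul_comm, Real.mul_self_sqrt (pauliProb_nonneg hee he' k),
          Real.mul_self_sqrt (bellWeight_nonneg he0 (by linarith) _), Real.mul_self_sqrt hpos.le]
      · intro i _ hi
        simp [hi]
      · simp
    simp only [h1, ← sum_div, sum_pauliProb_mul_bellWeight (e' := e') (lt_of_le_of_lt hee he')]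
    exact div_self hpos.ne'
  · refine sum_eq_zero fun k _ => sum_eq_zero fun i _ => ?_
    simp only [krausAmp, hx]
    split_ifs with h1 h2
    · exact absurd (hinj _ _ _ (h1.symm.trans h2)) h
    all_goals simp

/-- A Kraus operator of the channel that degrades Eve's `n` systems. -/
def krausOp (e e' : ℝ) {n : ℕ} (κ : EveIdx n) : Matrix (EveIdx n) (EveIdx n) ℂ :=
  of fun i j => ((∏ p, krausAmp e e' (κ p) (i p) (j p) : ℝ) : ℂ)

theorem sum_krausOp {e e' : ℝ} (he0 : 0 ≤ e) (hee : e ≤ e') (he0' : 0 < e') (he' : e' < 1 / 2)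
    (n : ℕ) : ∑ κ : EveIdx n, (krausOp e e' κ)ᴴ * krausOp e e' κ = 1 := by
  ext j j'
  have h : (∑ κ : EveIdx n, (krausOp e e' κ)ᴴ * krausOp e e' κ) j j' =
      ((∏ p, ∑ k, ∑ i, krausAmp e e' k i (j p) * krausAmp e e' k i (j' p) : ℝ) : ℂ) := by
    rw [← sum_prod_pi fun p k => ∑ i, krausAmp e e' k i (j p) * krausAmp e e' k i (j' p)]
    simp only [Matrix.sum_apply, Matrix.mul_apply, conjTranspose_apply, krausOp, of_apply,
      Complex.star_def, Complex.conj_ofReal, ← Complex.ofReal_mul, ← Complex.ofReal_sum,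
      ← prod_mul_distrib]
    congr 1
    refine sum_congr rfl fun κ _ => ?_
    rw [sum_prod_pi fun p i => krausAmp e e' (κ p) i (j p) * krausAmp e e' (κ p) i (j' p)]
  rw [h]
  simp only [sum_krausAmp_mul_krausAmp he0 hee he0' he']
  by_cases hj : j = j'
  · subst hj
    simp
  · rw [one_apply_ne hj]
    obtain ⟨p, hp⟩ := Function.ne_iff.1 hj
    rw [prod_eq_zero (mem_univ p) (if_neg hp), Complex.ofReal_zero]

theorem krausOp_mulVec_eveVec {e e' : ℝ} (he0' : 0 < e') (he' : e' < 1 / 2) {n : ℕ}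
    (κ : EveIdx n) (x y : BitString n) :
    krausOp e e' κ *ᵥ eveVec e' x y =
      ((∏ p, √(pauliProb e e' (κ p)) * pauliSign (κ p) (x p) : ℝ) : ℂ) •
        eveVec e x fun p => xor (y p) (pauliFlip (κ p)) := by
  ext i
  simp only [mulVec, dotProduct, krausOp, of_apply, eveVec_eq, Pi.smul_apply, smul_eq_mul,
    ← Complex.ofReal_mul, ← Complex.ofReal_sum, ← prod_mul_distrib]
  rw [sum_prod_pi fun p j => krausAmp e e' (κ p) (i p) j * eveAmp e' (x p) (y p) j]
  simp only [sum_krausAmp_mul_eveAmp he0' he']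

/-- The phase part of a Pauli error shows only as a sign depending on x, which squares away; its
flip part shifts Bob's string. -/
theorem krausOp_mul_rhoXYE {e e' : ℝ} (hee : e ≤ e') (he0' : 0 < e') (he' : e' < 1 / 2) {n : ℕ}
    (κ : EveIdx n) (x y : BitString n) :
    krausOp e e' κ * rhoXYE e' x y * (krausOp e e' κ)ᴴ =
      ((∏ p, pauliProb e e' (κ p) : ℝ) : ℂ) •
        rhoXYE e x fun p => xor (y p) (pauliFlip (κ p)) := by
  rw [rhoXYE, mul_vecMulVec, vecMulVec_mul, ← star_mulVec, krausOp_mulVec_eveVec he0' he', star_smul,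
    smul_vecMulVec, vecMulVec_smul, smul_smul, rhoXYE]
  congr 1
  rw [Complex.star_def, Complex.conj_ofReal, ← Complex.ofReal_mul, ← prod_mul_distrib]
  congr 1
  refine prod_congr rfl fun p _ => ?_
  rw [mul_mul_mul_comm, Real.mul_self_sqrt (pauliProb_nonneg hee he' _)]
  unfold pauliSign
  split_ifs <;> ring

/-- Bob's string is summed over, so flips only permute the terms; Alice's string is untouched, so
the channel commutes with hashing and with the transcript. -/
theorem sum_krausOp_mul_rhoXE {e e' : ℝ} (hee : e ≤ e') (he0' : 0 < e') (he' : e' < 1 / 2) {n : ℕ}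
    (x : BitString n) :
    ∑ κ : EveIdx n, krausOp e e' κ * rhoXE e' x * (krausOp e e' κ)ᴴ = rhoXE e x := by
  have h : ∀ κ : EveIdx n, krausOp e e' κ * rhoXE e' x * (krausOp e e' κ)ᴴ =
      ((∏ p, pauliProb e e' (κ p) : ℝ) : ℂ) • rhoXE e x := by
    intro κ
    have hinv : Function.Involutive fun y : BitString n => fun p => xor (y p) (pauliFlip (κ p)) := by
      intro y
      ext p
      simp
    rw [rhoXE, Matrix.mul_sum, Matrix.sum_mul, rhoXE, smul_sum]
    simp only [krausOp_mul_rhoXYE hee he0' he']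
    exact Equiv.sum_comp hinv.toPerm
      fun y => ((∏ p, pauliProb e e' (κ p) : ℝ) : ℂ) • rhoXYE e x y
  simp only [h]
  rw [← sum_smul, ← Complex.ofReal_sum, sum_prod_pi fun _ k => pauliProb e e' k]
  simp [sum_pauliProb]

theorem rhoXE_posSemidef (e : ℝ) {n : ℕ} (x : BitString n) : (rhoXE e x).PosSemidef :=
  posSemidef_sum _ fun y _ => rhoXYE_posSemidef e x y

/-- A smaller QBER makes the key more secret. -/
theorem secrecy_mono {e e' : ℝ} (he0 : 0 ≤ e) (hee : e ≤ e') (he0' : 0 < e') (he' : e' < 1 / 2)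
    {n ℓ : ℕ} (P : ECProtocol n) (H : HashFamily n ℓ) : secrecy e P H ≤ secrecy e' P H := by
  refine sum_le_sum fun f _ => sum_le_sum fun c _ => sum_le_sum fun k _ =>
    mul_le_mul_of_nonneg_left ?_ (H.prob_nonneg f)
  have h := traceNorm_kraus_le (sum_krausOp he0 hee he0' he' n)
    (A := ∑ x, ((keyBias (H.hash f) k x * P.prob x c : ℝ) : ℂ) • rhoXE e' x)
    (isHermitian_sum _ fun x _ => IsHermitian.real_smul _ (rhoXE_posSemidef e' x).isHermitian)
  refine le_trans (le_of_eq (congrArg traceNorm ?_)) h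
  simp only [Matrix.mul_sum, Matrix.sum_mul, mul_smul_comm, smul_mul_assoc]
  rw [sum_comm]
  refine sum_congr rfl fun x _ => ?_
  rw [← smul_sum, sum_krausOp_mul_rhoXE hee he0' he']

end DataProcessing

/-! ### From secrecy of Alice's key to security of the protocol -/

section Protocol

/-- The uniform distribution on all functions works: resampling the value at x gives collision
probability exactly 2^{-ℓ}. -/
theorem exists_isTwoUniversal (n ℓ : ℕ) : ∃ H : HashFamily n ℓ, H.IsTwoUniversal := by
  set M : ℝ := ((Fintype.card (BitString n → BitString ℓ) : ℕ) : ℝ) with hM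
  have hM0 : 0 < M := by
    rw [hM]
    exact_mod_cast Fintype.card_pos
  refine ⟨⟨BitString n → BitString ℓ, inferInstance, fun _ => 1 / M, fun _ => by positivity, ?_,
    fun f x => f x⟩, fun x x' hne => ?_⟩
  · rw [sum_const, card_univ, nsmul_eq_mul, ← hM]
    field_simp
  · have h := sum_sum_update x fun f : BitString n → BitString ℓ => if f x = f x' then 1 / M else 0
    simp only [Function.update_self, Function.update_of_ne hne.symm, sum_ite_eq', mem_univ,
      if_true, sum_const, card_univ, nsmul_eq_mul] at h
    rw [← hM, mul_one_div_cancel hM0.ne'] at h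
    have hB : (Fintype.card (BitString ℓ) : ℝ) = 2 ^ ℓ := by simp
    rw [hB] at h
    refine le_of_eq ?_
    rw [eq_div_iff (by positivity), mul_comm]
    exact h.symm

variable {n ℓ : ℕ}

open Classical in
/-- The block of the real state with given values of the keys, the transcript and the hash
function, where `q` is the probability of the outcome of the parameter estimation. -/
def realBlock (e q : ℝ) (P : ECProtocol n) (H : HashFamily n ℓ) (kA kB : BitString ℓ) (c : P.C)
    (f : H.F) : Matrix (EveIdx n) (EveIdx n) ℂ :=
  ∑ x, ∑ y,
    if H.hash f x = kA ∧ H.hash f (P.decode c y) = kB then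
      ((q * H.prob f * P.prob x c : ℝ) : ℂ) • rhoXYE e x y
    else 0

open Classical in
/-- The block of the ideal state. -/
def idealBlock (e q : ℝ) (P : ECProtocol n) (H : HashFamily n ℓ) (kA kB : BitString ℓ) (c : P.C)
    (f : H.F) : Matrix (EveIdx n) (EveIdx n) ℂ :=
  if kA = kB then
    ((1 / 2 ^ ℓ : ℝ) : ℂ) •
      ∑ x, ∑ y, ((q * H.prob f * P.prob x c : ℝ) : ℂ) • rhoXYE e x y
  else 0

/-- Twice the trace distance of the real and the ideal state, for one outcome of the parameter
estimation. -/
def blockDist (e q : ℝ) (P : ECProtocol n) (H : HashFamily n ℓ) : ℝ :=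
  ∑ kA, ∑ kB, ∑ c, ∑ f, traceNorm (realBlock e q P H kA kB c f - idealBlock e q P H kA kB c f)

/-- The matrix `∑_{x,y} q h(f) P(c|x) d(x,y) ρ_{xy}`. -/
def coeffBlock (e q : ℝ) (P : ECProtocol n) (H : HashFamily n ℓ) (c : P.C) (f : H.F)
    (d : BitString n → BitString n → ℝ) : Matrix (EveIdx n) (EveIdx n) ℂ :=
  ∑ x, ∑ y, ((q * H.prob f * P.prob x c * d x y : ℝ) : ℂ) • rhoXYE e x y

theorem realBlock_eq (e q : ℝ) (P : ECProtocol n) (H : HashFamily n ℓ) (kA kB : BitString ℓ)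
    (c : P.C) (f : H.F) :
    realBlock e q P H kA kB c f = coeffBlock e q P H c f fun x y =>
      (if H.hash f x = kA then 1 else 0) * if H.hash f (P.decode c y) = kB then 1 else 0 := by
  refine sum_congr rfl fun x _ => sum_congr rfl fun y _ => ?_
  by_cases h1 : H.hash f x = kA <;> by_cases h2 : H.hash f (P.decode c y) = kB <;> simp [h1, h2]

theorem idealBlock_eq (e q : ℝ) (P : ECProtocol n) (H : HashFamily n ℓ) (kA kB : BitString ℓ)
    (c : P.C) (f : H.F) :
    idealBlock e q P H kA kB c f = coeffBlock e q P H c f fun _ _ =>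
      if kA = kB then 1 / Fintype.card (BitString ℓ) else 0 := by
  have hB : (Fintype.card (BitString ℓ) : ℝ) = 2 ^ ℓ := by simp
  rw [hB, idealBlock, coeffBlock]
  split_ifs with h
  · simp only [smul_sum, smul_smul, ← Complex.ofReal_mul]
    refine sum_congr rfl fun x _ => sum_congr rfl fun y _ => ?_
    rw [mul_comm]
  · simp

theorem coeffBlock_sub (e q : ℝ) (P : ECProtocol n) (H : HashFamily n ℓ) (c : P.C) (f : H.F)
    (d d' : BitString n → BitString n → ℝ) :
    coeffBlock e q P H c f d - coeffBlock e q P H c f d' =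
      coeffBlock e q P H c f fun x y => d x y - d' x y := by
  simp only [coeffBlock, ← sum_sub_distrib, ← sub_smul, ← Complex.ofReal_sub, mul_sub]

theorem coeffBlock_isHermitian (e q : ℝ) (P : ECProtocol n) (H : HashFamily n ℓ) (c : P.C)
    (f : H.F) (d : BitString n → BitString n → ℝ) : (coeffBlock e q P H c f d).IsHermitian :=
  isHermitian_sum _ fun x _ => isHermitian_sum _ fun y _ =>
    IsHermitian.real_smul _ (rhoXYE_posSemidef e x y).isHermitian

theorem trace_rhoXYE_re_nonneg (e : ℝ) (x y : BitString n) : 0 ≤ (rhoXYE e x y).trace.re :=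
  (Complex.le_def.1 (rhoXYE_posSemidef e x y).trace_nonneg).1

/-- By the triangle inequality, a bound on the key registers that is classical, for each (x, y, c),
passes to the quantum states. -/
theorem sum_traceNorm_coeffBlock_le (e : ℝ) {q : ℝ} (hq : 0 ≤ q) (P : ECProtocol n)
    (H : HashFamily n ℓ)
    {d : BitString ℓ → BitString ℓ → P.C → H.F → BitString n → BitString n → ℝ}
    {g : BitString n → BitString n → P.C → ℝ}
    (hd : ∀ c f x y, ∑ kA, ∑ kB, |d kA kB c f x y| ≤ g x y c) :
    ∑ kA, ∑ kB, ∑ c, ∑ f, traceNorm (coeffBlock e q P H c f (d kA kB c f)) ≤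
      q * ∑ x, ∑ y, ∑ c, g x y c * ((rhoXYE e x y).trace.re * P.prob x c) := by
  have h1 : ∀ kA kB c f, traceNorm (coeffBlock e q P H c f (d kA kB c f)) ≤
      ∑ x, ∑ y, q * H.prob f * P.prob x c * (rhoXYE e x y).trace.re * |d kA kB c f x y| := by
    intro kA kB c f
    refine (traceNorm_sum_le _ fun x => isHermitian_sum _ fun y _ =>
      IsHermitian.real_smul _ (rhoXYE_posSemidef e x y).isHermitian).trans ?_
    refine sum_le_sum fun x _ => ?_
    refine (traceNorm_sum_smul_le _ _ fun y => rhoXYE_posSemidef e x y).trans_eq ?_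
    refine sum_congr rfl fun y _ => ?_
    rw [abs_mul, abs_of_nonneg (mul_nonneg (mul_nonneg hq (H.prob_nonneg f)) (P.prob_nonneg x c))]
    ring
  calc _ ≤ ∑ kA, ∑ kB, ∑ c, ∑ f, ∑ x, ∑ y,
        q * H.prob f * P.prob x c * (rhoXYE e x y).trace.re * |d kA kB c f x y| :=
        sum_le_sum fun kA _ => sum_le_sum fun kB _ => sum_le_sum fun c _ => sum_le_sum fun f _ =>
          h1 kA kB c f
    _ = ∑ c, ∑ f, ∑ x, ∑ y, q * H.prob f * P.prob x c * (rhoXYE e x y).trace.re *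
          ∑ kA, ∑ kB, |d kA kB c f x y| := by
        rw [sum_sum_comm]
        refine sum_congr rfl fun c _ => sum_congr rfl fun f _ => ?_
        rw [sum_sum_comm]
        simp only [mul_sum]
    _ ≤ ∑ c, ∑ f, ∑ x, ∑ y, q * H.prob f * P.prob x c * (rhoXYE e x y).trace.re * g x y c :=
        sum_le_sum fun c _ => sum_le_sum fun f _ => sum_le_sum fun x _ => sum_le_sum fun y _ =>
          mul_le_mul_of_nonneg_left (hd c f x y) (mul_nonneg (mul_nonneg (mul_nonneg hq
            (H.prob_nonneg f)) (P.prob_nonneg x c)) (trace_rhoXYE_re_nonneg e x y))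
    _ = ∑ c, ∑ x, ∑ y, (∑ f, H.prob f) *
          (q * (g x y c * ((rhoXYE e x y).trace.re * P.prob x c))) := by
        refine sum_congr rfl fun c _ => ?_
        rw [sum_comm]
        refine sum_congr rfl fun x _ => ?_
        rw [sum_comm]
        refine sum_congr rfl fun y _ => ?_
        rw [sum_mul]
        exact sum_congr rfl fun f _ => by ring
    _ = _ := by
        simp only [H.prob_sum, one_mul, mul_sum]
        rw [sum_comm]
        refine sum_congr rfl fun x _ => ?_
        rw [sum_comm]

theorem sum_indicator_mul {ℓ : ℕ} (a b : BitString ℓ) :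
    ∑ kA, ∑ kB, |(if a = kA then (1 : ℝ) else 0) * if b = kB then 1 else 0| = 1 := by
  have : ∀ kA kB : BitString ℓ, |(if a = kA then (1 : ℝ) else 0) * if b = kB then 1 else 0| =
      (if a = kA then (1 : ℝ) else 0) * if b = kB then 1 else 0 := fun kA kB =>
    abs_of_nonneg (by split_ifs <;> norm_num)
  simp only [this, ← mul_sum, sum_ite_eq, mem_univ, if_true, mul_one]

theorem blockDist_le_two_mul {e : ℝ} (he0 : 0 ≤ e) (he : e ≤ 2 / 3) {q : ℝ} (hq : 0 ≤ q)
    (P : ECProtocol n) (H : HashFamily n ℓ) : blockDist e q P H ≤ 2 * q := by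
  unfold blockDist
  simp only [realBlock_eq, idealBlock_eq, coeffBlock_sub]
  refine (sum_traceNorm_coeffBlock_le e hq P H (g := fun _ _ _ => 2) fun c f x y => ?_).trans_eq ?_
  · calc _ ≤ ∑ kA : BitString ℓ, ∑ kB : BitString ℓ, (|(if H.hash f x = kA then (1 : ℝ) else 0) *
          if H.hash f (P.decode c y) = kB then 1 else 0| +
            |if kA = kB then 1 / (Fintype.card (BitString ℓ) : ℝ) else 0|) :=
          sum_le_sum fun kA _ => sum_le_sum fun kB _ => abs_sub _ _
      _ = 2 := by
          simp only [sum_add_distrib, sum_indicator_mul]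
          have h : ∀ kA kB : BitString ℓ, |if kA = kB then 1 / (Fintype.card (BitString ℓ) : ℝ) else 0|
              = if kA = kB then 1 / (Fintype.card (BitString ℓ) : ℝ) else 0 := fun kA kB =>
            abs_of_nonneg (by split_ifs <;> positivity)
          simp only [h, sum_ite_eq, mem_univ, if_true, sum_const, card_univ, nsmul_eq_mul]
          rw [mul_one_div_cancel (by simp)]
          norm_num
  · have h : ∀ x y : BitString n, ∑ c, 2 * ((rhoXYE e x y).trace.re * P.prob x c) =
        2 * outcomeProb e x y := by
      intro x y
      rw [← mul_sum, ← mul_sum, P.prob_sum, mul_one, trace_rhoXYE he0 he, Complex.ofReal_re]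
    simp only [h, ← mul_sum, sum_outcomeProb]
    ring

/-- There is only one string of length 0, so an aborted run coincides with its ideal counterpart and
costs nothing. -/
theorem blockDist_eq_zero (e q : ℝ) (P : ECProtocol n) (H : HashFamily n 0) :
    blockDist e q P H = 0 := by
  refine sum_eq_zero fun kA _ => sum_eq_zero fun kB _ => sum_eq_zero fun c _ =>
    sum_eq_zero fun f _ => ?_
  have h : ∀ k k' : BitString 0, k = k' := fun k k' => Subsingleton.elim k k'
  rw [realBlock_eq, idealBlock_eq, coeffBlock_sub]
  have : coeffBlock e q P H c f (fun x y => ((if H.hash f x = kA then (1 : ℝ) else 0) *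
      if H.hash f (P.decode c y) = kB then 1 else 0) -
        if kA = kB then 1 / (Fintype.card (BitString 0) : ℝ) else 0) = 0 := by
    refine sum_eq_zero fun x _ => sum_eq_zero fun y _ => ?_
    beta_reduce
    rw [if_pos (h (H.hash f x) kA), if_pos (h (H.hash f (P.decode c y)) kB), if_pos (h kA kB)]
    simp
  rw [this, traceNorm_zero]

theorem sum_abs_indicator_sub_le (a b : BitString ℓ) :
    ∑ kA, ∑ kB, |((if a = kA then (1 : ℝ) else 0) * if b = kB then 1 else 0) -
      (if a = kA then (1 : ℝ) else 0) * if a = kB then 1 else 0| ≤ 2 := by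
  calc _ ≤ ∑ kA, ∑ kB, (|(if a = kA then (1 : ℝ) else 0) * if b = kB then 1 else 0| +
      |(if a = kA then (1 : ℝ) else 0) * if a = kB then 1 else 0|) :=
        sum_le_sum fun kA _ => sum_le_sum fun kB _ => abs_sub _ _
    _ = 2 := by
        simp only [sum_add_distrib, sum_indicator_mul]
        norm_num

/-- Security splits into correctness and secrecy of Alice's key. -/
theorem blockDist_le (e : ℝ) {q : ℝ} (hq : 0 ≤ q) (P : ECProtocol n) (H : HashFamily n ℓ) :
    blockDist e q P H ≤ 2 * (q * P.failProb e) + q * secrecy e P H := by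
  have hsplit : ∀ kA kB c f, traceNorm (realBlock e q P H kA kB c f - idealBlock e q P H kA kB c f) ≤
      traceNorm (coeffBlock e q P H c f fun x y =>
        ((if H.hash f x = kA then (1 : ℝ) else 0) *
          if H.hash f (P.decode c y) = kB then 1 else 0) -
        (if H.hash f x = kA then (1 : ℝ) else 0) * if H.hash f x = kB then 1 else 0) +
      if kA = kB then traceNorm (coeffBlock e q P H c f fun x _ => keyBias (H.hash f) kA x)
        else 0 := by
    intro kA kB c f
    -- The intermediate state gives both parties the hash of Alice's string: its distance from the
    -- real state is governed by decoding failure, that from the ideal state by secrecy.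
    rw [realBlock_eq, idealBlock_eq, ← sub_add_sub_cancel _ (coeffBlock e q P H c f fun x _ =>
      (if H.hash f x = kA then (1 : ℝ) else 0) * if H.hash f x = kB then 1 else 0),
      coeffBlock_sub, coeffBlock_sub]
    refine (traceNorm_add_le (coeffBlock_isHermitian _ _ _ _ _ _ _)
      (coeffBlock_isHermitian _ _ _ _ _ _ _)).trans (add_le_add le_rfl ?_)
    split_ifs with h
    · subst h
      refine le_of_eq ?_
      congr 2
      ext x y
      rw [keyBias]
      split_ifs <;> simp
    · have h0 : ∀ x, ((if H.hash f x = kA then (1 : ℝ) else 0) *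
          if H.hash f x = kB then 1 else 0) = 0 := by
        intro x
        split_ifs with h1 h2
        · exact absurd (h1.symm.trans h2) h
        all_goals simp
      simp [h0, coeffBlock, traceNorm_zero]
  have hcorr : ∑ kA, ∑ kB, ∑ c, ∑ f, traceNorm (coeffBlock e q P H c f fun x y =>
        ((if H.hash f x = kA then (1 : ℝ) else 0) *
          if H.hash f (P.decode c y) = kB then 1 else 0) -
        (if H.hash f x = kA then (1 : ℝ) else 0) * if H.hash f x = kB then 1 else 0) ≤
      2 * (q * P.failProb e) := by
    refine (sum_traceNorm_coeffBlock_le e hq P H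
      (g := fun x y c => if P.decode c y = x then 0 else 2) fun c f x y => ?_).trans_eq ?_
    · split_ifs with h
      · simp [h]
      · exact sum_abs_indicator_sub_le _ _
    · rw [ECProtocol.failProb, mul_left_comm]
      simp only [mul_sum]
      refine sum_congr rfl fun x _ => sum_congr rfl fun y _ => sum_congr rfl fun c _ => ?_
      split_ifs <;> simp
  have hsec : ∑ kA : BitString ℓ, ∑ kB, ∑ c, ∑ f, (if kA = kB then
      traceNorm (coeffBlock e q P H c f fun x _ => keyBias (H.hash f) kA x) else 0) =
      q * secrecy e P H := by
    have h1 : ∀ k c f, traceNorm (coeffBlock e q P H c f fun x _ => keyBias (H.hash f) k x) =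
        q * (H.prob f * traceNorm
          (∑ x, ((keyBias (H.hash f) k x * P.prob x c : ℝ) : ℂ) • rhoXE e x)) := by
      intro k c f
      have h2 : coeffBlock e q P H c f (fun x _ => keyBias (H.hash f) k x) =
          ((q * H.prob f : ℝ) : ℂ) •
            ∑ x, ((keyBias (H.hash f) k x * P.prob x c : ℝ) : ℂ) • rhoXE e x := by
        simp only [coeffBlock, rhoXE, smul_sum, smul_smul, ← Complex.ofReal_mul]
        refine sum_congr rfl fun x _ => sum_congr rfl fun y _ => ?_
        congr 2
        ring
      rw [h2, traceNorm_smul _ (isHermitian_sum _ fun x _ =>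
        IsHermitian.real_smul _ (rhoXE_posSemidef e x).isHermitian),
        abs_of_nonneg (mul_nonneg hq (H.prob_nonneg f)), mul_assoc]
    have h3 : ∀ kA : BitString ℓ, ∑ kB, ∑ c, ∑ f, (if kA = kB then
        traceNorm (coeffBlock e q P H c f fun x _ => keyBias (H.hash f) kA x) else 0) =
        ∑ c, ∑ f, traceNorm (coeffBlock e q P H c f fun x _ => keyBias (H.hash f) kA x) := by
      intro kA
      rw [sum_eq_single kA]
      · simp
      · intro kB _ hne
        simp [hne.symm]
      · simp
    rw [sum_congr rfl fun kA _ => h3 kA]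
    simp only [h1, secrecy, mul_sum]
    rw [sum_comm, sum_congr rfl fun c _ => sum_comm, sum_comm]
  calc _ ≤ _ := sum_le_sum fun kA _ => sum_le_sum fun kB _ => sum_le_sum fun c _ =>
        sum_le_sum fun f _ => hsplit kA kB c f
    _ ≤ _ := by
        simp only [sum_add_distrib]
        exact add_le_add hcorr hsec.le

theorem traceNorm_realState_sub_idealState {T : Type} [Fintype T] {ℓ : T → ℕ} (e : ℝ) (p : T → ℝ)
    (EC : T → ECProtocol n) (H : ∀ t, HashFamily n (ℓ t)) :
    traceNorm (realState e p EC H - idealState e p EC H) =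
      ∑ t, blockDist e (p t) (EC t) (H t) := by
  classical
  have hherm : ∀ r : Registers EC H,
      (realBlock e (p r.1) (EC r.1) (H r.1) r.2.1 r.2.2.1 r.2.2.2.1 r.2.2.2.2 -
        idealBlock e (p r.1) (EC r.1) (H r.1) r.2.1 r.2.2.1 r.2.2.2.1 r.2.2.2.2).IsHermitian := by
    intro r
    rw [realBlock_eq, idealBlock_eq, coeffBlock_sub]
    exact coeffBlock_isHermitian _ _ _ _ _ _ _
  have h : realState e p EC H - idealState e p EC H = blockDiagonal fun r : Registers EC H =>
      realBlock e (p r.1) (EC r.1) (H r.1) r.2.1 r.2.2.1 r.2.2.2.1 r.2.2.2.2 -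
        idealBlock e (p r.1) (EC r.1) (H r.1) r.2.1 r.2.2.1 r.2.2.2.1 r.2.2.2.2 := by
    rw [realState, idealState, ← blockDiagonal_sub]
    rfl
  rw [h, traceNorm_blockDiagonal hherm]
  simp only [Fintype.sum_sigma, Fintype.sum_prod_type, blockDist]

/-- Strict positivity is needed because the degrading channel divides by the Bell weights at the
estimated QBER; the true QBER may be 0. -/
theorem qberEst_pos {eM εPE : ℝ} {m : ℕ} (hm : 1 ≤ m) (heM : 0 ≤ eM) (hPE : 0 < εPE)
    (hPE1 : εPE < 1) : 0 < qberEst eM εPE m := by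
  have hm' : (0 : ℝ) < m := by exact_mod_cast hm
  have h1 : 0 < Real.log (1 / εPE) := Real.log_pos ((one_lt_div hPE).2 hPE1)
  have h2 : 0 ≤ Real.log ((m : ℝ) + 1) := Real.log_nonneg (by linarith)
  have h3 : 0 < zeta εPE m := Real.sqrt_pos.2 (div_pos (by linarith) (by linarith))
  unfold qberEst
  linarith

theorem ECProtocol.failProb_nonneg (P : ECProtocol n) (e : ℝ) : 0 ≤ P.failProb e := by
  refine sum_nonneg fun x _ => sum_nonneg fun y _ => sum_nonneg fun c _ => ?_
  split_ifs
  · exact le_rfl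
  · exact mul_nonneg (trace_rhoXYE_re_nonneg e x y) (P.prob_nonneg x c)

theorem secrecy_le_of_div_le_keyRate {N : ℕ} (hn : 1 ≤ n) (hnN : n ≤ N)
    {εPA εEC εbar fEC e e' : ℝ} (hPA : 0 < εPA) (hPA1 : εPA ≤ 1) (hbar : 0 ≤ εbar)
    (hbar1 : εbar ≤ 1) (he0 : 0 ≤ e) (hee : e ≤ e') (he0' : 0 < e') (he' : e' < 1 / 2)
    (P : ECProtocol n) (H : HashFamily n ℓ) (hH : H.IsTwoUniversal)
    (hleak : P.leak ≤ leakEC fEC n e' εEC)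
    (hrate : (ℓ : ℝ) / N ≤ keyRate N n fEC εPA εEC εbar e') :
    secrecy e P H / 2 ≤ εPA + εbar := by
  have hN : (0 : ℝ) < N := by exact_mod_cast (show 0 < N by omega)
  have h1 := secrecy_mono he0 hee he0' he' P H
  rw [keyRate, div_eq_mul_one_div, mul_comm] at hrate
  have h2 := le_of_mul_le_mul_left hrate (one_div_pos.2 hN)
  have h3 := secrecy_le he0' he' hn P H hH hbar hbar1 hPA hPA1 (by linarith)
  linarith

end Protocol

end QKD

end

theorem mainTheorem3 (N n m : ℕ) (hn : 1 ≤ n) (hnN : n ≤ N) (hm : 1 ≤ m)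
    (εPE εPA εEC εbar fEC : ℝ) (hPE : 0 < εPE) (hPA : 0 < εPA) (hEC : 0 < εEC) (hbar : 0 ≤ εbar)
    -- the true QBER of the signals
    (e : ℝ) (he0 : 0 ≤ e) (he : e ≤ 2 / 3)
    -- the outcomes of the parameter estimation, their distribution, and the measured QBER
    (T : Type) [Fintype T] (p : T → ℝ) (hp : ∀ t, 0 ≤ p t) (hp1 : ∑ t, p t = 1)
    (eM : T → ℝ) (heM : ∀ t, 0 ≤ eM t)
    (hest : 1 - εPE ≤ ∑ t, open Classical in if e ≤ QKD.qberEst (eM t) εPE m then p t else 0)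
    -- the key length and the error correction protocol used after outcome `t`;
    -- length zero means that no key is produced
    (ℓ : T → ℕ) (EC : T → QKD.ECProtocol n)
    (hℓ : ∀ t, ℓ t ≠ 0 → QKD.qberEst (eM t) εPE m < 1 / 2 ∧
      (EC t).leak ≤ QKD.leakEC fEC n (QKD.qberEst (eM t) εPE m) εEC ∧
      (ℓ t : ℝ) / N ≤ QKD.keyRate N n fEC εPA εEC εbar (QKD.qberEst (eM t) εPE m))
    (hfail : ∑ t, (if ℓ t = 0 then 0 else p t * (EC t).failProb e) ≤ εEC) :
    (∀ t, ∃ H : QKD.HashFamily n (ℓ t), H.IsTwoUniversal) ∧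
      ∀ H : ∀ t, QKD.HashFamily n (ℓ t), (∀ t, (H t).IsTwoUniversal) →
        QKD.IsSecure (εPE + εPA + εbar + εEC) e p EC H := by
  classical
  refine ⟨fun t => QKD.exists_isTwoUniversal n (ℓ t), fun H hH => ?_⟩
  rw [QKD.IsSecure, QKD.traceNorm_realState_sub_idealState]
  -- If one of these is at least 1, the trivial bound on the trace distance suffices; otherwise they
  -- are small enough for the hashing estimates.
  by_cases htriv : 1 ≤ εPE ∨ 1 ≤ εPA ∨ 1 ≤ εbar
  · have h1 : ∑ t, QKD.blockDist e (p t) (EC t) (H t) ≤ ∑ t, 2 * p t :=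
      Finset.sum_le_sum fun t _ => QKD.blockDist_le_two_mul he0 he (hp t) (EC t) (H t)
    rw [← Finset.mul_sum, hp1] at h1
    rcases htriv with h | h | h <;> linarith
  · push Not at htriv
    obtain ⟨hPE1, hPA1, hbar1⟩ := htriv
    -- The three summands charge, for each t, a bad estimate, a decoding failure, and the secrecy
    -- defect.
    have hterm : ∀ t, QKD.blockDist e (p t) (EC t) (H t) ≤
        2 * (p t - if e ≤ QKD.qberEst (eM t) εPE m then p t else 0) +
        2 * (if ℓ t = 0 then 0 else p t * (EC t).failProb e) + 2 * (p t * (εPA + εbar)) := by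
      intro t
      have hkey : 0 ≤ p t * (εPA + εbar) := mul_nonneg (hp t) (by linarith)
      have hf : 0 ≤ p t * (EC t).failProb e := mul_nonneg (hp t) ((EC t).failProb_nonneg e)
      by_cases h0 : ℓ t = 0
      · have hz : QKD.blockDist e (p t) (EC t) (H t) = 0 := by
          -- The length is generalized because `ℓ t` is not a variable and cannot be substituted in
          -- the type of `H t`.
          have hgen : ∀ (l : ℕ) (H' : QKD.HashFamily n l), l = 0 →
              QKD.blockDist e (p t) (EC t) H' = 0 := by
            rintro l H' rfl
            exact QKD.blockDist_eq_zero e (p t) (EC t) H'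
          exact hgen _ _ h0
        rw [hz, if_pos h0]
        have : 0 ≤ p t - if e ≤ QKD.qberEst (eM t) εPE m then p t else 0 := by
          split_ifs
          · simp
          · simpa using hp t
        linarith
      · rw [if_neg h0]
        split_ifs with hee
        · obtain ⟨h1, h2, h3⟩ := hℓ t h0
          have hs := QKD.secrecy_le_of_div_le_keyRate hn hnN hPA hPA1.le hbar hbar1.le he0 hee
            (QKD.qberEst_pos hm (heM t) hPE hPE1) h1 (EC t) (H t) (hH t) h2 h3
          have hb := QKD.blockDist_le e (hp t) (EC t) (H t)
          have hs' := mul_le_mul_of_nonneg_left hs (hp t)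
          linarith
        · have := QKD.blockDist_le_two_mul he0 he (hp t) (EC t) (H t)
          linarith
    have hsum := Finset.sum_le_sum fun t (_ : t ∈ Finset.univ) => hterm t
    simp only [Finset.sum_add_distrib, ← Finset.mul_sum, Finset.sum_sub_distrib, ← Finset.sum_mul,
      hp1] at hsum
    have hest' : 1 - εPE ≤ ∑ t, if e ≤ QKD.qberEst (eM t) εPE m then p t else 0 := by
      convert hest
    linarith
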